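/- **Setting.** Let $0<H<1$, $H\ne\frac12$, and let $\gamma\neq0$ satisfy $\gamma^2<\frac18$. Let $\varphi:\mathbb R\to\mathbb R$ be an even cut-off function (a Schwartz function, for instance smooth and compactly supported) with $\varphi(0)\ne 0$, and put $\phi(x)=\varphi(x)|x|^{H-1/2}$. For $0<\epsilon\le 1$ let $|\cdot|_\epsilon$ be a regularization of the absolute value (continuous, even, positive on $\mathbb R$, with $|x|_\epsilon\ge c|x|$ for some $c>0$ not depending on $\epsilon,x$, and $|x|_\epsilon\to|x|$ as $\epsilon\to0$; e.g. $|x|_\epsilon^2=x^2+\epsilon^2$), and put $k_\epsilon(x)=\frac{x}{|x|_\epsilon^{3/2}}1_{|x|\le1}$. Let $\widehat X_\epsilon$ be a continuous, centered, stationary Gaussian field on $\mathbb R$ which regularizes the log-correlated field: $\widehat C_\epsilon(x)=\mathbb E[\widehat X_\epsilon(x)\widehat X_\epsilon(0)]\to\ln_+\frac1{|x|}$ as $\epsilon\to0$ for every $x\neq0$, and $\widehat C_\epsilon(x)\le \ln_+\frac1{|x|}+K$ for all $\epsilon\in(0,1]$, $x\ne0$, with a constant $K$. Let $c_\epsilon=\widehat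 C_\epsilon(0)$, and let $W$ be a white noise on $\mathbb R$ such that, for each $\epsilon$, it is independent of $\widehat X_\epsilon$. Define $$u_\epsilon(x)=\int\phi(x-y)X_\epsilon(y)e^{\gamma\widehat X_\epsilon(y)-\gamma^2c_\epsilon}\,W(dy),\qquad X_\epsilon(y)=\int k_\epsilon(y-z)e^{\gamma\widehat X_\epsilon(z)-\gamma^2c_\epsilon}\,W(dz),$$ that is, conditionally on $\widehat X_\epsilon$, $u_\epsilon(x)$ is the double Wiener–Itô integral of the kernel $(y,z)\mapsto\phi(x-y)k_\epsilon(y-z)e^{\gamma\widehat X_\epsilon(y)+\gamma\widehat X_\epsilon(z)-2\gamma^2c_\epsilon}$. The third moment of the increments of the limiting field $u$ is understood as $$\mathbb E[(u(x)-u(y))^3]:=\lim_{\epsilon\to0}\mathbb E[(u_\epsilon(x)-u_\epsilon(y))^3].$$ For $h>0$ put $$f_H(h)=\int_{\mathbb R}\Big[\tfrac{1}{|x+1/2|^{\frac12-H}}-\tfrac{1}{|x-1/2|^{\frac12-H}}\Big]\Big[\tfrac{1}{|x+h+1/2|^{\frac12-H}}-\tfrac{1}{|x+h-1/2|^{\frac12-H}}\Big]^2dx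 .$$ **Proposition.** Assume that $(\frac12-H)f_H(h)>0$ for all $h>0$, $h\neq1$ (for the given $H$). Then for all $\epsilon\in(0,1]$ the double integrals defining $u_\epsilon$ exist and $\mathbb E[(u_\epsilon(x)-u_\epsilon(y))^3]$ is well defined; for all $x>y$ the limit $\mathbb E[(u(x)-u(y))^3]$ above exists, depends only on $x-y$, and $$\mathbb E[(u(x)-u(y))^3]\sim C_3'\,(x-y)^{\xi(3)}\quad\text{as }x-y\to0^+,\qquad \xi(q)=(H+2\gamma^2)q-2\gamma^2q^2,$$ where $$C_3'=-12\,r_\gamma\,\varphi(0)^3\int_0^\infty f_H(h)\,h^{-\frac12-12\gamma^2}\,dh\;\neq\;0,$$ $$r_\gamma=\int_0^\infty\frac{1}{\sqrt x\,x^{4\gamma^2}}\Big(\frac{x+1}{|x+1|^{\frac32+4\gamma^2}}+\frac{x-1}{|x-1|^{\frac32+4\gamma^2}}\Big)dx .$$ -/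

import Mathlib

open MeasureTheory ProbabilityTheory Filter Topology Set

noncomputable section

namespace SkewField

/-! ### White noise and the double Wiener–Itô integral with random kernels -/

/-- Borel subsets of `ℝ` of finite Lebesgue measure. -/
abbrev FinSet : Type := {A : Set ℝ // MeasurableSet A ∧ volume A ≠ ⊤}

/-- `W` is a Gaussian white noise on `ℝ` with Lebesgue intensity: a centered Gaussian family indexed
by the Borel sets of finite measure, with `E[W(A) W(B)] = |A ∩ B|`. -/
structure IsWhiteNoise {Ω : Type*} [MeasurableSpace Ω] (P : Measure Ω) (W : FinSet → Ω → ℝ) :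
    Prop where
  measurable : ∀ A, Measurable (W A)
  gaussian : IsGaussianProcess W P
  centered : ∀ A, ∫ ω, W A ω ∂P = 0
  covariance : ∀ A B, cov[W A, W B; P] = volume.real (A.1 ∩ B.1)

/-- The graph of the elementary double stochastic integral. It is the linear span of the pairs
`(1_F(ω) 1_A(y) 1_B(z), 1_F(ω) W(A)(ω) W(B)(ω))` where `F` belongs to the `σ`-algebra `m`
and `A`, `B` are disjoint Borel sets of finite measure. -/
def elementaryGraph {Ω : Type*} (m : MeasurableSpace Ω) (W : FinSet → Ω → ℝ) :
    Submodule ℝ ((Ω × ℝ × ℝ → ℝ) × (Ω → ℝ)) :=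
  Submodule.span ℝ {p | ∃ (F : Set Ω) (A B : FinSet), MeasurableSet[m] F ∧ Disjoint A.1 B.1 ∧
    p = ((F ×ˢ A.1 ×ˢ B.1).indicator 1, F.indicator (fun ω => W A ω * W B ω))}

/-- `U = ∬ G(ω, y, z) W(dy) W(dz)`, the double Wiener–Itô integral of the random, square
integrable kernel `G` (which is `m`-measurable in `ω`, where `m` is independent of `W`): `U` is the
`L²` limit of elementary integrals whose kernels converge to `G` in `L²(Ω × ℝ²)`. -/
def IsDoubleIntegral {Ω : Type*} (m : MeasurableSpace Ω) [MeasurableSpace Ω] (P : Measure Ω)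
    (W : FinSet → Ω → ℝ) (G : Ω × ℝ × ℝ → ℝ) (U : Ω → ℝ) : Prop :=
  MemLp U 2 P ∧ ∃ g : ℕ → (Ω × ℝ × ℝ → ℝ) × (Ω → ℝ),
    (∀ n, g n ∈ elementaryGraph m W) ∧
    Tendsto (fun n => eLpNorm (G - (g n).1) 2 (P.prod (volume.prod volume))) atTop (𝓝 0) ∧
    Tendsto (fun n => eLpNorm (U - (g n).2) 2 P) atTop (𝓝 0)

open Classical in
/-- The double Wiener–Itô integral (a version of it; it is unique up to almost sure equality). -/
def doubleIntegral {Ω : Type*} (m : MeasurableSpace Ω) [MeasurableSpace Ω] (P : Measure Ω)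
    (W : FinSet → Ω → ℝ) (G : Ω × ℝ × ℝ → ℝ) : Ω → ℝ :=
  if h : ∃ U, IsDoubleIntegral m P W G U then h.choose else 0

/-! ### Regularizations -/

/-- `Xhat ε`, `0 < ε ≤ 1`, are continuous centered stationary Gaussian fields which regularize the
log-correlated field of covariance `ln₊ (1 / |x|)`: the covariances `E[Xhat ε x * Xhat ε 0]`
converge pointwise to `ln₊ (1 / |x|)` off the origin and exceed it by at most a constant. -/
structure IsLogRegularization {Ω : Type*} [MeasurableSpace Ω] (P : Measure Ω)
    (Xhat : ℝ → ℝ → Ω → ℝ) : Prop where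
  measurable : ∀ ε ∈ Ioc (0 : ℝ) 1, ∀ x, Measurable (Xhat ε x)
  continuous : ∀ ε ∈ Ioc (0 : ℝ) 1, ∀ ω, Continuous fun x => Xhat ε x ω
  gaussian : ∀ ε ∈ Ioc (0 : ℝ) 1, IsGaussianProcess (Xhat ε) P
  centered : ∀ ε ∈ Ioc (0 : ℝ) 1, ∀ x, ∫ ω, Xhat ε x ω ∂P = 0
  stationary : ∀ ε ∈ Ioc (0 : ℝ) 1, ∀ x y,
    cov[Xhat ε x, Xhat ε y; P] = cov[Xhat ε (x - y), Xhat ε 0; P]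
  tendsto : ∀ x : ℝ, x ≠ 0 →
    Tendsto (fun ε => cov[Xhat ε x, Xhat ε 0; P]) (𝓝[>] 0) (𝓝 (Real.posLog (1 / |x|)))
  bound : ∃ K : ℝ, ∀ ε ∈ Ioc (0 : ℝ) 1, ∀ x : ℝ, x ≠ 0 →
    cov[Xhat ε x, Xhat ε 0; P] ≤ Real.posLog (1 / |x|) + K

/-- `N ε x = |x|_ε`, `0 < ε ≤ 1`, is a regularization of the absolute value. -/
structure IsRegularizedNorm (N : ℝ → ℝ → ℝ) : Prop where
  continuous : ∀ ε ∈ Ioc (0 : ℝ) 1, Continuous (N ε)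
  even : ∀ ε ∈ Ioc (0 : ℝ) 1, ∀ x, N ε (-x) = N ε x
  pos : ∀ ε ∈ Ioc (0 : ℝ) 1, ∀ x, 0 < N ε x
  lower : ∃ c : ℝ, 0 < c ∧ ∀ ε ∈ Ioc (0 : ℝ) 1, ∀ x, c * |x| ≤ N ε x
  tendsto : ∀ x : ℝ, Tendsto (fun ε => N ε x) (𝓝[>] 0) (𝓝 |x|)

/-! ### The field -/

/-- `ϕ(x) = φ(x) / |x|^(1/2 - H)`, where `φ` is the cut-off function. -/
def bigPhi (H : ℝ) (φ : ℝ → ℝ) (x : ℝ) : ℝ := φ x * (1 / |x| ^ (1 / 2 - H))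

/-- `k_ε(x) = x / |x|_ε^(3/2) 1_{|x| ≤ 1}`. -/
def kEps (N : ℝ → ℝ → ℝ) (ε x : ℝ) : ℝ := if |x| ≤ 1 then x / N ε x ^ (3 / 2 : ℝ) else 0

/-- The random density `exp(γ Xhat_ε(y) - γ² c_ε)`, with `c_ε = E[Xhat_ε(y)²]`. -/
def chaosDensity {Ω : Type*} [MeasurableSpace Ω] (P : Measure Ω) (γ : ℝ) (Xhat : ℝ → ℝ → Ω → ℝ)
    (ε y : ℝ) (ω : Ω) : ℝ :=
  Real.exp (γ * Xhat ε y ω - γ ^ 2 * Var[Xhat ε 0; P])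

/-- The `σ`-algebra generated by the field `Xhat_ε`. -/
abbrev fieldSigma {Ω : Type*} (Xhat : ℝ → ℝ → Ω → ℝ) (ε : ℝ) : MeasurableSpace Ω :=
  MeasurableSpace.comap (fun ω x => Xhat ε x ω) MeasurableSpace.pi

/-- The random kernel
`(y, z) ↦ ϕ(x - y) k_ε(y - z) e^{γ Xhat_ε(z) - γ² c_ε} e^{γ Xhat_ε(y) - γ² c_ε}`
of `u_ε(x)`. -/
def fieldKernel {Ω : Type*} [MeasurableSpace Ω] (P : Measure Ω) (γ H : ℝ) (φ : ℝ → ℝ)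
    (N : ℝ → ℝ → ℝ) (Xhat : ℝ → ℝ → Ω → ℝ) (ε x : ℝ) (p : Ω × ℝ × ℝ) : ℝ :=
  bigPhi H φ (x - p.2.1) * kEps N ε (p.2.1 - p.2.2) *
    chaosDensity P γ Xhat ε p.2.2 p.1 * chaosDensity P γ Xhat ε p.2.1 p.1

/-- `u_ε(x) = ∫ ϕ(x - y) X_ε(y) e^{γ Xhat_ε(y) - γ² c_ε} W(dy)` where
`X_ε(y) = ∫ k_ε(y - z) e^{γ Xhat_ε(z) - γ² c_ε} W(dz)`. As `X_ε(y)` is linear in `W`,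
given `Xhat_ε`, and anticipating, the iterated integral is the double Wiener–Itô integral of
`fieldKernel`; there is no trace term since `k_ε(0) = 0`. -/
def uEps {Ω : Type*} [MeasurableSpace Ω] (P : Measure Ω) (γ H : ℝ) (φ : ℝ → ℝ)
    (N : ℝ → ℝ → ℝ) (W : FinSet → Ω → ℝ) (Xhat : ℝ → ℝ → Ω → ℝ) (ε x : ℝ) : Ω → ℝ :=
  doubleIntegral (fieldSigma Xhat ε) P W (fieldKernel P γ H φ N Xhat ε x)

/-! ### Exponents and constants -/

/-- The spectrum `ξ(q) = (H + 2γ²) q - 2γ² q²`. -/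
def xi (γ H q : ℝ) : ℝ := (H + 2 * γ ^ 2) * q - 2 * γ ^ 2 * q ^ 2

/-- The function `f_H`. -/
def fH (H h : ℝ) : ℝ :=
  ∫ x : ℝ, (1 / |x + 1 / 2| ^ (1 / 2 - H) - 1 / |x - 1 / 2| ^ (1 / 2 - H)) *
    (1 / |x + h + 1 / 2| ^ (1 / 2 - H) - 1 / |x + h - 1 / 2| ^ (1 / 2 - H)) ^ 2

/-- The constant `r_γ`. -/
def rGamma (γ : ℝ) : ℝ :=
  ∫ x in Ioi (0 : ℝ), 1 / (√x * |x| ^ (4 * γ ^ 2)) *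
    ((x + 1) / |x + 1| ^ (3 / 2 + 4 * γ ^ 2) + (x - 1) / |x - 1| ^ (3 / 2 + 4 * γ ^ 2))

/-- The constant `C'₃ = -12 r_γ φ(0)³ ∫₀^∞ f_H(h) h^(-1/2 - 12γ²) dh`. -/
def skewConst (γ H : ℝ) (φ : ℝ → ℝ) : ℝ :=
  -12 * rGamma γ * φ 0 ^ 3 * ∫ h in Ioi (0 : ℝ), fH H h * (1 / h ^ (1 / 2 + 12 * γ ^ 2))

end SkewField

end

open SkewField

/-!
# Third moment of the increments of a multiplicative chaos field

Given the field `Xhat ε`, the increment `u_ε(x) - u_ε(x')` is a double Wiener-Itô integral with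
kernel `G(y, z) = D(y) k_ε(y - z) M(y) M(z)`, where `D(y) = ϕ(x - y) - ϕ(x' - y)` and `M` is the
density `chaosDensity`.

*Third moment of a double integral.* For a quadratic form in independent Gaussian variables without
diagonal terms the third moment is a sum over closed triangles, and the fourth moment is bounded by
a multiple of the square of the second one. Approximating a kernel by step kernels on a grid with
vanishing diagonal, and conditioning on the field, one obtains for the double integral `U` of a
random kernel `G` that `E[U³] = E ∭ S(y, z) S(z, w) S(w, y)`, `S(y, z) = G(y, z) + G(z, y)`: this
is `IsRegularKernel.integral_cube`. The bound of the fourth moments makes the third moments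
converge along the approximation.

*Reduction to a single integral.* As `k_ε` is odd, `S(y, z) = k_ε(y - z) (D(y) - D(z)) M(y) M(z)`.
The expectation of `(M(y) M(z) M(w))²` is a product of the three factors `exp(4γ² C(y - z))`, which
turns `k_ε` into the odd kernel `κ = k_ε exp(4γ² C)`. In the product of
`κ(y - z) κ(z - w) κ(w - y)` and of the Vandermonde product of `D`, both alternating, the six terms
of the latter contribute equally, and

`E[(u_ε(x) - u_ε(x'))³] = 6 ∫ κ(h) (κ * κ)(h) F(h) dh`, with `F(h) = ∫ D(y)² D(y + h) dy`.

This is `integral_uEps_sub_cube`.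

*Scaling and limits.* At scale `l = x - x'` this equals
`6 l ^ ξ(3) ∫ κ_l(t) (κ_l * κ_l)(t) f_l(t) dt`, where `κ_l(t) = l ^ a κ(l t)` with `a = 1/2 + 4γ²`,
and where `f_l` is the correlation (`incrCorr`) of the unit increments of `φ(l u) |u| ^ (H - 1/2)`.
Uniformly in `ε` and `l`, `|κ_l(t)| ≤ C |t| ^ (-a)`, so that the product of `κ_l` and its
self-convolution is of order `|t| ^ (1 - 3 a)`, where `1/2 < 3 a - 1 < 2`. On the other hand `f_l`
is bounded by a function which is integrable against all these powers (`exists_corr_dominating`):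
at infinity by an `L²` bound of the increments, and at the origin, where `3 a - 1` may exceed `1`,
because `f_l` is odd and vanishes linearly there (`exists_incrCorr_small`). Dominated convergence
gives both the limit `ε → 0` and the limit `l → 0`. In the latter `κ_l` tends to
`sign t / |t| ^ a`, whose self-convolution is `-r_γ |t| ^ (1 - 2 a)`, and `f_l` tends to
`φ(0)³ f_H`, which yields the constant.

*The constant.* `r_γ` is positive (`integral_oddPow_mul_pos`): after an inversion and a
symmetrisation it is the integral over `[0, 1]` of `(x (1 - x)) ^ (-a) (x ^ s + (1 - x) ^ s - 1)`
with `s = 3 a - 2 < 1`. The integral of `f_H` does not vanish because of the sign hypothesis.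
-/

noncomputable section

namespace SkewField

/-! ### Moments of Gaussian variables -/

section Moments

variable {Ω : Type*} [MeasurableSpace Ω] {P : Measure Ω}

/-- All moments of `f` are finite. -/
def HasMoments (f : Ω → ℝ) (P : Measure Ω) : Prop :=
  ∀ p : ENNReal, p ≠ ⊤ → MemLp f p P

lemma HasMoments.add {f g : Ω → ℝ} (hf : HasMoments f P) (hg : HasMoments g P) :
    HasMoments (fun ω => f ω + g ω) P := fun p hp => (hf p hp).add (hg p hp)

lemma HasMoments.mul {f g : Ω → ℝ} (hf : HasMoments f P) (hg : HasMoments g P) :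
    HasMoments (fun ω => f ω * g ω) P := by
  intro p hp
  have h2 : (2 * p) ≠ ⊤ := ENNReal.mul_ne_top (by simp) hp
  have : ENNReal.HolderTriple (2 * p) (2 * p) p := by
    constructor
    rw [← two_mul, ENNReal.mul_inv (by simp) (by simp), ← mul_assoc,
      ENNReal.mul_inv_cancel (by simp) (by simp), one_mul]
  exact (hg (2 * p) h2).mul (hf (2 * p) h2)

lemma HasMoments.const [IsFiniteMeasure P] (c : ℝ) : HasMoments (fun _ : Ω => c) P :=
  fun _ _ => memLp_const c

lemma HasMoments.const_mul {f : Ω → ℝ} (hf : HasMoments f P) (c : ℝ) :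
    HasMoments (fun ω => c * f ω) P := fun p hp => (hf p hp).const_mul c

lemma HasMoments.pow [IsFiniteMeasure P] {f : Ω → ℝ} (hf : HasMoments f P) (n : ℕ) :
    HasMoments (fun ω => f ω ^ n) P := by
  induction n with
  | zero => simpa using HasMoments.const (P := P) 1
  | succ n ih => simpa only [pow_succ] using ih.mul hf

lemma HasMoments.sum [IsFiniteMeasure P] {ι : Type*} (s : Finset ι) {f : ι → Ω → ℝ}
    (hf : ∀ i ∈ s, HasMoments (f i) P) : HasMoments (fun ω => ∑ i ∈ s, f i ω) P :=
  fun p hp => memLp_finsetSum s fun i hi => hf i hi p hp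

lemma HasMoments.integrable {f : Ω → ℝ} (hf : HasMoments f P) : Integrable f P :=
  memLp_one_iff_integrable.1 (hf 1 (by simp))

lemma _root_.ProbabilityTheory.HasGaussianLaw.hasMoments {X : Ω → ℝ} (hX : HasGaussianLaw X P) :
    HasMoments X P := fun _ hp => hX.memLp hp

/-- The recursion for the derivatives at `0` of the moment generating function of a centered
Gaussian variable, which satisfies `f' = v t f`. -/
lemma iteratedDeriv_exp_mul_sq (v : ℝ) (n : ℕ) :
    iteratedDeriv (n + 2) (fun t : ℝ => Real.exp (v * t ^ 2 / 2)) 0 =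
      v * (n + 1) * iteratedDeriv n (fun t : ℝ => Real.exp (v * t ^ 2 / 2)) 0 := by
  set e : ℝ → ℝ := fun t => Real.exp (v * t ^ 2 / 2) with he
  have hd : deriv e = fun t => (v * t) * e t := by
    ext t
    have : HasDerivAt e (Real.exp (v * t ^ 2 / 2) * (v * (2 * t) / 2)) t := by
      have := (((hasDerivAt_pow 2 t).const_mul v).div_const 2).exp
      simpa using this
    rw [this.deriv]; simp only [he]; ring
  have hsm : ContDiff ℝ ⊤ e := by
    simp only [he]; fun_prop
  have key : ∀ n : ℕ, iteratedDeriv (n + 2) e =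
      fun t => v * t * iteratedDeriv (n + 1) e t + v * (n + 1) * iteratedDeriv n e t := by
    have dif : ∀ k, Differentiable ℝ (iteratedDeriv k e) := fun k =>
      hsm.differentiable_iteratedDeriv k (by exact_mod_cast WithTop.coe_lt_top _)
    intro n
    induction n with
    | zero =>
      ext t
      have h0 := (dif 0) t
      simp only [iteratedDeriv_zero] at h0
      rw [show (0 + 2) = 1 + 1 from rfl, iteratedDeriv_succ, iteratedDeriv_one, hd]
      have : HasDerivAt (fun t => v * t * e t) (v * 1 * e t + v * t * deriv e t) t :=
        ((hasDerivAt_id t).const_mul v).mul h0.hasDerivAt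
      rw [this.deriv]
      simp [hd]; ring
    | succ n ih =>
      ext t
      have hs : iteratedDeriv (n + 1 + 2) e t = deriv (iteratedDeriv (n + 2) e) t := by
        rw [iteratedDeriv_succ]
      rw [hs]
      conv_lhs => rw [ih]
      have h1 := ((dif (n + 1)) t).hasDerivAt
      have h0 := ((dif n) t).hasDerivAt
      have := (((hasDerivAt_id t).const_mul v).mul h1).add (h0.const_mul (v * (n + 1)))
      rw [← iteratedDeriv_succ, ← iteratedDeriv_succ] at this
      rw [show (fun t => v * t * iteratedDeriv (n + 1) e t + v * (↑n + 1) * iteratedDeriv n e t)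
        = ((fun t => v * id t) * iteratedDeriv (n + 1) e +
            fun t => v * (↑n + 1) * iteratedDeriv n e t) from rfl, this.deriv]
      push_cast
      simp only [id]
      ring
  rw [key n]; simp

/-- Stein's recursion for the moments of a centered Gaussian variable. -/
lemma integral_pow_gaussian {X : Ω → ℝ} (hX : HasGaussianLaw X P) (h0 : ∫ ω, X ω ∂P = 0) (n : ℕ) :
    ∫ ω, X ω ^ (n + 2) ∂P = Var[X; P] * (n + 1) * ∫ ω, X ω ^ n ∂P := by
  have := hX.isProbabilityMeasure
  have hm := hX.map_eq_gaussianReal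
  rw [h0] at hm
  have hmgf : mgf X P = fun t => Real.exp (Var[X; P] * t ^ 2 / 2) := by
    ext t
    rw [mgf_gaussianReal hm t, Real.coe_toNNReal _ (variance_nonneg _ _)]; simp
  have hint : (0 : ℝ) ∈ interior (integrableExpSet X P) := by
    have : integrableExpSet X P = Set.univ := by
      ext t
      simp only [integrableExpSet, mem_ofPred_eq, mem_univ, iff_true]
      rw [← mgf_pos_iff, hmgf]
      positivity
    simp [this]
  have h1 := iteratedDeriv_mgf_zero hint (n + 2)
  have h2 := iteratedDeriv_mgf_zero hint n
  rw [hmgf] at h1 h2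
  rw [iteratedDeriv_exp_mul_sq, h2] at h1
  simpa using h1.symm

lemma integral_sq_gaussian {X : Ω → ℝ} (hX : HasGaussianLaw X P) (h0 : ∫ ω, X ω ∂P = 0) :
    ∫ ω, X ω ^ 2 ∂P = Var[X; P] := by
  have := hX.isProbabilityMeasure
  simpa using integral_pow_gaussian hX h0 0

lemma integral_cube_gaussian {X : Ω → ℝ} (hX : HasGaussianLaw X P) (h0 : ∫ ω, X ω ∂P = 0) :
    ∫ ω, X ω ^ 3 ∂P = 0 := by
  have := integral_pow_gaussian hX h0 1
  simpa [h0] using this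

lemma integral_fourth_gaussian {X : Ω → ℝ} (hX : HasGaussianLaw X P) (h0 : ∫ ω, X ω ∂P = 0) :
    ∫ ω, X ω ^ 4 ∂P = 3 * Var[X; P] ^ 2 := by
  have := integral_pow_gaussian hX h0 2
  rw [integral_sq_gaussian hX h0] at this
  rw [this]; push_cast; ring

end Moments

/-! ### Linear and quadratic forms of independent Gaussian variables -/

section Chaos

variable {Ω : Type*} {ι : Type*}

/-- A family of independent centered real Gaussian variables. -/
structure IndepGaussian [MeasurableSpace Ω] (ξ : ι → Ω → ℝ) (P : Measure Ω) : Prop where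
  measurable : ∀ i, Measurable (ξ i)
  gaussian : ∀ i, HasGaussianLaw (ξ i) P
  centered : ∀ i, ∫ ω, ξ i ω ∂P = 0
  indep : iIndepFun ξ P

/-- The `σ`-algebra generated by the variables `ξ i`, `i ∈ s`. -/
abbrev sigmaOf (ξ : ι → Ω → ℝ) (s : Finset ι) : MeasurableSpace Ω :=
  ⨆ i ∈ (s : Set ι), MeasurableSpace.comap (ξ i) inferInstance

/-- The linear form `∑ c i ξ i` over `s`. -/
def linForm (ξ : ι → Ω → ℝ) (c : ι → ℝ) (s : Finset ι) (ω : Ω) : ℝ := ∑ i ∈ s, c i * ξ i ω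

/-- The quadratic form `∑ b i j ξ i ξ j` over `s`. -/
def quadForm (ξ : ι → Ω → ℝ) (b : ι → ι → ℝ) (s : Finset ι) (ω : Ω) : ℝ :=
  ∑ i ∈ s, ∑ j ∈ s, b i j * (ξ i ω * ξ j ω)

lemma measurable_sigmaOf (ξ : ι → Ω → ℝ) {s : Finset ι} {i : ι} (hi : i ∈ s) :
    Measurable[sigmaOf ξ s] (ξ i) := by
  have h : MeasurableSpace.comap (ξ i) inferInstance ≤ sigmaOf ξ s :=
    le_iSup₂_of_le (f := fun i (_ : i ∈ (s : Set ι)) => MeasurableSpace.comap (ξ i) inferInstance)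
      i (by simpa using hi) le_rfl
  exact Measurable.mono (comap_measurable (ξ i)) h le_rfl

lemma measurable_linForm {m : MeasurableSpace Ω} {ξ : ι → Ω → ℝ} (c : ι → ℝ) {s : Finset ι}
    (h : ∀ i ∈ s, Measurable (ξ i)) : Measurable (linForm ξ c s) :=
  Finset.measurable_fun_sum s fun i hi => (h i hi).const_mul _

lemma measurable_quadForm {m : MeasurableSpace Ω} {ξ : ι → Ω → ℝ} (b : ι → ι → ℝ) {s : Finset ι}
    (h : ∀ i ∈ s, Measurable (ξ i)) : Measurable (quadForm ξ b s) :=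
  Finset.measurable_fun_sum s fun i hi => Finset.measurable_fun_sum s fun j hj =>
    ((h i hi).mul (h j hj)).const_mul _

lemma measurable_monomial {m : MeasurableSpace Ω} {f g h : Ω → ℝ} (hf : Measurable f)
    (hg : Measurable g) (hh : Measurable h) (i j l : ℕ) :
    Measurable fun ω => f ω ^ i * g ω ^ j * h ω ^ l := by fun_prop

lemma linForm_insert [DecidableEq ι] (ξ : ι → Ω → ℝ) (c : ι → ℝ) {s : Finset ι} {n : ι}
    (hn : n ∉ s) (ω : Ω) :
    linForm ξ c (insert n s) ω = c n * ξ n ω + linForm ξ c s ω := by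
  simp [linForm, Finset.sum_insert hn]

/-- Adding a variable to a quadratic form without diagonal terms adds twice the product of this
variable and of a linear form in the others. This is the induction step of all the moment
computations. -/
lemma quadForm_insert [DecidableEq ι] (ξ : ι → Ω → ℝ) {b : ι → ι → ℝ} (hb : ∀ i j, b i j = b j i)
    (hb0 : ∀ i, b i i = 0) {s : Finset ι} {n : ι} (hn : n ∉ s) (ω : Ω) :
    quadForm ξ b (insert n s) ω = 2 * (ξ n ω * linForm ξ (b n) s ω) + quadForm ξ b s ω := by
  simp only [quadForm, linForm, Finset.sum_insert hn, hb0, Finset.sum_add_distrib]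
  have h1 : ∑ x ∈ s, b x n * (ξ x ω * ξ n ω) = ξ n ω * ∑ i ∈ s, b n i * ξ i ω := by
    rw [Finset.mul_sum]; exact Finset.sum_congr rfl fun i _ => by rw [hb i n]; ring
  have h2 : ∑ x ∈ s, b n x * (ξ n ω * ξ x ω) = ξ n ω * ∑ i ∈ s, b n i * ξ i ω := by
    rw [Finset.mul_sum]; exact Finset.sum_congr rfl fun i _ => by ring
  rw [h1, h2]; ring

namespace IndepGaussian

variable [MeasurableSpace Ω] {P : Measure Ω} {ξ : ι → Ω → ℝ}

lemma isProbabilityMeasure (hξ : IndepGaussian ξ P) : IsProbabilityMeasure P :=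
  hξ.indep.isProbabilityMeasure

lemma sigmaOf_le (hξ : IndepGaussian ξ P) (s : Finset ι) : sigmaOf ξ s ≤ ‹MeasurableSpace Ω› :=
  iSup₂_le fun i _ => (hξ.measurable i).comap_le

lemma integral_pow_mul (hξ : IndepGaussian ξ P) {s : Finset ι} {n : ι} (hn : n ∉ s) (k : ℕ)
    {Y : Ω → ℝ}
    (hY : Measurable[sigmaOf ξ s] Y) :
    ∫ ω, ξ n ω ^ k * Y ω ∂P = (∫ ω, ξ n ω ^ k ∂P) * ∫ ω, Y ω ∂P := by
  have hi : iIndep (fun i => MeasurableSpace.comap (ξ i) inferInstance) P := hξ.indep.iIndep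
  have h1 := indep_iSup_of_disjoint (fun i => (hξ.measurable i).comap_le) hi
    (S := {n}) (T := (s : Set ι)) (by simpa using hn)
  have hX : Measurable[MeasurableSpace.comap (ξ n) inferInstance] (fun ω => ξ n ω ^ k) :=
    (measurable_id.pow_const k).comp (comap_measurable (ξ n))
  have h2 : IndepFun (fun ω => ξ n ω ^ k) Y P := by
    refine (IndepFun_iff_Indep _ _ _).2 (indep_of_indep_of_le_left
      (indep_of_indep_of_le_right h1 hY.comap_le) ?_)
    simpa using hX.comap_le
  exact h2.integral_fun_mul_eq_mul_integral
    ((hξ.measurable n).pow_const k).aestronglyMeasurable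
    (hY.mono (hξ.sigmaOf_le s) le_rfl).aestronglyMeasurable

lemma hasMoments_linForm (hξ : IndepGaussian ξ P) (c : ι → ℝ) (s : Finset ι)
    : HasMoments (linForm ξ c s) P := by
  have := hξ.isProbabilityMeasure
  exact HasMoments.sum s fun i _ => (hξ.gaussian i).hasMoments.const_mul _

lemma hasMoments_quadForm (hξ : IndepGaussian ξ P) (b : ι → ι → ℝ) (s : Finset ι)
    : HasMoments (quadForm ξ b s) P := by
  have := hξ.isProbabilityMeasure
  exact HasMoments.sum s fun i _ => HasMoments.sum s fun j _ =>
    ((hξ.gaussian i).hasMoments.mul (hξ.gaussian j).hasMoments).const_mul _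

/-- Expectation of a product of powers of `ξ n`, of a linear and a quadratic form over `s ∌ n`. -/
lemma integral_monomial (hξ : IndepGaussian ξ P) {s : Finset ι} {n : ι} (hn : n ∉ s)
    (b : ι → ι → ℝ) (c c' : ι → ℝ)
    (k i j l : ℕ) :
    Integrable (fun ω => ξ n ω ^ k * (quadForm ξ b s ω ^ i * linForm ξ c s ω ^ j *
      linForm ξ c' s ω ^ l)) P ∧
    ∫ ω, ξ n ω ^ k * (quadForm ξ b s ω ^ i * linForm ξ c s ω ^ j * linForm ξ c' s ω ^ l) ∂P =
      (∫ ω, ξ n ω ^ k ∂P) *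
        ∫ ω, quadForm ξ b s ω ^ i * linForm ξ c s ω ^ j * linForm ξ c' s ω ^ l ∂P := by
  have := hξ.isProbabilityMeasure
  constructor
  · exact (((hξ.gaussian n).hasMoments.pow k).mul ((((hξ.hasMoments_quadForm b s).pow i).mul
      ((hξ.hasMoments_linForm c s).pow j)).mul ((hξ.hasMoments_linForm c' s).pow l))).integrable
  · have h : ∀ i ∈ s, Measurable[sigmaOf ξ s] (ξ i) := fun i hi => measurable_sigmaOf ξ hi
    exact hξ.integral_pow_mul hn k (measurable_monomial (measurable_quadForm b h)
      (measurable_linForm c h) (measurable_linForm c' h) i j l)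

end IndepGaussian

end Chaos

section ChaosMoments

variable {Ω : Type*} [MeasurableSpace Ω] {P : Measure Ω} {ι : Type*}

/-- Linearity of the integral for six terms, the number of terms in the expansions of the moments
below; missing terms are given the coefficient `0`. -/
lemma integral_lin_comb {f₀ f₁ f₂ f₃ f₄ f₅ : Ω → ℝ} (h₀ : Integrable f₀ P) (h₁ : Integrable f₁ P)
    (h₂ : Integrable f₂ P) (h₃ : Integrable f₃ P) (h₄ : Integrable f₄ P)
    (h₅ : Integrable f₅ P) (c₀ c₁ c₂ c₃ c₄ c₅ : ℝ) :
    ∫ ω, (c₀ * f₀ ω + c₁ * f₁ ω + c₂ * f₂ ω + c₃ * f₃ ω + c₄ * f₄ ω +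
        c₅ * f₅ ω) ∂P =
      c₀ * ∫ ω, f₀ ω ∂P + c₁ * ∫ ω, f₁ ω ∂P + c₂ * ∫ ω, f₂ ω ∂P + c₃ * ∫ ω, f₃ ω ∂P +
        c₄ * ∫ ω, f₄ ω ∂P + c₅ * ∫ ω, f₅ ω ∂P := by
  have e₁ : Integrable (fun ω => c₀ * f₀ ω + c₁ * f₁ ω) P := (h₀.const_mul c₀).add (h₁.const_mul c₁)
  have e₂ : Integrable (fun ω => c₀ * f₀ ω + c₁ * f₁ ω + c₂ * f₂ ω) P := e₁.add (h₂.const_mul c₂)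
  have e₃ : Integrable (fun ω => c₀ * f₀ ω + c₁ * f₁ ω + c₂ * f₂ ω + c₃ * f₃ ω) P :=
    e₂.add (h₃.const_mul c₃)
  have e₄ : Integrable (fun ω => c₀ * f₀ ω + c₁ * f₁ ω + c₂ * f₂ ω + c₃ * f₃ ω + c₄ * f₄ ω) P :=
    e₃.add (h₄.const_mul c₄)
  rw [integral_add e₄ (h₅.const_mul c₅), integral_add e₃ (h₄.const_mul c₄),
    integral_add e₂ (h₃.const_mul c₃), integral_add e₁ (h₂.const_mul c₂),
    integral_add (h₀.const_mul c₀) (h₁.const_mul c₁)]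
  simp only [integral_const_mul]

namespace IndepGaussian

variable {ξ : ι → Ω → ℝ}

lemma integral_linForm_mul (hξ : IndepGaussian ξ P) (c c' : ι → ℝ) (s : Finset ι) :
    ∫ ω, linForm ξ c s ω * linForm ξ c' s ω ∂P = ∑ i ∈ s, c i * c' i * Var[ξ i; P] := by
  classical
  have := hξ.isProbabilityMeasure
  induction s using Finset.induction_on with
  | empty => simp [linForm]
  | insert n s hn ih =>
    have M := hξ.integral_monomial hn 0 c c'
    have e : ∀ ω, linForm ξ c (insert n s) ω * linForm ξ c' (insert n s) ω =
        c n * c' n * (ξ n ω ^ 2 * (quadForm ξ 0 s ω ^ 0 * linForm ξ c s ω ^ 0 *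
          linForm ξ c' s ω ^ 0)) +
        c n * (ξ n ω ^ 1 * (quadForm ξ 0 s ω ^ 0 * linForm ξ c s ω ^ 0 *
          linForm ξ c' s ω ^ 1)) +
        c' n * (ξ n ω ^ 1 * (quadForm ξ 0 s ω ^ 0 * linForm ξ c s ω ^ 1 *
          linForm ξ c' s ω ^ 0)) +
        1 * (ξ n ω ^ 0 * (quadForm ξ 0 s ω ^ 0 * linForm ξ c s ω ^ 1 *
          linForm ξ c' s ω ^ 1)) +
        0 * (ξ n ω ^ 0 * (quadForm ξ 0 s ω ^ 0 * linForm ξ c s ω ^ 0 *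
          linForm ξ c' s ω ^ 0)) +
        0 * (ξ n ω ^ 0 * (quadForm ξ 0 s ω ^ 0 * linForm ξ c s ω ^ 0 *
          linForm ξ c' s ω ^ 0)) := by
      intro ω; rw [linForm_insert ξ c hn, linForm_insert ξ c' hn]; ring
    simp_rw [e]
    rw [integral_lin_comb (M _ _ _ _).1 (M _ _ _ _).1 (M _ _ _ _).1 (M _ _ _ _).1 (M _ _ _ _).1
      (M 0 0 0 0).1]
    simp only [(M _ _ _ _).2]
    simp [integral_sq_gaussian (hξ.gaussian n) (hξ.centered n), hξ.centered n, ih,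
      Finset.sum_insert hn]

lemma integral_linForm_sq (hξ : IndepGaussian ξ P) (c : ι → ℝ) (s : Finset ι) :
    ∫ ω, linForm ξ c s ω ^ 2 ∂P = ∑ i ∈ s, c i ^ 2 * Var[ξ i; P] := by
  simpa only [sq] using hξ.integral_linForm_mul c c s

lemma integral_linForm_fourth (hξ : IndepGaussian ξ P) (c : ι → ℝ) (s : Finset ι) :
    ∫ ω, linForm ξ c s ω ^ 4 ∂P = 3 * (∑ i ∈ s, c i ^ 2 * Var[ξ i; P]) ^ 2 := by
  classical
  have := hξ.isProbabilityMeasure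
  induction s using Finset.induction_on with
  | empty => simp [linForm]
  | insert n s hn ih =>
    have M := hξ.integral_monomial hn 0 c 0
    have e : ∀ ω, linForm ξ c (insert n s) ω ^ 4 =
        c n ^ 4 * (ξ n ω ^ 4 * (quadForm ξ 0 s ω ^ 0 * linForm ξ c s ω ^ 0 *
          linForm ξ 0 s ω ^ 0)) +
        4 * c n ^ 3 * (ξ n ω ^ 3 * (quadForm ξ 0 s ω ^ 0 * linForm ξ c s ω ^ 1 *
          linForm ξ 0 s ω ^ 0)) +
        6 * c n ^ 2 * (ξ n ω ^ 2 * (quadForm ξ 0 s ω ^ 0 * linForm ξ c s ω ^ 2 *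
          linForm ξ 0 s ω ^ 0)) +
        4 * c n * (ξ n ω ^ 1 * (quadForm ξ 0 s ω ^ 0 * linForm ξ c s ω ^ 3 *
          linForm ξ 0 s ω ^ 0)) +
        1 * (ξ n ω ^ 0 * (quadForm ξ 0 s ω ^ 0 * linForm ξ c s ω ^ 4 *
          linForm ξ 0 s ω ^ 0)) +
        0 * (ξ n ω ^ 0 * (quadForm ξ 0 s ω ^ 0 * linForm ξ c s ω ^ 0 *
          linForm ξ 0 s ω ^ 0)) := by
      intro ω; rw [linForm_insert ξ c hn]; ring
    simp_rw [e]
    rw [integral_lin_comb (M _ _ _ _).1 (M _ _ _ _).1 (M _ _ _ _).1 (M _ _ _ _).1 (M _ _ _ _).1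
      (M 0 0 0 0).1]
    simp only [(M _ _ _ _).2]
    simp [integral_sq_gaussian (hξ.gaussian n) (hξ.centered n), hξ.centered n, ih,
      integral_cube_gaussian (hξ.gaussian n) (hξ.centered n),
      integral_fourth_gaussian (hξ.gaussian n) (hξ.centered n),
      Finset.sum_insert hn, hξ.integral_linForm_sq]
    ring

variable {b : ι → ι → ℝ}

lemma integral_quadForm (hξ : IndepGaussian ξ P) (hb : ∀ i j, b i j = b j i)
    (hb0 : ∀ i, b i i = 0) (s : Finset ι) : ∫ ω, quadForm ξ b s ω ∂P = 0 := by
  classical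
  have := hξ.isProbabilityMeasure
  induction s using Finset.induction_on with
  | empty => simp [quadForm]
  | insert n s hn ih =>
    have M := hξ.integral_monomial hn b (b n) 0
    have h0 := (M 1 0 1 0).1
    have e : ∀ ω, quadForm ξ b (insert n s) ω =
        2 * (ξ n ω ^ 1 * (quadForm ξ b s ω ^ 0 * linForm ξ (b n) s ω ^ 1 *
          linForm ξ 0 s ω ^ 0)) + quadForm ξ b s ω := by
      intro ω; rw [quadForm_insert ξ hb hb0 hn]; ring
    simp_rw [e]
    rw [integral_add (h0.const_mul _) (hξ.hasMoments_quadForm b s).integrable, integral_const_mul,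
      (M _ _ _ _).2, ih]
    simp [hξ.centered n]

lemma integral_quadForm_mul_linForm_sq (hξ : IndepGaussian ξ P) (hb : ∀ i j, b i j = b j i)
    (hb0 : ∀ i, b i i = 0) (c : ι → ℝ) (s : Finset ι) :
    ∫ ω, quadForm ξ b s ω * linForm ξ c s ω ^ 2 ∂P =
      2 * ∑ i ∈ s, ∑ j ∈ s, b i j * c i * c j * (Var[ξ i; P] * Var[ξ j; P]) := by
  classical
  have := hξ.isProbabilityMeasure
  induction s using Finset.induction_on with
  | empty => simp [quadForm]
  | insert n s hn ih =>
    have M := hξ.integral_monomial hn b (b n) c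
    have e : ∀ ω, quadForm ξ b (insert n s) ω * linForm ξ c (insert n s) ω ^ 2 =
        2 * c n ^ 2 * (ξ n ω ^ 3 * (quadForm ξ b s ω ^ 0 * linForm ξ (b n) s ω ^ 1 *
          linForm ξ c s ω ^ 0)) +
        4 * c n * (ξ n ω ^ 2 * (quadForm ξ b s ω ^ 0 * linForm ξ (b n) s ω ^ 1 *
          linForm ξ c s ω ^ 1)) +
        2 * (ξ n ω ^ 1 * (quadForm ξ b s ω ^ 0 * linForm ξ (b n) s ω ^ 1 *
          linForm ξ c s ω ^ 2)) +
        c n ^ 2 * (ξ n ω ^ 2 * (quadForm ξ b s ω ^ 1 * linForm ξ (b n) s ω ^ 0 *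
          linForm ξ c s ω ^ 0)) +
        2 * c n * (ξ n ω ^ 1 * (quadForm ξ b s ω ^ 1 * linForm ξ (b n) s ω ^ 0 *
          linForm ξ c s ω ^ 1)) +
        1 * (ξ n ω ^ 0 * (quadForm ξ b s ω ^ 1 * linForm ξ (b n) s ω ^ 0 *
          linForm ξ c s ω ^ 2)) := by
      intro ω; rw [linForm_insert ξ c hn, quadForm_insert ξ hb hb0 hn]; ring
    simp_rw [e]
    rw [integral_lin_comb (M _ _ _ _).1 (M _ _ _ _).1 (M _ _ _ _).1 (M _ _ _ _).1 (M _ _ _ _).1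
      (M _ _ _ _).1]
    simp only [(M _ _ _ _).2]
    have h2 : ∑ i ∈ s, b i n * c i * c n * (Var[ξ i; P] * Var[ξ n; P]) =
        c n * Var[ξ n; P] * ∑ i ∈ s, b n i * c i * Var[ξ i; P] := by
      rw [Finset.mul_sum]; exact Finset.sum_congr rfl fun i _ => by rw [hb i n]; ring
    have h3 : ∑ i ∈ s, b n i * c n * c i * (Var[ξ n; P] * Var[ξ i; P]) =
        c n * Var[ξ n; P] * ∑ i ∈ s, b n i * c i * Var[ξ i; P] := by
      rw [Finset.mul_sum]; exact Finset.sum_congr rfl fun i _ => by ring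
    simp [integral_sq_gaussian (hξ.gaussian n) (hξ.centered n), hξ.centered n, ih,
      integral_cube_gaussian (hξ.gaussian n) (hξ.centered n), hξ.integral_quadForm hb hb0,
      Finset.sum_insert hn, hξ.integral_linForm_mul, Finset.sum_add_distrib, hb0, h2, h3]
    ring

/-- The third moment of a quadratic form in independent Gaussian variables: the sum over the
closed triangles. -/
lemma integral_quadForm_cube (hξ : IndepGaussian ξ P) (hb : ∀ i j, b i j = b j i)
    (hb0 : ∀ i, b i i = 0) (s : Finset ι) :
    ∫ ω, quadForm ξ b s ω ^ 3 ∂P =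
      8 * ∑ i ∈ s, ∑ j ∈ s, ∑ k ∈ s, b i j * b j k * b k i *
        (Var[ξ i; P] * Var[ξ j; P] * Var[ξ k; P]) := by
  classical
  have := hξ.isProbabilityMeasure
  induction s using Finset.induction_on with
  | empty => simp [quadForm]
  | insert n s hn ih =>
    have M := hξ.integral_monomial hn b (b n) 0
    have e : ∀ ω, quadForm ξ b (insert n s) ω ^ 3 =
        8 * (ξ n ω ^ 3 * (quadForm ξ b s ω ^ 0 * linForm ξ (b n) s ω ^ 3 *
          linForm ξ 0 s ω ^ 0)) +
        12 * (ξ n ω ^ 2 * (quadForm ξ b s ω ^ 1 * linForm ξ (b n) s ω ^ 2 *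
          linForm ξ 0 s ω ^ 0)) +
        6 * (ξ n ω ^ 1 * (quadForm ξ b s ω ^ 2 * linForm ξ (b n) s ω ^ 1 *
          linForm ξ 0 s ω ^ 0)) +
        1 * (ξ n ω ^ 0 * (quadForm ξ b s ω ^ 3 * linForm ξ (b n) s ω ^ 0 *
          linForm ξ 0 s ω ^ 0)) +
        0 * (ξ n ω ^ 0 * (quadForm ξ b s ω ^ 0 * linForm ξ (b n) s ω ^ 0 *
          linForm ξ 0 s ω ^ 0)) +
        0 * (ξ n ω ^ 0 * (quadForm ξ b s ω ^ 0 * linForm ξ (b n) s ω ^ 0 *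
          linForm ξ 0 s ω ^ 0)) := by
      intro ω; rw [quadForm_insert ξ hb hb0 hn]; ring
    simp_rw [e]
    rw [integral_lin_comb (M _ _ _ _).1 (M _ _ _ _).1 (M _ _ _ _).1 (M _ _ _ _).1 (M _ _ _ _).1
      (M 0 0 0 0).1]
    simp only [(M _ _ _ _).2]
    set v : ι → ℝ := fun i => Var[ξ i; P] with hv
    set T := ∑ i ∈ s, ∑ j ∈ s, b i j * b n i * b n j * (v i * v j) with hT
    have h1 : ∑ j ∈ s, ∑ k ∈ s, b n j * b j k * b k n * (v n * v j * v k) = v n * T := by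
      rw [hT, Finset.mul_sum]
      refine Finset.sum_congr rfl fun i _ => ?_
      rw [Finset.mul_sum]
      exact Finset.sum_congr rfl fun j _ => by rw [hb j n]; ring
    have h2 : ∑ i ∈ s, ∑ k ∈ s, b i n * b n k * b k i * (v i * v n * v k) = v n * T := by
      rw [hT, Finset.mul_sum]
      refine Finset.sum_congr rfl fun i _ => ?_
      rw [Finset.mul_sum]
      exact Finset.sum_congr rfl fun j _ => by rw [hb i n, hb j i]; ring
    have h3 : ∑ i ∈ s, ∑ j ∈ s, b i j * b j n * b n i * (v i * v j * v n) = v n * T := by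
      rw [hT, Finset.mul_sum]
      refine Finset.sum_congr rfl fun i _ => ?_
      rw [Finset.mul_sum]
      exact Finset.sum_congr rfl fun j _ => by rw [hb j n]; ring
    have hQ := hξ.integral_quadForm_mul_linForm_sq hb hb0 (b n) s
    simp only [pow_zero, mul_one, one_mul, pow_one, zero_mul, add_zero,
      integral_sq_gaussian (hξ.gaussian n) (hξ.centered n), hξ.centered n, ih, hQ,
      integral_cube_gaussian (hξ.gaussian n) (hξ.centered n), integral_const,
      Finset.sum_insert hn, Finset.sum_add_distrib, hb0, mul_zero, zero_add, Finset.sum_const_zero,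
      probReal_univ, one_smul]
    rw [h1, h2, h3]
    ring

/-- Hypercontractivity for quadratic forms, by induction on the number of variables. Writing the
form as `2 ξ L + Q` with `ξ` independent of the forms `L` and `Q`, its fourth moment is `16 E[ξ⁴]
E[L⁴] + 24 E[ξ²] E[Q² L²] + E[Q⁴]`, where the mixed term is bounded by Cauchy-Schwarz. -/
lemma integral_quadForm_fourth_le (hξ : IndepGaussian ξ P) (hb : ∀ i j, b i j = b j i)
    (hb0 : ∀ i, b i i = 0) (s : Finset ι) :
    ∫ ω, quadForm ξ b s ω ^ 4 ∂P ≤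
      81 * (2 * ∑ i ∈ s, ∑ j ∈ s, b i j ^ 2 * (Var[ξ i; P] * Var[ξ j; P])) ^ 2 := by
  classical
  have := hξ.isProbabilityMeasure
  induction s using Finset.induction_on with
  | empty => simp [quadForm]
  | insert n s hn ih =>
    have M := hξ.integral_monomial hn b (b n) 0
    have e : ∀ ω, quadForm ξ b (insert n s) ω ^ 4 =
        16 * (ξ n ω ^ 4 * (quadForm ξ b s ω ^ 0 * linForm ξ (b n) s ω ^ 4 *
          linForm ξ 0 s ω ^ 0)) +
        32 * (ξ n ω ^ 3 * (quadForm ξ b s ω ^ 1 * linForm ξ (b n) s ω ^ 3 *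
          linForm ξ 0 s ω ^ 0)) +
        24 * (ξ n ω ^ 2 * (quadForm ξ b s ω ^ 2 * linForm ξ (b n) s ω ^ 2 *
          linForm ξ 0 s ω ^ 0)) +
        8 * (ξ n ω ^ 1 * (quadForm ξ b s ω ^ 3 * linForm ξ (b n) s ω ^ 1 *
          linForm ξ 0 s ω ^ 0)) +
        1 * (ξ n ω ^ 0 * (quadForm ξ b s ω ^ 4 * linForm ξ (b n) s ω ^ 0 *
          linForm ξ 0 s ω ^ 0)) +
        0 * (ξ n ω ^ 0 * (quadForm ξ b s ω ^ 0 * linForm ξ (b n) s ω ^ 0 *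
          linForm ξ 0 s ω ^ 0)) := by
      intro ω; rw [quadForm_insert ξ hb hb0 hn]; ring
    simp_rw [e]
    rw [integral_lin_comb (M _ _ _ _).1 (M _ _ _ _).1 (M _ _ _ _).1 (M _ _ _ _).1 (M _ _ _ _).1
      (M 0 0 0 0).1]
    simp only [(M _ _ _ _).2]
    set v : ι → ℝ := fun i => Var[ξ i; P] with hv
    have hv0 : ∀ i, 0 ≤ v i := fun i => variance_nonneg _ _
    set B := 2 * ∑ i ∈ s, ∑ j ∈ s, b i j ^ 2 * (v i * v j) with hB
    set Λ := ∑ i ∈ s, b n i ^ 2 * v i with hΛ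
    have hB0 : 0 ≤ B := mul_nonneg zero_le_two <| Finset.sum_nonneg fun i _ =>
      Finset.sum_nonneg fun j _ => mul_nonneg (sq_nonneg _) (mul_nonneg (hv0 i) (hv0 j))
    have hΛ0 : 0 ≤ Λ := Finset.sum_nonneg fun i _ => mul_nonneg (sq_nonneg _) (hv0 i)
    have hL4 : ∫ ω, linForm ξ (b n) s ω ^ 4 ∂P = 3 * Λ ^ 2 := hξ.integral_linForm_fourth (b n) s
    have ih' : ∫ ω, quadForm ξ b s ω ^ 4 ∂P ≤ 81 * B ^ 2 := ih
    -- Cauchy-Schwarz: `E[Q² L²]² ≤ E[Q⁴] E[L⁴] ≤ 81 B² * 3 Λ²`, and `√243 ≤ 27`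
    have hcs : ∫ ω, quadForm ξ b s ω ^ 2 * linForm ξ (b n) s ω ^ 2 ∂P ≤ 27 * B * Λ := by
      have hq := (hξ.hasMoments_quadForm b s).pow 4
      have hl := (hξ.hasMoments_linForm (b n) s).pow 4
      have hql := ((hξ.hasMoments_quadForm b s).pow 2).mul
        ((hξ.hasMoments_linForm (b n) s).pow 2)
      have key : ∀ t u : ℝ, 2 * t * u * ∫ ω, quadForm ξ b s ω ^ 2 * linForm ξ (b n) s ω ^ 2 ∂P ≤
          t ^ 2 * (81 * B ^ 2) + u ^ 2 * (3 * Λ ^ 2) := by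
        intro t u
        calc 2 * t * u * ∫ ω, quadForm ξ b s ω ^ 2 * linForm ξ (b n) s ω ^ 2 ∂P
            = ∫ ω, 2 * t * u * (quadForm ξ b s ω ^ 2 * linForm ξ (b n) s ω ^ 2) ∂P := by
              rw [integral_const_mul]
          _ ≤ ∫ ω, (t ^ 2 * quadForm ξ b s ω ^ 4 + u ^ 2 * linForm ξ (b n) s ω ^ 4) ∂P := by
              refine integral_mono (hql.const_mul _).integrable
                ((hq.const_mul _).add (hl.const_mul _)).integrable fun ω => ?_
              nlinarith [sq_nonneg (t * quadForm ξ b s ω ^ 2 - u * linForm ξ (b n) s ω ^ 2)]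
          _ = t ^ 2 * ∫ ω, quadForm ξ b s ω ^ 4 ∂P + u ^ 2 * (3 * Λ ^ 2) := by
              rw [integral_add (hq.const_mul _).integrable (hl.const_mul _).integrable,
                integral_const_mul, integral_const_mul, hL4]
          _ ≤ _ := by gcongr
      set I := ∫ ω, quadForm ξ b s ω ^ 2 * linForm ξ (b n) s ω ^ 2 ∂P
      have hI : I ^ 2 ≤ (81 * B ^ 2) * (3 * Λ ^ 2) := by
        have hd := discrim_le_zero (a := 81 * B ^ 2) (b := -2 * I) (c := 3 * Λ ^ 2) fun x => by
          have := key x 1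
          nlinarith
        rw [discrim] at hd; nlinarith
      refine (abs_le_of_sq_le_sq' (hI.trans ?_) (by positivity)).2
      nlinarith [sq_nonneg (B * Λ)]
    have hs : ∑ i ∈ s, b i n ^ 2 * (v i * v n) = v n * Λ := by
      rw [hΛ, Finset.mul_sum]; exact Finset.sum_congr rfl fun i _ => by rw [hb i n]; ring
    have hs' : ∑ i ∈ s, b n i ^ 2 * (v n * v i) = v n * Λ := by
      rw [hΛ, Finset.mul_sum]; exact Finset.sum_congr rfl fun i _ => by ring
    simp only [pow_zero, mul_one, one_mul, pow_one, zero_mul, add_zero,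
      integral_sq_gaussian (hξ.gaussian n) (hξ.centered n), hξ.centered n, hL4,
      integral_cube_gaussian (hξ.gaussian n) (hξ.centered n),
      integral_fourth_gaussian (hξ.gaussian n) (hξ.centered n), integral_const,
      Finset.sum_insert hn, Finset.sum_add_distrib, hb0, mul_zero,
      probReal_univ, one_smul]
    have hR : (2 * ((0 ^ 2 * (v n * v n) + ∑ x ∈ s, b n x ^ 2 * (v n * v x)) +
      (∑ x ∈ s, b x n ^ 2 * (v x * v n) + ∑ i ∈ s, ∑ j ∈ s, b i j ^ 2 * (v i * v j)))) =
        B + 4 * (v n * Λ) := by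
      rw [hs, hs', hB]; ring
    change 16 * (3 * v n ^ 2 * (3 * Λ ^ 2)) + 24 * (v n * _) + _ ≤ 81 * (2 * ((0 ^ 2 * (v n * v n) +
        ∑ x ∈ s, b n x ^ 2 * (v n * v x)) +
      (∑ x ∈ s, b x n ^ 2 * (v x * v n) + ∑ i ∈ s, ∑ j ∈ s, b i j ^ 2 * (v i * v j)))) ^ 2
    rw [hR]
    have := mul_le_mul_of_nonneg_left hcs (hv0 n)
    nlinarith [sq_nonneg (v n * Λ)]

end IndepGaussian

end ChaosMoments

/-! ### The isometry of the double integral -/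

section Isometry

variable {Ω : Type*}

/-- The `σ`-algebra generated by the noise. -/
abbrev noiseSigma (W : FinSet → Ω → ℝ) : MeasurableSpace Ω :=
  MeasurableSpace.comap (fun ω A => W A ω) MeasurableSpace.pi

lemma measurable_noiseSigma (W : FinSet → Ω → ℝ) (A : FinSet) : Measurable[noiseSigma W] (W A) :=
  (measurable_pi_apply A).comp (comap_measurable (fun ω A => W A ω))

variable {m : MeasurableSpace Ω} [mΩ : MeasurableSpace Ω] {P : Measure Ω}

/-- Isserlis' formula for four variables, by polarisation of the fourth moment. -/
lemma integral_mul_four_gaussian {X : Fin 4 → Ω → ℝ} (hX : IsGaussianProcess X P)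
    (h0 : ∀ i, ∫ ω, X i ω ∂P = 0) :
    ∫ ω, X 0 ω * X 1 ω * (X 2 ω * X 3 ω) ∂P =
      cov[X 0, X 1; P] * cov[X 2, X 3; P] + cov[X 0, X 2; P] * cov[X 1, X 3; P] +
        cov[X 0, X 3; P] * cov[X 1, X 2; P] := by
  have := hX.isProbabilityMeasure
  have hm : ∀ i, HasMoments (X i) P := fun i => (hX.hasGaussianLaw_eval i).hasMoments
  have hcov : ∀ i j, cov[X i, X j; P] = ∫ ω, X i ω * X j ω ∂P := fun i j => by
    rw [covariance_eq_sub (hm i 2 (by simp)) (hm j 2 (by simp)), h0, zero_mul, sub_zero]; rfl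
  let c : ℝ → ℝ → ℝ → Fin 4 → ℝ := fun s t u => ![1, s, t, u]
  let Z : ℝ → ℝ → ℝ → Ω → ℝ := fun s t u ω => X 0 ω + s * X 1 ω + t * X 2 ω + u * X 3 ω
  have hZe : ∀ s t u, Z s t u = fun ω => ∑ i, c s t u i • X i ω := fun s t u => by
    ext ω; simp [Z, c, Fin.sum_univ_four]
  have hZ : ∀ s t u, HasGaussianLaw (Z s t u) P := fun s t u => by
    rw [hZe]; exact (hX.smul (c s t u)).hasGaussianLaw_fun_sum
  have hZ0 : ∀ s t u, ∫ ω, Z s t u ω ∂P = 0 := fun s t u => by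
    simp only [hZe]
    rw [integral_finsetSum (f := fun i ω => c s t u i • X i ω) _ fun i _ =>
      ((hm i).integrable).smul (c s t u i)]
    simp [integral_const_mul, h0]
  have hV : ∀ s t u, Var[Z s t u; P] = ∑ i, ∑ j, c s t u i * c s t u j * cov[X i, X j; P] := by
    intro s t u
    rw [← covariance_self (hZ s t u).aemeasurable, hZe]
    have := covariance_fun_sum_fun_sum (μ := P) (X := fun i ω => c s t u i • X i ω)
      (Y := fun i ω => c s t u i • X i ω)
      (fun i => (hm i 2 (by simp)).const_smul (c s t u i))
      (fun i => (hm i 2 (by simp)).const_smul (c s t u i))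
    rw [this]
    refine Finset.sum_congr rfl fun i _ => Finset.sum_congr rfl fun j _ => ?_
    simp only [smul_eq_mul]
    rw [covariance_const_mul_left, covariance_const_mul_right]; ring
  have h4 : ∀ s t u, ∫ ω, Z s t u ω ^ 4 ∂P = 3 * Var[Z s t u; P] ^ 2 := fun s t u =>
    integral_fourth_gaussian (hZ s t u) (hZ0 s t u)
  have hi : ∀ s t u, Integrable (fun ω => Z s t u ω ^ 4) P := fun s t u =>
    ((hZ s t u).hasMoments.pow 4).integrable
  have e : ∀ ω, X 0 ω * X 1 ω * (X 2 ω * X 3 ω) =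
      1 / 192 * (1 * Z 1 1 1 ω ^ 4 + (-1) * Z (-1) 1 1 ω ^ 4 + (-1) * Z 1 (-1) 1 ω ^ 4
        + (-1) * Z 1 1 (-1) ω ^ 4 + 1 * Z (-1) (-1) 1 ω ^ 4 + 1 * Z (-1) 1 (-1) ω ^ 4) +
      1 / 192 * (1 * Z 1 (-1) (-1) ω ^ 4 + (-1) * Z (-1) (-1) (-1) ω ^ 4
        + 0 * Z 1 1 1 ω ^ 4 + 0 * Z 1 1 1 ω ^ 4 + 0 * Z 1 1 1 ω ^ 4 + 0 * Z 1 1 1 ω ^ 4) := by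
    intro ω; simp only [Z]; ring
  simp_rw [e]
  rw [integral_add, integral_const_mul, integral_const_mul,
    integral_lin_comb (hi _ _ _) (hi _ _ _) (hi _ _ _) (hi _ _ _) (hi _ _ _) (hi _ _ _),
    integral_lin_comb (hi _ _ _) (hi _ _ _) (hi _ _ _) (hi _ _ _) (hi _ _ _) (hi _ _ _)]
  · simp only [h4, hV, Fin.sum_univ_four]
    have hs : ∀ i j, cov[X i, X j; P] = cov[X j, X i; P] := fun i j => covariance_comm _ _
    simp only [c, Matrix.cons_val_zero, Matrix.cons_val_one, Matrix.cons_val, hs 1 0, hs 2 0,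
      hs 3 0, hs 2 1, hs 3 1, hs 3 2]
    ring
  · exact (((((((hi _ _ _).const_mul _).add ((hi _ _ _).const_mul _)).add
      ((hi _ _ _).const_mul _)).add ((hi _ _ _).const_mul _)).add
      ((hi _ _ _).const_mul _)).add ((hi _ _ _).const_mul _)).const_mul _
  · exact (((((((hi _ _ _).const_mul _).add ((hi _ _ _).const_mul _)).add
      ((hi _ _ _).const_mul _)).add ((hi _ _ _).const_mul _)).add
      ((hi _ _ _).const_mul _)).add ((hi _ _ _).const_mul _)).const_mul _

lemma IsWhiteNoise.hasMoments {W : FinSet → Ω → ℝ} (hW : IsWhiteNoise P W) (A : FinSet) :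
    HasMoments (W A) P := (hW.gaussian.hasGaussianLaw_eval A).hasMoments

/-- As `A` and `B` are disjoint, the pairing of `W A` with `W B` does not contribute. -/
lemma IsWhiteNoise.integral_mul_four {W : FinSet → Ω → ℝ} (hW : IsWhiteNoise P W)
    (A B A' B' : FinSet) (hAB : Disjoint A.1 B.1) :
    ∫ ω, W A ω * W B ω * (W A' ω * W B' ω) ∂P =
      volume.real (A.1 ∩ A'.1) * volume.real (B.1 ∩ B'.1) +
        volume.real (A.1 ∩ B'.1) * volume.real (B.1 ∩ A'.1) := by
  have h := integral_mul_four_gaussian (hW.gaussian.comp_right ![A, B, A', B'])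
    (fun i => hW.centered _)
  simp only [Function.comp, Matrix.cons_val_zero, Matrix.cons_val_one, Matrix.cons_val] at h
  rw [h]
  simp only [hW.covariance, hAB.inter_eq]
  simp

/-- The measure for which the kernels of double integrals are square integrable. -/
abbrev kerMeasure (P : Measure Ω) : Measure (Ω × ℝ × ℝ) := P.prod (volume.prod volume)

/-- Exchange of the two integration variables of a random kernel. -/
def kerSwap (p : Ω × ℝ × ℝ) : Ω × ℝ × ℝ := (p.1, p.2.2, p.2.1)

lemma measurePreserving_kerSwap [SFinite P] :
    MeasurePreserving kerSwap (kerMeasure P) (kerMeasure P) :=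
  (MeasurePreserving.id P).prod Measure.measurePreserving_swap

variable {W : FinSet → Ω → ℝ}

lemma integral_indicator_mul {F : Set Ω} (hm : m ≤ mΩ) (hF : MeasurableSet[m] F)
    (hind : Indep m (noiseSigma W) P) {Y : Ω → ℝ} (hY : Measurable[noiseSigma W] Y)
    (hY' : Measurable Y) :
    ∫ ω, F.indicator 1 ω * Y ω ∂P = P.real F * ∫ ω, Y ω ∂P := by
  have hFm : Measurable[m] (F.indicator (1 : Ω → ℝ)) :=
    Measurable.indicator (m := m) measurable_const hF
  have hi : IndepFun (F.indicator (1 : Ω → ℝ)) Y P :=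
    (IndepFun_iff_Indep _ _ _).2 (indep_of_indep_of_le_left
      (indep_of_indep_of_le_right hind hY.comap_le) hFm.comap_le)
  rw [hi.integral_fun_mul_eq_mul_integral (hFm.mono hm le_rfl).aestronglyMeasurable
    hY'.aestronglyMeasurable, integral_indicator_one (hm _ hF)]

lemma measurableSet_box {F : Set Ω} (hF : MeasurableSet F) (A B : FinSet) :
    MeasurableSet (F ×ˢ A.1 ×ˢ B.1) := hF.prod (A.2.1.prod B.2.1)

lemma kerMeasure_real_box [SFinite P] (F : Set Ω) (A B : Set ℝ) :
    (kerMeasure P).real (F ×ˢ A ×ˢ B) = P.real F * (volume.real A * volume.real B) := by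
  simp [measureReal_prod_prod]

lemma memLp_elementaryGraph [IsProbabilityMeasure P] (hm : m ≤ mΩ) (hW : IsWhiteNoise P W)
    {p : (Ω × ℝ × ℝ → ℝ) × (Ω → ℝ)} (hp : p ∈ elementaryGraph m W) :
    MemLp p.1 2 (kerMeasure P) ∧ MemLp p.2 2 P := by
  refine Submodule.span_induction (p := fun p _ => MemLp p.1 2 (kerMeasure P) ∧ MemLp p.2 2 P)
    ?_ ?_ ?_ ?_ hp
  rotate_left
  · simp only [Prod.fst_zero, Prod.snd_zero, MemLp.zero, and_self]
  · intro x y _ _ hx hy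
    rw [Prod.fst_add, Prod.snd_add]
    exact ⟨hx.1.add hy.1, hx.2.add hy.2⟩
  · intro a x _ hx
    rw [Prod.smul_fst, Prod.smul_snd]
    exact ⟨hx.1.const_smul a, hx.2.const_smul a⟩
  rintro _ ⟨F, A, B, hF, hAB, rfl⟩
  refine ⟨?_, (((hW.hasMoments A).mul (hW.hasMoments B)) 2 (by simp)).indicator (hm _ hF)⟩
  refine memLp_indicator_const 2 (measurableSet_box (hm _ hF) A B) (1 : ℝ) (Or.inr ?_)
  simp only [Measure.prod_prod]
  exact ENNReal.mul_ne_top (measure_ne_top _ _) (ENNReal.mul_ne_top A.2.2 B.2.2)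

lemma integrable_mul_swap [SFinite P] {g g' : Ω × ℝ × ℝ → ℝ} (hg : MemLp g 2 (kerMeasure P))
    (hg' : MemLp g' 2 (kerMeasure P)) :
    Integrable (fun q => g q * g' q) (kerMeasure P) ∧
      Integrable (fun q => g q * g' (kerSwap q)) (kerMeasure P) :=
  ⟨hg.integrable_mul hg',
    hg.integrable_mul (hg'.comp_measurePreserving measurePreserving_kerSwap)⟩

/-- The isometry formula `E[I(g) I(g')] = ⟨g, g'⟩ + ⟨g, g' ∘ swap⟩` on elementary kernels. It is
bilinear, hence it suffices to check it on indicators of boxes. -/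
lemma integral_mul_elementaryGraph [IsProbabilityMeasure P] (hm : m ≤ mΩ)
    (hW : IsWhiteNoise P W) (hind : Indep m (noiseSigma W) P)
    {p q : (Ω × ℝ × ℝ → ℝ) × (Ω → ℝ)} (hp : p ∈ elementaryGraph m W)
    (hq : q ∈ elementaryGraph m W) :
    ∫ ω, p.2 ω * q.2 ω ∂P =
      ∫ x, p.1 x * q.1 x ∂(kerMeasure P) + ∫ x, p.1 x * q.1 (kerSwap x) ∂(kerMeasure P) := by
  have M := fun {p : (Ω × ℝ × ℝ → ℝ) × (Ω → ℝ)} (hp : p ∈ elementaryGraph m W) =>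
    memLp_elementaryGraph hm hW hp
  refine Submodule.span_induction (p := fun p _ => ∫ ω, p.2 ω * q.2 ω ∂P =
      ∫ x, p.1 x * q.1 x ∂(kerMeasure P) + ∫ x, p.1 x * q.1 (kerSwap x) ∂(kerMeasure P))
    ?_ (by simp) ?_ ?_ hp
  · rintro p ⟨F, A, B, hF, hAB, rfl⟩
    have hp' : ((F ×ˢ A.1 ×ˢ B.1).indicator 1, F.indicator (fun ω => W A ω * W B ω)) ∈
      elementaryGraph m W := Submodule.subset_span ⟨F, A, B, hF, hAB, rfl⟩
    refine Submodule.span_induction (p := fun q _ =>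
      ∫ ω, F.indicator (fun ω => W A ω * W B ω) ω * q.2 ω ∂P =
      ∫ x, (F ×ˢ A.1 ×ˢ B.1).indicator 1 x * q.1 x ∂(kerMeasure P) +
        ∫ x, (F ×ˢ A.1 ×ˢ B.1).indicator 1 x * q.1 (kerSwap x) ∂(kerMeasure P))
      ?_ (by simp) ?_ ?_ hq
    · rintro _ ⟨F', A', B', hF', hAB', rfl⟩
      have e1 : ∀ ω, F.indicator (fun ω => W A ω * W B ω) ω *
          F'.indicator (fun ω => W A' ω * W B' ω) ω =
          (F ∩ F').indicator 1 ω * (W A ω * W B ω * (W A' ω * W B' ω)) := by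
        intro ω
        by_cases h1 : ω ∈ F <;> by_cases h2 : ω ∈ F' <;> simp [h1, h2]
      have e2 : ∀ x, (F ×ˢ A.1 ×ˢ B.1).indicator (1 : Ω × ℝ × ℝ → ℝ) x *
          (F' ×ˢ A'.1 ×ˢ B'.1).indicator 1 x =
          ((F ∩ F') ×ˢ (A.1 ∩ A'.1) ×ˢ (B.1 ∩ B'.1)).indicator 1 x := by
        intro x
        rw [← Set.prod_inter_prod, ← Set.prod_inter_prod, Set.inter_indicator_one]
        rfl
      have e3 : ∀ x, (F ×ˢ A.1 ×ˢ B.1).indicator (1 : Ω × ℝ × ℝ → ℝ) x *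
          (F' ×ˢ A'.1 ×ˢ B'.1).indicator 1 (kerSwap x) =
          ((F ∩ F') ×ˢ (A.1 ∩ B'.1) ×ˢ (B.1 ∩ A'.1)).indicator 1 x := by
        intro x
        rw [← Set.prod_inter_prod, ← Set.prod_inter_prod, Set.inter_indicator_one]
        have : kerSwap x ∈ F' ×ˢ A'.1 ×ˢ B'.1 ↔ x ∈ F' ×ˢ B'.1 ×ˢ A'.1 := by
          simp only [kerSwap, Set.mem_prod, and_comm (a := x.2.2 ∈ A'.1)]
        rw [Pi.mul_apply]
        by_cases hx : x ∈ F' ×ˢ B'.1 ×ˢ A'.1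
        · rw [Set.indicator_of_mem hx, Set.indicator_of_mem (this.2 hx)]; rfl
        · rw [Set.indicator_of_notMem hx, Set.indicator_of_notMem (mt this.1 hx)]
      simp only [e1, e2, e3]
      have hd := hm _ (hF.inter hF')
      have hYm : ∀ m' : MeasurableSpace Ω, (∀ A, Measurable[m'] (W A)) → Measurable[m'] fun ω =>
          W A ω * W B ω * (W A' ω * W B' ω) := fun m' h =>
        ((h A).mul (h B)).mul ((h A').mul (h B'))
      rw [integral_indicator_mul hm (hF.inter hF') hind (hYm _ (measurable_noiseSigma W))
        (hYm _ hW.measurable), hW.integral_mul_four A B A' B' hAB,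
        integral_indicator_one (hd.prod ((A.2.1.inter A'.2.1).prod (B.2.1.inter B'.2.1))),
        integral_indicator_one (hd.prod ((A.2.1.inter B'.2.1).prod (B.2.1.inter A'.2.1))),
        kerMeasure_real_box, kerMeasure_real_box]
      ring
    · intro x y hx hy h1 h2
      have I := fun {x} (hx : x ∈ elementaryGraph m W) => integrable_mul_swap (M hp').1 (M hx).1
      have J : ∀ {x}, x ∈ elementaryGraph m W → Integrable (fun ω =>
          F.indicator (fun ω => W A ω * W B ω) ω * x.2 ω) P := fun hx =>
        (M hp').2.integrable_mul (M hx).2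
      simp only [Prod.fst_add, Prod.snd_add, Pi.add_apply, mul_add]
      rw [integral_add (J hx) (J hy), integral_add (I hx).1 (I hy).1,
        integral_add (I hx).2 (I hy).2, h1, h2]
      ring
    · intro a x hx h1
      simp only [Prod.smul_fst, Prod.smul_snd, Pi.smul_apply, smul_eq_mul, mul_left_comm _ a]
      rw [integral_const_mul, integral_const_mul, integral_const_mul, h1, mul_add]
  · intro x y hx hy h1 h2
    have I := fun {x} (hx : x ∈ elementaryGraph m W) => integrable_mul_swap (M hx).1 (M hq).1
    have J : ∀ {x}, x ∈ elementaryGraph m W → Integrable (fun ω => x.2 ω * q.2 ω) P :=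
      fun hx => (M hx).2.integrable_mul (M hq).2
    simp only [Prod.fst_add, Prod.snd_add, Pi.add_apply, add_mul]
    rw [integral_add (J hx) (J hy), integral_add (I hx).1 (I hy).1,
      integral_add (I hx).2 (I hy).2, h1, h2]
    ring
  · intro a x hx h1
    simp only [Prod.smul_fst, Prod.smul_snd, Pi.smul_apply, smul_eq_mul, mul_assoc]
    rw [integral_const_mul, integral_const_mul, integral_const_mul, h1, mul_add]

lemma eLpNorm_two_eq {α : Type*} [MeasurableSpace α] {μ : Measure α} {f : α → ℝ}
    (hf : MemLp f 2 μ) : eLpNorm f 2 μ = ENNReal.ofReal (√(∫ x, f x ^ 2 ∂μ)) := by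
  rw [hf.eLpNorm_eq_integral_rpow_norm (by simp) (by simp)]
  congr 1
  simp [Real.sqrt_eq_rpow]

lemma eLpNorm_elementaryGraph_le [IsProbabilityMeasure P] (hm : m ≤ mΩ)
    (hW : IsWhiteNoise P W) (hind : Indep m (noiseSigma W) P)
    {p : (Ω × ℝ × ℝ → ℝ) × (Ω → ℝ)} (hp : p ∈ elementaryGraph m W) :
    eLpNorm p.2 2 P ≤ 2 * eLpNorm p.1 2 (kerMeasure P) := by
  obtain ⟨h1, h2⟩ := memLp_elementaryGraph hm hW hp
  have hi := integral_mul_elementaryGraph hm hW hind hp hp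
  have hsw : ∫ x, p.1 x * p.1 (kerSwap x) ∂(kerMeasure P) ≤ ∫ x, p.1 x ^ 2 ∂(kerMeasure P) := by
    have h3 : Integrable (fun x => p.1 (kerSwap x) ^ 2) (kerMeasure P) :=
      (h1.comp_measurePreserving measurePreserving_kerSwap).integrable_sq
    have h4 : ∫ x, p.1 (kerSwap x) ^ 2 ∂(kerMeasure P) = ∫ x, p.1 x ^ 2 ∂(kerMeasure P) := by
      have := measurePreserving_kerSwap (P := P)
      conv_rhs => rw [← this.map_eq]
      rw [integral_map this.measurable.aemeasurable]
      rw [this.map_eq]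
      exact h1.integrable_sq.aestronglyMeasurable
    have : ∫ x, p.1 x * p.1 (kerSwap x) ∂(kerMeasure P) ≤
        ∫ x, (1 / 2 * p.1 x ^ 2 + 1 / 2 * p.1 (kerSwap x) ^ 2) ∂(kerMeasure P) :=
      integral_mono (integrable_mul_swap h1 h1).2
        ((h1.integrable_sq.const_mul _).add (h3.const_mul _)) fun x => by
          nlinarith [sq_nonneg (p.1 x - p.1 (kerSwap x))]
    rw [integral_add (h1.integrable_sq.const_mul _) (h3.const_mul _), integral_const_mul,
      integral_const_mul, h4] at this
    linarith
  rw [eLpNorm_two_eq h1, eLpNorm_two_eq h2, show (2 : ENNReal) = ENNReal.ofReal 2 by simp,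
    ← ENNReal.ofReal_mul zero_le_two]
  refine ENNReal.ofReal_le_ofReal (Real.sqrt_le_iff.2 ⟨by positivity, ?_⟩)
  rw [mul_pow, Real.sq_sqrt (integral_nonneg fun _ => sq_nonneg _)]
  simp only [← sq] at hi
  have : 0 ≤ ∫ x, p.1 x ^ 2 ∂(kerMeasure P) := integral_nonneg fun _ => sq_nonneg _
  rw [hi]; linarith

lemma eLpNorm_sub_elementaryGraph_le [IsProbabilityMeasure P] (hm : m ≤ mΩ)
    (hW : IsWhiteNoise P W) (hind : Indep m (noiseSigma W) P) {G : Ω × ℝ × ℝ → ℝ}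
    (hG : AEStronglyMeasurable G (kerMeasure P))
    {p q : (Ω × ℝ × ℝ → ℝ) × (Ω → ℝ)} (hp : p ∈ elementaryGraph m W)
    (hq : q ∈ elementaryGraph m W) :
    eLpNorm (p.2 - q.2) 2 P ≤
      2 * (eLpNorm (G - p.1) 2 (kerMeasure P) + eLpNorm (G - q.1) 2 (kerMeasure P)) := by
  have hd : p - q ∈ elementaryGraph m W := Submodule.sub_mem _ hp hq
  have e : p.1 - q.1 = (G - q.1) - (G - p.1) := by abel
  have h := eLpNorm_elementaryGraph_le hm hW hind hd
  rw [Prod.fst_sub, Prod.snd_sub, e] at h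
  refine h.trans (mul_le_mul_right ?_ 2)
  rw [add_comm]
  exact eLpNorm_sub_le (hG.sub (memLp_elementaryGraph hm hW hq).1.1)
    (hG.sub (memLp_elementaryGraph hm hW hp).1.1) (by simp)

/-- Two sequences of elementary integrals with asymptotically equal kernels are asymptotically
equal. -/
lemma IsDoubleIntegral.tendsto [IsProbabilityMeasure P] (hm : m ≤ mΩ)
    (hW : IsWhiteNoise P W) (hind : Indep m (noiseSigma W) P) {G : Ω × ℝ × ℝ → ℝ} {U : Ω → ℝ}
    (hG : AEStronglyMeasurable G (kerMeasure P)) (hU : IsDoubleIntegral m P W G U)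
    {h : ℕ → (Ω × ℝ × ℝ → ℝ) × (Ω → ℝ)} (hh : ∀ n, h n ∈ elementaryGraph m W)
    (hlim : Tendsto (fun n => eLpNorm (G - (h n).1) 2 (kerMeasure P)) atTop (𝓝 0)) :
    Tendsto (fun n => eLpNorm (U - (h n).2) 2 P) atTop (𝓝 0) := by
  obtain ⟨hU2, g, hg, hg1, hg2⟩ := hU
  have M := fun {p : (Ω × ℝ × ℝ → ℝ) × (Ω → ℝ)} (hp : p ∈ elementaryGraph m W) =>
    memLp_elementaryGraph hm hW hp
  refine tendsto_of_tendsto_of_tendsto_of_le_of_le (tendsto_const_nhds)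
    (h := fun n => eLpNorm (U - (g n).2) 2 P + 2 * (eLpNorm (G - (g n).1) 2 (kerMeasure P) +
      eLpNorm (G - (h n).1) 2 (kerMeasure P))) ?_ (fun n => zero_le) fun n => ?_
  · have := hg2.add (ENNReal.Tendsto.const_mul (hg1.add hlim) (a := 2) (Or.inr (by simp)))
    simpa using this
  · have e : U - (h n).2 = (U - (g n).2) + ((g n).2 - (h n).2) := by simp
    rw [e]
    refine (eLpNorm_add_le (hU2.sub (M (hg n)).2).1 ((M (hg n)).2.sub (M (hh n)).2).1
      (by simp)).trans ?_
    exact add_le_add le_rfl (eLpNorm_sub_elementaryGraph_le hm hW hind hG (hg n) (hh n))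

/-- The double integral exists as soon as the kernel is an `L²` limit of elementary kernels, by
completeness of `L²`. -/
lemma exists_isDoubleIntegral [IsProbabilityMeasure P] (hm : m ≤ mΩ)
    (hW : IsWhiteNoise P W) (hind : Indep m (noiseSigma W) P) {G : Ω × ℝ × ℝ → ℝ}
    (hG : AEStronglyMeasurable G (kerMeasure P))
    {h : ℕ → (Ω × ℝ × ℝ → ℝ) × (Ω → ℝ)} (hh : ∀ n, h n ∈ elementaryGraph m W)
    (hlim : Tendsto (fun n => eLpNorm (G - (h n).1) 2 (kerMeasure P)) atTop (𝓝 0)) :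
    ∃ U, IsDoubleIntegral m P W G U := by
  have M := fun {p : (Ω × ℝ × ℝ → ℝ) × (Ω → ℝ)} (hp : p ∈ elementaryGraph m W) =>
    memLp_elementaryGraph hm hW hp
  let u : ℕ → Lp ℝ 2 P := fun n => (M (hh n)).2.toLp
  have hu : CauchySeq u := by
    rw [EMetric.cauchySeq_iff]
    intro ε hε
    have h4 : 0 < ε / 4 := ENNReal.div_pos hε.ne' (by simp)
    obtain ⟨N, hN⟩ := (hlim.eventually (gt_mem_nhds h4)).exists_forall_of_atTop
    refine ⟨N, fun k hk n hn => ?_⟩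
    rw [Lp.edist_toLp_toLp]
    refine (eLpNorm_sub_elementaryGraph_le hm hW hind hG (hh k) (hh n)).trans_lt ?_
    have h2 : eLpNorm (G - (h k).1) 2 (kerMeasure P) + eLpNorm (G - (h n).1) 2 (kerMeasure P) <
      ε / 4 + ε / 4 := ENNReal.add_lt_add (hN k hk) (hN n hn)
    have h3 : 2 * (ε / 4 + ε / 4) = ε := by
      have h4' : ε / 4 + ε / 4 = ε / 2 := by
        rw [← two_mul, show (4 : ENNReal) = 2 * 2 by norm_num, div_eq_mul_inv,
          ENNReal.mul_inv (by simp) (by simp), div_eq_mul_inv, mul_left_comm ε, ← mul_assoc,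
          ENNReal.mul_inv_cancel (by simp) (by simp), one_mul]
      rw [h4', ENNReal.mul_div_cancel (by simp) (by simp)]
    calc _ < 2 * (ε / 4 + ε / 4) := ENNReal.mul_lt_mul_right (by simp) (by simp) h2
      _ = ε := h3
  obtain ⟨U, hU⟩ := cauchySeq_tendsto_of_complete hu
  refine ⟨U, Lp.memLp U, h, hh, hlim, ?_⟩
  have := (Lp.tendsto_Lp_iff_tendsto_eLpNorm' u U).1 hU
  refine this.congr fun n => ?_
  rw [← eLpNorm_neg]
  refine eLpNorm_congr_ae ?_
  filter_upwards [(M (hh n)).2.coeFn_toLp] with ω hω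
  simp [u, hω]

lemma IsDoubleIntegral.sub [IsProbabilityMeasure P] (hm : m ≤ mΩ)
    (hW : IsWhiteNoise P W) {G G' : Ω × ℝ × ℝ → ℝ} {U U' : Ω → ℝ}
    (hG : AEStronglyMeasurable G (kerMeasure P)) (hG' : AEStronglyMeasurable G' (kerMeasure P))
    (hU : IsDoubleIntegral m P W G U) (hU' : IsDoubleIntegral m P W G' U') :
    IsDoubleIntegral m P W (G - G') (U - U') := by
  have M := fun {p : (Ω × ℝ × ℝ → ℝ) × (Ω → ℝ)} (hp : p ∈ elementaryGraph m W) =>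
    memLp_elementaryGraph hm hW hp
  obtain ⟨hU2, g, hg, hg1, hg2⟩ := hU
  obtain ⟨hU2', g', hg', hg1', hg2'⟩ := hU'
  refine ⟨hU2.sub hU2', fun n => g n - g' n, fun n => Submodule.sub_mem _ (hg n) (hg' n), ?_, ?_⟩
  · refine tendsto_of_tendsto_of_tendsto_of_le_of_le tendsto_const_nhds
      (by simpa using hg1.add hg1') (fun n => zero_le) fun n => ?_
    have e : G - G' - (g n - g' n).1 = (G - (g n).1) - (G' - (g' n).1) := by
      simp only [Prod.fst_sub]; abel
    rw [e]
    exact eLpNorm_sub_le (hG.sub (M (hg n)).1.1) (hG'.sub (M (hg' n)).1.1) (by simp)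
  · refine tendsto_of_tendsto_of_tendsto_of_le_of_le tendsto_const_nhds
      (by simpa using hg2.add hg2') (fun n => zero_le) fun n => ?_
    have e : U - U' - (g n - g' n).2 = (U - (g n).2) - (U' - (g' n).2) := by
      simp only [Prod.snd_sub]; abel
    rw [e]
    exact eLpNorm_sub_le (hU2.sub (M (hg n)).2).1 (hU2'.sub (M (hg' n)).2).1 (by simp)

end Isometry

/-! ### Discretisation of kernels on a grid -/

section Grid

/-- The cell `[i/N, (i+1)/N)`. -/
def gridCell (N : ℕ) (i : ℤ) : FinSet :=
  ⟨Ico ((i : ℝ) / N) ((i + 1) / N), measurableSet_Ico, by simp⟩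

lemma mem_gridCell {N : ℕ} (hN : 0 < N) {i : ℤ} {y : ℝ} :
    y ∈ (gridCell N i).1 ↔ ⌊(N : ℝ) * y⌋ = i := by
  have : (0 : ℝ) < N := by exact_mod_cast hN
  rw [Int.floor_eq_iff, gridCell]
  simp only [mem_Ico, div_le_iff₀ this, lt_div_iff₀ this, mul_comm y]

lemma disjoint_gridCell {N : ℕ} (hN : 0 < N) {i j : ℤ} (hij : i ≠ j) :
    Disjoint (gridCell N i).1 (gridCell N j).1 := by
  rw [Set.disjoint_left]
  intro y hi hj
  exact hij (((mem_gridCell hN).1 hi).symm.trans ((mem_gridCell hN).1 hj))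

lemma volume_gridCell (N : ℕ) (i : ℤ) : volume.real (gridCell N i).1 = 1 / N := by
  have : ((i : ℝ) + 1) / N - i / N = 1 / N := by ring
  rw [gridCell]
  simp only [Measure.real, Real.volume_Ico, this]
  exact ENNReal.toReal_ofReal (by positivity)

/-- The indices of the cells which meet `[-R, R]`. -/
def gridRange (N R : ℕ) : Finset ℤ := Finset.Icc (-(N * R : ℤ)) (N * R)

lemma measurable_floor_mul {Ω : Type*} {m : MeasurableSpace Ω} {f : Ω → ℝ} (hf : Measurable f)
    (c : ℝ) :
    Measurable fun ω => (⌊c * f ω⌋ : ℤ) := (hf.const_mul c).floor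

variable {Ω : Type*} {m : MeasurableSpace Ω}

/-- The kernel sampled at the corners of the grid, rounded to a multiple of `1 / N` so that it takes
finitely many values, and set to zero on the diagonal. -/
def gridCoef (N : ℕ) (G : Ω × ℝ × ℝ → ℝ) (i j : ℤ) (ω : Ω) : ℝ :=
  if i = j then 0 else (⌊(N : ℝ) * G (ω, i / N, j / N)⌋ : ℝ) / N

/-- The step kernel with the coefficients `gridCoef`. -/
def gridKernel (N : ℕ) (G : Ω × ℝ × ℝ → ℝ) (p : Ω × ℝ × ℝ) : ℝ :=
  gridCoef N G ⌊(N : ℝ) * p.2.1⌋ ⌊(N : ℝ) * p.2.2⌋ p.1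

/-- The double integral of the step kernel. -/
def gridIntegral (N R : ℕ) (G : Ω × ℝ × ℝ → ℝ) (W : FinSet → Ω → ℝ) (ω : Ω) : ℝ :=
  ∑ i ∈ gridRange N R, ∑ j ∈ gridRange N R,
    gridCoef N G i j ω * (W (gridCell N i) ω * W (gridCell N j) ω)

/-- A kernel with `m`-measurable `ω`-sections which is bounded by `R` and supported in
`[-R, R]²`. -/
structure IsBoundedKernel (m : MeasurableSpace Ω) (R : ℕ) (G : Ω × ℝ × ℝ → ℝ) : Prop where
  measurable_left : ∀ y z, Measurable[m] fun ω => G (ω, y, z)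
  bound : ∀ p, |G p| ≤ R
  support : ∀ p, G p ≠ 0 → |p.2.1| ≤ R ∧ |p.2.2| ≤ R

variable {N R : ℕ} {G : Ω × ℝ × ℝ → ℝ}

lemma mem_gridRange_of {N R : ℕ} (hN : 0 < N) {i : ℤ} (h : |(i : ℝ) / N| ≤ R) :
    i ∈ gridRange N R := by
  have : (0 : ℝ) < N := by exact_mod_cast hN
  rw [abs_div, abs_of_pos this, div_le_iff₀ this] at h
  rw [gridRange, Finset.mem_Icc, ← abs_le]
  have : ((|i| : ℤ) : ℝ) ≤ ((N * R : ℤ) : ℝ) := by push_cast; linarith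
  exact_mod_cast this

lemma IsBoundedKernel.mem_gridRange (hG : IsBoundedKernel m R G) (hN : 0 < N) {i j : ℤ} {ω : Ω}
    (h : gridCoef N G i j ω ≠ 0) : i ∈ gridRange N R ∧ j ∈ gridRange N R := by
  have h' : G (ω, i / N, j / N) ≠ 0 := by
    intro h0; apply h; simp [gridCoef, h0]
  exact ⟨mem_gridRange_of hN (hG.support _ h').1, mem_gridRange_of hN (hG.support _ h').2⟩

lemma IsBoundedKernel.measurable_gridCoef (hG : IsBoundedKernel m R G) (i j : ℤ) :
    Measurable[m] (gridCoef N G i j) := by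
  unfold gridCoef
  split_ifs
  · exact measurable_const
  · have h1 : Measurable[m] fun ω => (⌊(N : ℝ) * G (ω, i / N, j / N)⌋ : ℤ) :=
      measurable_floor_mul (hG.measurable_left _ _) _
    have h2 : Measurable fun k : ℤ => (k : ℝ) / N := measurable_of_countable _
    exact h2.comp h1

lemma IsBoundedKernel.abs_gridCoef_le (hG : IsBoundedKernel m R G) (hN : 0 < N) (i j : ℤ) (ω : Ω) :
    |gridCoef N G i j ω| ≤ R + 1 := by
  have hN' : (1 : ℝ) ≤ N := by exact_mod_cast hN
  unfold gridCoef
  split_ifs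
  · simp; positivity
  · rw [abs_div, abs_of_pos (by linarith : (0 : ℝ) < N), div_le_iff₀ (by linarith)]
    have h1 := Int.floor_le ((N : ℝ) * G (ω, i / N, j / N))
    have h2 := Int.lt_floor_add_one ((N : ℝ) * G (ω, i / N, j / N))
    have h3 := abs_le.1 (hG.bound (ω, i / N, j / N))
    rw [abs_le]
    constructor <;> nlinarith

lemma gridKernel_eq_sum (hG : IsBoundedKernel m R G) (hN : 0 < N) (p : Ω × ℝ × ℝ) :
    gridKernel N G p = ∑ i ∈ gridRange N R, ∑ j ∈ gridRange N R, gridCoef N G i j p.1 *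
      ((gridCell N i).1.indicator 1 p.2.1 * (gridCell N j).1.indicator 1 p.2.2) := by
  classical
  have e : ∀ (i : ℤ) (y : ℝ), (gridCell N i).1.indicator (1 : ℝ → ℝ) y =
      if i = ⌊(N : ℝ) * y⌋ then 1 else 0 := by
    intro i y
    rw [Set.indicator_apply]
    simp only [mem_gridCell hN, eq_comm, Pi.one_apply]
  simp only [e, mul_ite, mul_one, mul_zero, Finset.sum_ite_eq']
  rw [gridKernel]
  by_cases h : gridCoef N G ⌊(N : ℝ) * p.2.1⌋ ⌊(N : ℝ) * p.2.2⌋ p.1 = 0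
  · simp [h]
  · have := hG.mem_gridRange hN h
    simp [this.1, this.2]

lemma measurable_family {ι E : Type*} [MeasurableSpace E] {f : ι → Ω → E}
    (h : ∀ i, Measurable (f i)) : Measurable fun ω i => f i ω := measurable_pi_lambda _ h

/-- The quadratic polynomial with coefficients `a`, which need not be symmetric. -/
def quadPoly (s : Finset ℤ) (a : ℤ → ℤ → ℝ) (x : ℤ → ℝ) : ℝ :=
  ∑ i ∈ s, ∑ j ∈ s, a i j * (x i * x j)

/-- Passage to a symmetric form, indexed by the subtype of `s` in order to have independent
variables only. -/
lemma quadPoly_eq_quadForm (s : Finset ℤ) (a : ℤ → ℤ → ℝ) (ξ : ℤ → Ω → ℝ) (ω : Ω) :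
    quadPoly s a (fun i => ξ i ω) =
      1 / 2 * quadForm (fun i : s => ξ i) (fun i j : s => a i j + a j i) Finset.univ ω := by
  have h1 : ∑ i ∈ s, ∑ j ∈ s, a j i * (ξ i ω * ξ j ω) = quadPoly s a (fun i => ξ i ω) := by
    rw [Finset.sum_comm]
    exact Finset.sum_congr rfl fun i _ => Finset.sum_congr rfl fun j _ => by ring
  have h2 : quadForm (fun i : s => ξ i) (fun i j : s => a i j + a j i) Finset.univ ω =
      ∑ i ∈ s, ∑ j ∈ s, (a i j + a j i) * (ξ i ω * ξ j ω) := by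
    rw [quadForm]
    rw [← Finset.sum_coe_sort s]
    exact Finset.sum_congr rfl fun i _ => by rw [← Finset.sum_coe_sort s]
  rw [h2]
  simp only [add_mul, Finset.sum_add_distrib, h1]
  rw [show ∑ i ∈ s, ∑ j ∈ s, a i j * (ξ i ω * ξ j ω) = quadPoly s a (fun i => ξ i ω) from rfl]
  ring

/-- As the coefficients take finitely many values, the step kernel is a finite combination of
indicators of boxes. -/
lemma mem_elementaryGraph_grid (hG : IsBoundedKernel m R G) (hN : 0 < N) (W : FinSet → Ω → ℝ) :
    (gridKernel N G, gridIntegral N R G W) ∈ elementaryGraph m W := by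
  classical
  set T : Finset ℤ := Finset.Icc (-(N * R + 1 : ℤ)) (N * R + 1) with hT
  let F : ℤ → ℤ → ℤ → Set Ω := fun i j k => {ω | ⌊(N : ℝ) * G (ω, i / N, j / N)⌋ = k}
  have hF : ∀ i j k, MeasurableSet[m] (F i j k) := fun i j k => by
    have h1 : Measurable[m] fun ω => (⌊(N : ℝ) * G (ω, i / N, j / N)⌋ : ℤ) :=
      measurable_floor_mul (hG.measurable_left _ _) _
    exact h1 (measurableSet_singleton k)
  let c : ℤ → ℤ → ℤ → ℝ := fun i j k => if i = j then 0 else (k : ℝ) / N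
  have hmemT : ∀ (i j : ℤ) (ω : Ω), ⌊(N : ℝ) * G (ω, i / N, j / N)⌋ ∈ T := by
    intro i j ω
    have hN' : (1 : ℝ) ≤ N := by exact_mod_cast hN
    have h1 := Int.floor_le ((N : ℝ) * G (ω, i / N, j / N))
    have h2 := Int.lt_floor_add_one ((N : ℝ) * G (ω, i / N, j / N))
    have h3 := abs_le.1 (hG.bound (ω, i / N, j / N))
    rw [hT, Finset.mem_Icc]
    constructor
    · have : (-(N * R + 1 : ℤ) : ℝ) ≤ (⌊(N : ℝ) * G (ω, i / N, j / N)⌋ : ℝ) := by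
        push_cast; nlinarith
      exact_mod_cast this
    · have : (⌊(N : ℝ) * G (ω, i / N, j / N)⌋ : ℝ) ≤ ((N * R + 1 : ℤ) : ℝ) := by
        push_cast; nlinarith
      exact_mod_cast this
  have key : ∀ (i j : ℤ) (ω : Ω), ∑ k ∈ T, c i j k * (F i j k).indicator 1 ω =
      gridCoef N G i j ω := by
    intro i j ω
    rw [Finset.sum_eq_single ⌊(N : ℝ) * G (ω, i / N, j / N)⌋]
    · rw [Set.indicator_of_mem (by rfl)]
      simp [c, gridCoef]
    · intro k _ hk
      rw [Set.indicator_of_notMem (fun h => hk h.symm), mul_zero]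
    · intro h; exact absurd (hmemT i j ω) h
  have e : (gridKernel N G, gridIntegral N R G W) =
      ∑ i ∈ gridRange N R, ∑ j ∈ gridRange N R, ∑ k ∈ T, c i j k •
        (((F i j k ×ˢ (gridCell N i).1 ×ˢ (gridCell N j).1).indicator 1,
          (F i j k).indicator (fun ω => W (gridCell N i) ω * W (gridCell N j) ω)) :
          (Ω × ℝ × ℝ → ℝ) × (Ω → ℝ)) := by
    refine Prod.ext ?_ ?_
    · ext p
      simp only [Prod.fst_sum, Prod.smul_fst, Finset.sum_apply, Pi.smul_apply, smul_eq_mul]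
      rw [gridKernel_eq_sum hG hN]
      refine Finset.sum_congr rfl fun i _ => Finset.sum_congr rfl fun j _ => ?_
      rw [← key, Finset.sum_mul]
      refine Finset.sum_congr rfl fun k _ => ?_
      rw [mul_assoc]
      congr 1
      by_cases h1 : p.1 ∈ F i j k <;> by_cases h2 : p.2.1 ∈ (gridCell N i).1 <;>
        by_cases h3 : p.2.2 ∈ (gridCell N j).1 <;>
        simp [Set.indicator, Set.mem_prod, h1, h2, h3]
    · ext ω
      simp only [Prod.snd_sum, Prod.smul_snd, Finset.sum_apply, Pi.smul_apply, smul_eq_mul]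
      rw [gridIntegral]
      refine Finset.sum_congr rfl fun i _ => Finset.sum_congr rfl fun j _ => ?_
      rw [← key, Finset.sum_mul]
      refine Finset.sum_congr rfl fun k _ => ?_
      by_cases h1 : ω ∈ F i j k <;> simp [h1]
  rw [e]
  refine Submodule.sum_mem _ fun i _ => Submodule.sum_mem _ fun j _ =>
    Submodule.sum_mem _ fun k _ => ?_
  by_cases hij : i = j
  · simp [c, hij]
  · exact Submodule.smul_mem _ _ (Submodule.subset_span
      ⟨F i j k, gridCell N i, gridCell N j, hF i j k, disjoint_gridCell hN hij, rfl⟩)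

variable [mΩ : MeasurableSpace Ω] {P : Measure Ω}

lemma measurable_gridKernel (hm : m ≤ mΩ) (hG : IsBoundedKernel m R G) (hN : 0 < N) :
    Measurable (gridKernel N G) := by
  rw [funext (gridKernel_eq_sum hG hN)]
  refine Finset.measurable_fun_sum _ fun i _ => Finset.measurable_fun_sum _ fun j _ => ?_
  refine (((hG.measurable_gridCoef i j).mono hm le_rfl).comp measurable_fst).mul
    (Measurable.mul ?_ ?_)
  · exact (measurable_one.indicator (gridCell N i).2.1).comp (measurable_fst.comp measurable_snd)
  · exact (measurable_one.indicator (gridCell N j).2.1).comp (measurable_snd.comp measurable_snd)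

/-- Integration of a step function. -/
lemma integral_comp_floor (hN : 0 < N) (s : Finset ℤ) {Φ : ℤ → ℝ} (hΦ : ∀ i ∉ s, Φ i = 0) :
    ∫ y : ℝ, Φ ⌊(N : ℝ) * y⌋ = 1 / N * ∑ i ∈ s, Φ i := by
  classical
  have e : ∀ y : ℝ, Φ ⌊(N : ℝ) * y⌋ = ∑ i ∈ s, Φ i * (gridCell N i).1.indicator 1 y := by
    intro y
    have : ∀ i : ℤ, (gridCell N i).1.indicator (1 : ℝ → ℝ) y =
        if i = ⌊(N : ℝ) * y⌋ then 1 else 0 := by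
      intro i
      rw [Set.indicator_apply]
      simp only [mem_gridCell hN, eq_comm, Pi.one_apply]
    simp only [this, mul_ite, mul_one, mul_zero, Finset.sum_ite_eq']
    split_ifs with h
    · rfl
    · exact hΦ _ h
  simp only [e]
  rw [integral_finsetSum, Finset.mul_sum]
  · refine Finset.sum_congr rfl fun i _ => ?_
    rw [integral_const_mul, integral_indicator_one (gridCell N i).2.1, volume_gridCell, mul_comm]
  · intro i _
    refine Integrable.const_mul ?_ _
    exact (integrable_indicator_iff (gridCell N i).2.1).2
      (integrableOn_const (gridCell N i).2.2)

lemma indepGaussian_gridCell {W : FinSet → Ω → ℝ} (hW : IsWhiteNoise P W) (hN : 0 < N)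
    (s : Finset ℤ) :
    IndepGaussian (fun i : s => W (gridCell N i)) P where
  measurable i := hW.measurable _
  gaussian i := hW.gaussian.hasGaussianLaw_eval _
  centered i := hW.centered _
  indep := by
    have h := (hW.gaussian.comp_right (fun i : s => gridCell N i)).hasGaussianLaw Finset.univ
    have h' : HasGaussianLaw (fun ω (i : s) => W (gridCell N i) ω) P := by
      have := h.map_fun (ContinuousLinearMap.pi fun i : s =>
        ContinuousLinearMap.proj (R := ℝ) (φ := fun _ : (Finset.univ : Finset s) => ℝ)
          ⟨i, Finset.mem_univ i⟩)
      exact this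
    refine h'.iIndepFun_of_covariance_eq_zero fun i j hij => ?_
    rw [hW.covariance, (disjoint_gridCell hN (fun h => hij (Subtype.ext h))).inter_eq]
    simp

lemma variance_gridCell {W : FinSet → Ω → ℝ} (hW : IsWhiteNoise P W) (N : ℕ) (i : ℤ) :
    Var[W (gridCell N i); P] = 1 / N := by
  rw [← covariance_self (hW.measurable _).aemeasurable, hW.covariance, inter_self,
    volume_gridCell]

lemma integral_quadPoly_cube {W : FinSet → Ω → ℝ} (hW : IsWhiteNoise P W) (hN : 0 < N)
    (s : Finset ℤ) {a : ℤ → ℤ → ℝ} (ha : ∀ i, a i i = 0) :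
    ∫ ω, quadPoly s a (fun i => W (gridCell N i) ω) ^ 3 ∂P =
      1 / N * ∑ i ∈ s, (1 / N * ∑ j ∈ s, (1 / N * ∑ k ∈ s,
        (a i j + a j i) * (a j k + a k j) * (a k i + a i k))) := by
  simp only [quadPoly_eq_quadForm s a (fun i => W (gridCell N i)), mul_pow]
  rw [integral_const_mul, (indepGaussian_gridCell hW hN s).integral_quadForm_cube
    (fun i j => add_comm _ _) (fun i => by simp [ha])]
  simp only [variance_gridCell hW, ← Finset.sum_coe_sort s, Finset.mul_sum]
  refine Finset.sum_congr rfl fun i _ => Finset.sum_congr rfl fun j _ =>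
    Finset.sum_congr rfl fun k _ => ?_
  ring

lemma integral_quadPoly_fourth_le {W : FinSet → Ω → ℝ} (hW : IsWhiteNoise P W) (hN : 0 < N)
    (s : Finset ℤ) {a : ℤ → ℤ → ℝ} (ha : ∀ i, a i i = 0) :
    ∫ ω, quadPoly s a (fun i => W (gridCell N i) ω) ^ 4 ∂P ≤
      324 * (1 / N * ∑ i ∈ s, (1 / N * ∑ j ∈ s, a i j ^ 2)) ^ 2 := by
  simp only [quadPoly_eq_quadForm s a (fun i => W (gridCell N i)), mul_pow]
  rw [integral_const_mul]
  have h := (indepGaussian_gridCell hW hN s).integral_quadForm_fourth_le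
    (b := fun i j : s => a i j + a j i) (fun i j => add_comm _ _) (fun i => by simp [ha])
    Finset.univ
  set A := 1 / (N : ℝ) * ∑ i ∈ s, (1 / (N : ℝ) * ∑ j ∈ s, a i j ^ 2) with hA
  have hA' : A = ∑ i ∈ s, ∑ j ∈ s, a i j ^ 2 * (1 / N * (1 / N)) := by
    rw [hA, Finset.mul_sum]
    refine Finset.sum_congr rfl fun i _ => ?_
    rw [← mul_assoc, Finset.mul_sum]
    exact Finset.sum_congr rfl fun j _ => by ring
  have hA'' : A = ∑ i ∈ s, ∑ j ∈ s, a j i ^ 2 * (1 / N * (1 / N)) := by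
    rw [hA', Finset.sum_comm]
  have hle : ∑ i : s, ∑ j : s, (a i j + a j i) ^ 2 *
      (Var[W (gridCell N i); P] * Var[W (gridCell N j); P]) ≤ 4 * A := by
    calc _ = ∑ i ∈ s, ∑ j ∈ s, (a i j + a j i) ^ 2 * (1 / N * (1 / N)) := by
          simp only [variance_gridCell hW, ← Finset.sum_coe_sort s]
      _ ≤ ∑ i ∈ s, ∑ j ∈ s, (2 * (a i j ^ 2 * (1 / N * (1 / N))) +
            2 * (a j i ^ 2 * (1 / N * (1 / N)))) := by
          refine Finset.sum_le_sum fun i _ => Finset.sum_le_sum fun j _ => ?_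
          have : (0 : ℝ) ≤ 1 / N * (1 / N) := by positivity
          nlinarith [mul_nonneg this (sq_nonneg (a i j - a j i))]
      _ = 4 * A := by
          simp only [Finset.sum_add_distrib, ← Finset.mul_sum]
          rw [← hA', ← hA'']; ring
  have h0 : 0 ≤ ∑ i : s, ∑ j : s, (a i j + a j i) ^ 2 *
      (Var[W (gridCell N i); P] * Var[W (gridCell N j); P]) :=
    Finset.sum_nonneg fun i _ => Finset.sum_nonneg fun j _ =>
      mul_nonneg (sq_nonneg _) (mul_nonneg (variance_nonneg _ _) (variance_nonneg _ _))
  have h1 := pow_le_pow_left₀ h0 hle 2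
  nlinarith

/-- Freezing lemma: the expectation of a function of two independent variables is computed by
fixing the first one. -/
lemma integral_of_indepFun {E E' : Type*} [MeasurableSpace E] [MeasurableSpace E']
    [IsProbabilityMeasure P] {A : Ω → E} {X : Ω → E'} (hA : Measurable A) (hX : Measurable X)
    (h : IndepFun A X P) {Φ : E × E' → ℝ} (hΦ : Measurable Φ)
    (hi : Integrable (fun ω => Φ (A ω, X ω)) P) :
    ∫ ω, Φ (A ω, X ω) ∂P = ∫ ω, ∫ ω', Φ (A ω, X ω') ∂P ∂P ∧
      Integrable (fun ω => ∫ ω', Φ (A ω, X ω') ∂P) P := by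
  have hmap := (indepFun_iff_map_prod_eq_prod_map_map hA.aemeasurable hX.aemeasurable).1 h
  have hAX : Measurable fun ω => (A ω, X ω) := hA.prodMk hX
  have := Measure.isProbabilityMeasure_map (μ := P) hA.aemeasurable
  have := Measure.isProbabilityMeasure_map (μ := P) hX.aemeasurable
  have hi' : Integrable Φ ((P.map A).prod (P.map X)) := by
    rw [← hmap, integrable_map_measure hΦ.aestronglyMeasurable hAX.aemeasurable]; exact hi
  have e : ∀ a, ∫ x, Φ (a, x) ∂(P.map X) = ∫ ω', Φ (a, X ω') ∂P := fun a =>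
    integral_map hX.aemeasurable (hΦ.comp measurable_prodMk_left).aestronglyMeasurable
  constructor
  · calc ∫ ω, Φ (A ω, X ω) ∂P = ∫ p, Φ p ∂(P.map fun ω => (A ω, X ω)) :=
          (integral_map hAX.aemeasurable hΦ.aestronglyMeasurable).symm
      _ = ∫ a, ∫ x, Φ (a, x) ∂(P.map X) ∂(P.map A) := by rw [hmap, integral_prod _ hi']
      _ = ∫ ω, ∫ x, Φ (A ω, x) ∂(P.map X) ∂P :=
          integral_map hA.aemeasurable hi'.integral_prod_left.aestronglyMeasurable
      _ = _ := by simp only [e]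
  · have := (integrable_map_measure hi'.integral_prod_left.aestronglyMeasurable
      hA.aemeasurable).1 hi'.integral_prod_left
    simpa only [Function.comp_def, e] using this

lemma hasMoments_gridIntegral [IsProbabilityMeasure P] (hm : m ≤ mΩ)
    {W : FinSet → Ω → ℝ} (hW : IsWhiteNoise P W)
    (hG : IsBoundedKernel m R G) (hN : 0 < N) : HasMoments (gridIntegral N R G W) P := by
  refine HasMoments.sum _ fun i _ => HasMoments.sum _ fun j _ => HasMoments.mul ?_
    ((hW.hasMoments _).mul (hW.hasMoments _))
  intro p _
  exact MemLp.of_bound ((hG.measurable_gridCoef i j).mono hm le_rfl).aestronglyMeasurable (R + 1)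
    (Eventually.of_forall fun ω => hG.abs_gridCoef_le hN i j ω)

/-- Moments of the double integral of a step kernel, conditionally on the kernel. -/
lemma integral_pow_gridIntegral [IsProbabilityMeasure P] (hm : m ≤ mΩ)
    {W : FinSet → Ω → ℝ} (hW : IsWhiteNoise P W) (hind : Indep m (noiseSigma W) P)
    (hG : IsBoundedKernel m R G) (hN : 0 < N) (k : ℕ) :
    ∫ ω, gridIntegral N R G W ω ^ k ∂P = ∫ ω, ∫ ω', quadPoly (gridRange N R)
      (fun i j => gridCoef N G i j ω) (fun i => W (gridCell N i) ω') ^ k ∂P ∂P ∧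
    Integrable (fun ω => ∫ ω', quadPoly (gridRange N R)
      (fun i j => gridCoef N G i j ω) (fun i => W (gridCell N i) ω') ^ k ∂P) P := by
  have hA : Measurable[m] (fun ω (i j : ℤ) => gridCoef N G i j ω) :=
    measurable_family fun i => measurable_family fun j => hG.measurable_gridCoef i j
  have hX : Measurable[noiseSigma W] (fun ω (i : ℤ) => W (gridCell N i) ω) :=
    measurable_family fun i => measurable_noiseSigma W _
  have hX' : Measurable (fun ω (i : ℤ) => W (gridCell N i) ω) :=
    measurable_pi_lambda _ fun i => hW.measurable _
  have hi : IndepFun (fun ω (i j : ℤ) => gridCoef N G i j ω)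
      (fun ω (i : ℤ) => W (gridCell N i) ω) P :=
    (IndepFun_iff_Indep _ _ _).2 (indep_of_indep_of_le_left
      (indep_of_indep_of_le_right hind hX.comap_le) hA.comap_le)
  refine integral_of_indepFun (Φ := fun q => quadPoly (gridRange N R) q.1 q.2 ^ k)
    (hA.mono hm le_rfl) hX' hi ?_ ((hasMoments_gridIntegral hm hW hG hN).pow k).integrable
  unfold quadPoly
  fun_prop

end Grid

/-! ### Bounded kernels -/

section Bounded

/-- The cyclic permutation of three variables. -/
def cyc (p : ℝ × ℝ × ℝ) : ℝ × ℝ × ℝ := (p.2.1, p.2.2, p.1)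

lemma measurePreserving_cyc : MeasurePreserving cyc := by
  have h1 : MeasurePreserving (Prod.swap : ℝ × ℝ × ℝ → (ℝ × ℝ) × ℝ) :=
    Measure.measurePreserving_swap
  have h2 := measurePreserving_prodAssoc (volume : Measure ℝ) (volume : Measure ℝ)
    (volume : Measure ℝ)
  exact h2.comp h1

/-- A property of almost all pairs holds for the six ordered pairs from almost every triple. -/
lemma ae_pairs {p : ℝ × ℝ → Prop} (h : ∀ᵐ q : ℝ × ℝ, p q) :
    ∀ᵐ t : ℝ × ℝ × ℝ, (p (t.1, t.2.1) ∧ p (t.2.1, t.1)) ∧ (p (t.2.1, t.2.2) ∧ p (t.2.2, t.2.1)) ∧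
      (p (t.2.2, t.1) ∧ p (t.1, t.2.2)) := by
  have hs : ∀ᵐ q : ℝ × ℝ, p (q.1, q.2) ∧ p (q.2, q.1) :=
    h.and ((Measure.measurePreserving_swap (μ := (volume : Measure ℝ))
      (ν := (volume : Measure ℝ))).quasiMeasurePreserving.ae h)
  have h1 : ∀ᵐ t : ℝ × ℝ × ℝ, p (t.2.1, t.2.2) ∧ p (t.2.2, t.2.1) :=
    (Measure.quasiMeasurePreserving_snd (μ := (volume : Measure ℝ))
      (ν := (volume : Measure (ℝ × ℝ)))).ae hs
  have h2 := measurePreserving_cyc.quasiMeasurePreserving.ae h1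
  have h3 := measurePreserving_cyc.quasiMeasurePreserving.ae h2
  filter_upwards [h1, h2, h3] with t a b c
  exact ⟨c, a, b⟩

variable {Ω : Type*}

/-- The sum of a random kernel and its transpose, which is twice its symmetrisation. -/
def kerSym (G : Ω × ℝ × ℝ → ℝ) (ω : Ω) (y z : ℝ) : ℝ := G (ω, y, z) + G (ω, z, y)

lemma kerSym_tendsto {ι : Type*} {l : Filter ι} {G : Ω × ℝ × ℝ → ℝ}
    {g : ι → Ω × ℝ × ℝ → ℝ} {ω : Ω} {y z : ℝ}
    (h1 : Tendsto (fun n => g n (ω, y, z)) l (𝓝 (G (ω, y, z))))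
    (h2 : Tendsto (fun n => g n (ω, z, y)) l (𝓝 (G (ω, z, y)))) :
    Tendsto (fun n => kerSym (g n) ω y z) l (𝓝 (kerSym G ω y z)) := h1.add h2

/-- The integrand of the trace of the third power of the kernel `kerSym G`. -/
def triForm (G : Ω × ℝ × ℝ → ℝ) (p : Ω × ℝ × ℝ × ℝ) : ℝ :=
  kerSym G p.1 p.2.1 p.2.2.1 * kerSym G p.1 p.2.2.1 p.2.2.2 * kerSym G p.1 p.2.2.2 p.2.1

/-- The squared Hilbert-Schmidt norm of a random kernel. -/
def sqNorm (G : Ω × ℝ × ℝ → ℝ) (ω : Ω) : ℝ := ∫ q : ℝ × ℝ, G (ω, q) ^ 2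

/-- The indicator of the interval `[-(R + 1), R + 1]`. -/
def boxInd (R : ℕ) : ℝ → ℝ := (Icc (-((R : ℝ) + 1)) (R + 1)).indicator 1

lemma boxInd_nonneg (R : ℕ) (y : ℝ) : 0 ≤ boxInd R y :=
  Set.indicator_nonneg (fun _ _ => zero_le_one) y

lemma boxInd_eq_one {R : ℕ} {y : ℝ} (h : |y| ≤ R + 1) : boxInd R y = 1 := by
  rw [boxInd, Set.indicator_of_mem]; · rfl
  exact abs_le.1 h

lemma boxInd_sq (R : ℕ) (y : ℝ) : boxInd R y * boxInd R y = boxInd R y := by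
  unfold boxInd Set.indicator; split_ifs <;> simp

lemma integrable_boxInd (R : ℕ) : Integrable (boxInd R) :=
  (integrable_indicator_iff measurableSet_Icc).2 (integrableOn_const (by simp))

/-- `|G|` is bounded by `(R + 1) 1_{[-(R+1), R+1]²}`. The additional `1` leaves room for the
rounding in `gridKernel`, so that this bound holds for a bounded kernel and all its
discretisations. -/
def IsBoxBounded (R : ℕ) (G : Ω × ℝ × ℝ → ℝ) : Prop :=
  ∀ ω y z, |G (ω, y, z)| ≤ (R + 1) * (boxInd R y * boxInd R z)

variable {m : MeasurableSpace Ω} {N R : ℕ} {G : Ω × ℝ × ℝ → ℝ}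

lemma IsBoundedKernel.isBoxBounded (hG : IsBoundedKernel m R G) : IsBoxBounded R G := by
  intro ω y z
  by_cases h : G (ω, y, z) = 0
  · rw [h, abs_zero]
    exact mul_nonneg (by positivity) (mul_nonneg (boxInd_nonneg _ _) (boxInd_nonneg _ _))
  · have hs := hG.support _ h
    rw [boxInd_eq_one (hs.1.trans (by linarith)), boxInd_eq_one (hs.2.trans (by linarith))]
    linarith [hG.bound (ω, y, z)]

lemma abs_floor_div_sub_le (hN : 0 < N) (y : ℝ) : |(⌊(N : ℝ) * y⌋ : ℝ) / N - y| ≤ 1 / N := by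
  have : (0 : ℝ) < N := by exact_mod_cast hN
  have h1 := Int.floor_le ((N : ℝ) * y)
  have h2 := Int.lt_floor_add_one ((N : ℝ) * y)
  have e : (⌊(N : ℝ) * y⌋ : ℝ) / N - y = (⌊(N : ℝ) * y⌋ - N * y) / N := by field_simp
  rw [e, abs_div, abs_of_pos this]
  gcongr
  rw [abs_le]; constructor <;> linarith

lemma IsBoundedKernel.isBoxBounded_gridKernel (hG : IsBoundedKernel m R G) (hN : 0 < N) :
    IsBoxBounded R (gridKernel N G) := by
  intro ω y z
  by_cases h : gridKernel N G (ω, y, z) = 0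
  · rw [h, abs_zero]
    exact mul_nonneg (by positivity) (mul_nonneg (boxInd_nonneg _ _) (boxInd_nonneg _ _))
  · have hs : G (ω, (⌊(N : ℝ) * y⌋ : ℝ) / N, (⌊(N : ℝ) * z⌋ : ℝ) / N) ≠ 0 := by
      intro h0; apply h; simp [gridKernel, gridCoef, h0]
    have hs := hG.support _ hs
    have hN' : 1 / (N : ℝ) ≤ 1 := by
      rw [div_le_one (by exact_mod_cast hN)]; exact_mod_cast hN
    have key : ∀ y : ℝ, |(⌊(N : ℝ) * y⌋ : ℝ) / N| ≤ R → |y| ≤ R + 1 := by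
      intro y hy
      have h1 := abs_floor_div_sub_le hN y
      have h2 := abs_sub_abs_le_abs_sub y ((⌊(N : ℝ) * y⌋ : ℝ) / N)
      rw [abs_sub_comm] at h2
      linarith
    rw [boxInd_eq_one (key y hs.1), boxInd_eq_one (key z hs.2)]
    rw [mul_one, mul_one]
    exact hG.abs_gridCoef_le hN _ _ ω

lemma IsBoxBounded.abs_kerSym_le (hG : IsBoxBounded R G) (ω : Ω) (y z : ℝ) :
    |kerSym G ω y z| ≤ 2 * (R + 1) * (boxInd R y * boxInd R z) := by
  have h1 := hG ω y z
  have h2 := hG ω z y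
  have := abs_add_le (G (ω, y, z)) (G (ω, z, y))
  rw [kerSym]; linarith

lemma IsBoxBounded.abs_triForm_le (hG : IsBoxBounded R G) (p : Ω × ℝ × ℝ × ℝ) :
    |triForm G p| ≤ 8 * (R + 1) ^ 3 * (boxInd R p.2.1 * (boxInd R p.2.2.1 * boxInd R p.2.2.2)) := by
  obtain ⟨ω, y, z, w⟩ := p
  have h := mul_le_mul (mul_le_mul (hG.abs_kerSym_le ω y z) (hG.abs_kerSym_le ω z w)
    (abs_nonneg _) (mul_nonneg (by positivity) (mul_nonneg (boxInd_nonneg _ _)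
      (boxInd_nonneg _ _)))) (hG.abs_kerSym_le ω w y)
    (abs_nonneg _) (mul_nonneg (mul_nonneg (by positivity) (mul_nonneg (boxInd_nonneg _ _)
      (boxInd_nonneg _ _))) (mul_nonneg (by positivity) (mul_nonneg (boxInd_nonneg _ _)
      (boxInd_nonneg _ _))))
  rw [← abs_mul, ← abs_mul] at h
  refine h.trans (le_of_eq ?_)
  have e := boxInd_sq R
  calc _ = 8 * (R + 1 : ℝ) ^ 3 * ((boxInd R y * boxInd R y) * ((boxInd R z * boxInd R z) *
        (boxInd R w * boxInd R w))) := by ring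
    _ = _ := by rw [e, e, e]

lemma tendsto_gridKernel {ω : Ω} {q : ℝ × ℝ} (hq : q.1 ≠ q.2)
    (hc : ContinuousAt (fun q => G (ω, q)) q) :
    Tendsto (fun n : ℕ => gridKernel (n + 1) G (ω, q)) atTop (𝓝 (G (ω, q))) := by
  have hN0 : Tendsto (fun n : ℕ => (1 : ℝ) / ((n + 1 : ℕ) : ℝ)) atTop (𝓝 0) := by
    simpa using tendsto_one_div_add_atTop_nhds_zero_nat (𝕜 := ℝ)
  have hfl : ∀ y : ℝ, Tendsto (fun n : ℕ => (⌊((n + 1 : ℕ) : ℝ) * y⌋ : ℝ) / ((n + 1 : ℕ) : ℝ)) atTop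
      (𝓝 y) := by
    intro y
    rw [tendsto_iff_norm_sub_tendsto_zero]
    exact squeeze_zero (fun _ => norm_nonneg _)
      (fun n => abs_floor_div_sub_le (Nat.succ_pos n) y) hN0
  have h1 : Tendsto (fun n : ℕ => G (ω, (⌊((n + 1 : ℕ) : ℝ) * q.1⌋ : ℝ) / ((n + 1 : ℕ) : ℝ),
      (⌊((n + 1 : ℕ) : ℝ) * q.2⌋ : ℝ) / ((n + 1 : ℕ) : ℝ))) atTop (𝓝 (G (ω, q))) :=
    hc.tendsto.comp ((hfl q.1).prodMk_nhds (hfl q.2))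
  have hne : ∀ᶠ n : ℕ in atTop, ⌊((n + 1 : ℕ) : ℝ) * q.1⌋ ≠ ⌊((n + 1 : ℕ) : ℝ) * q.2⌋ := by
    filter_upwards [((hfl q.1).sub (hfl q.2)).eventually_ne (sub_ne_zero.2 hq)] with n hn h
    apply hn; rw [h, sub_self]
  have h2 : Tendsto (fun n : ℕ => gridKernel (n + 1) G (ω, q) -
      G (ω, (⌊((n + 1 : ℕ) : ℝ) * q.1⌋ : ℝ) / ((n + 1 : ℕ) : ℝ),
      (⌊((n + 1 : ℕ) : ℝ) * q.2⌋ : ℝ) / ((n + 1 : ℕ) : ℝ))) atTop (𝓝 0) := by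
    rw [tendsto_zero_iff_norm_tendsto_zero]
    refine squeeze_zero' (Eventually.of_forall fun _ => norm_nonneg _) ?_ hN0
    filter_upwards [hne] with n hn
    rw [gridKernel, gridCoef, if_neg hn]
    exact abs_floor_div_sub_le (Nat.succ_pos n) _
  simpa using h2.add h1

lemma IsBoxBounded.sq_le (hG : IsBoxBounded R G) (ω : Ω) (q : ℝ × ℝ) :
    G (ω, q) ^ 2 ≤ ((R : ℝ) + 1) ^ 2 * (boxInd R q.1 * boxInd R q.2) := by
  have h := hG ω q.1 q.2
  rw [← sq_abs]
  calc |G (ω, q)| ^ 2 ≤ ((R + 1) * (boxInd R q.1 * boxInd R q.2)) ^ 2 := by gcongr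
    _ = (R + 1) ^ 2 * ((boxInd R q.1 * boxInd R q.1) * (boxInd R q.2 * boxInd R q.2)) := by ring
    _ = _ := by rw [boxInd_sq, boxInd_sq]

variable [mΩ : MeasurableSpace Ω] {P : Measure Ω}

/-- The measure against which `triForm` is integrated. -/
abbrev triMeasure (P : Measure Ω) : Measure (Ω × ℝ × ℝ × ℝ) :=
  P.prod (volume.prod (volume.prod volume))

lemma measurable_triForm (hG : Measurable G) : Measurable (triForm G) := by
  unfold triForm kerSym; fun_prop

lemma integrable_box_pair (R : ℕ) (c : ℝ) :
    Integrable fun q : ℝ × ℝ => c * (boxInd R q.1 * boxInd R q.2) :=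
  ((integrable_boxInd R).mul_prod (integrable_boxInd R)).const_mul c

lemma integrable_box_ker [IsFiniteMeasure P] (R : ℕ) (c : ℝ) :
    Integrable (fun p : Ω × ℝ × ℝ => c * (boxInd R p.2.1 * boxInd R p.2.2)) (kerMeasure P) :=
  (integrable_box_pair R c).comp_snd P

lemma integrable_box_tri [IsFiniteMeasure P] (R : ℕ) (c : ℝ) :
    Integrable (fun p : Ω × ℝ × ℝ × ℝ => c * (boxInd R p.2.1 * (boxInd R p.2.2.1 *
      boxInd R p.2.2.2))) (triMeasure P) :=
  Integrable.comp_snd (((integrable_boxInd R).mul_prod ((integrable_boxInd R).mul_prod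
    (integrable_boxInd R))).const_mul c) P

lemma IsBoxBounded.integrable_sq (hG : IsBoxBounded R G) (hGm : Measurable G) (ω : Ω) :
    Integrable fun q : ℝ × ℝ => G (ω, q) ^ 2 := by
  refine (integrable_box_pair R (((R : ℝ) + 1) ^ 2)).mono'
    ((hGm.comp measurable_prodMk_left).pow_const 2).aestronglyMeasurable
    (Eventually.of_forall fun q => ?_)
  rw [Real.norm_of_nonneg (sq_nonneg _)]
  exact hG.sq_le ω q

lemma IsBoxBounded.sqNorm_le (hG : IsBoxBounded R G) (hGm : Measurable G) (ω : Ω) :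
    0 ≤ sqNorm G ω ∧
      sqNorm G ω ≤ ∫ q : ℝ × ℝ, ((R : ℝ) + 1) ^ 2 * (boxInd R q.1 * boxInd R q.2) :=
  ⟨integral_nonneg fun _ => sq_nonneg _, integral_mono (hG.integrable_sq hGm ω)
    (integrable_box_pair R _) fun q => hG.sq_le ω q⟩

lemma measurable_sqNorm (hGm : Measurable G) : Measurable (sqNorm G) :=
  (hGm.pow_const 2).stronglyMeasurable.integral_prod_right.measurable

lemma IsBoxBounded.integrable_triForm [IsFiniteMeasure P] (hG : IsBoxBounded R G)
    (hGm : Measurable G) : Integrable (triForm G) (triMeasure P) :=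
  (integrable_box_tri R (8 * ((R : ℝ) + 1) ^ 3)).mono' (measurable_triForm hGm).aestronglyMeasurable
    (Eventually.of_forall fun p => hG.abs_triForm_le p)

lemma integral_triForm_grid [IsProbabilityMeasure P] (hm : m ≤ mΩ) (hG : IsBoundedKernel m R G)
    (hN : 0 < N) :
    ∫ p, triForm (gridKernel N G) p ∂(triMeasure P) = ∫ ω, 1 / N * ∑ i ∈ gridRange N R,
      (1 / N * ∑ j ∈ gridRange N R, (1 / N * ∑ k ∈ gridRange N R,
        (gridCoef N G i j ω + gridCoef N G j i ω) * (gridCoef N G j k ω + gridCoef N G k j ω) *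
        (gridCoef N G k i ω + gridCoef N G i k ω))) ∂P := by
  have hb := hG.isBoxBounded_gridKernel hN
  have hmeas := measurable_gridKernel hm hG hN
  rw [integral_prod _ (hb.integrable_triForm hmeas)]
  refine integral_congr_ae (Eventually.of_forall fun ω => ?_)
  have hmt := measurable_triForm hmeas
  have z1 : ∀ {i : ℤ}, i ∉ gridRange N R → ∀ j, gridCoef N G i j ω + gridCoef N G j i ω = 0 := by
    intro i hi j
    have h1 : gridCoef N G i j ω = 0 := by
      by_contra h; exact hi (hG.mem_gridRange hN h).1
    have h2 : gridCoef N G j i ω = 0 := by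
      by_contra h; exact hi (hG.mem_gridRange hN h).2
    rw [h1, h2, add_zero]
  have i3 : Integrable (fun t : ℝ × ℝ × ℝ => triForm (gridKernel N G) (ω, t))
      (volume.prod (volume.prod volume)) := by
    refine Integrable.mono' (((integrable_boxInd R).mul_prod ((integrable_boxInd R).mul_prod
      (integrable_boxInd R))).const_mul (8 * ((R : ℝ) + 1) ^ 3))
      (hmt.comp measurable_prodMk_left).aestronglyMeasurable
      (Eventually.of_forall fun t => hb.abs_triForm_le (ω, t))
  have i2 : ∀ y : ℝ, Integrable (fun t : ℝ × ℝ => triForm (gridKernel N G) (ω, y, t))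
      (volume.prod volume) := by
    intro y
    refine Integrable.mono' (((((integrable_boxInd R).mul_prod
      (integrable_boxInd R))).const_mul (boxInd R y)).const_mul (8 * ((R : ℝ) + 1) ^ 3))
      (hmt.comp (measurable_prodMk_left.comp measurable_prodMk_left)).aestronglyMeasurable
      (Eventually.of_forall fun t => hb.abs_triForm_le (ω, y, t))
  have e1 : ∀ y z : ℝ, ∫ w, triForm (gridKernel N G) (ω, y, z, w) =
      1 / N * ∑ k ∈ gridRange N R, (gridCoef N G ⌊(N : ℝ) * y⌋ ⌊(N : ℝ) * z⌋ ω +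
        gridCoef N G ⌊(N : ℝ) * z⌋ ⌊(N : ℝ) * y⌋ ω) * (gridCoef N G ⌊(N : ℝ) * z⌋ k ω +
        gridCoef N G k ⌊(N : ℝ) * z⌋ ω) * (gridCoef N G k ⌊(N : ℝ) * y⌋ ω +
        gridCoef N G ⌊(N : ℝ) * y⌋ k ω) := fun y z =>
    integral_comp_floor hN (gridRange N R) (Φ := fun k => (gridCoef N G ⌊(N : ℝ) * y⌋
      ⌊(N : ℝ) * z⌋ ω + gridCoef N G ⌊(N : ℝ) * z⌋ ⌊(N : ℝ) * y⌋ ω) *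
      (gridCoef N G ⌊(N : ℝ) * z⌋ k ω + gridCoef N G k ⌊(N : ℝ) * z⌋ ω) *
      (gridCoef N G k ⌊(N : ℝ) * y⌋ ω + gridCoef N G ⌊(N : ℝ) * y⌋ k ω))
      fun k hk => by rw [z1 hk, mul_zero]
  have e2 : ∀ y : ℝ, ∫ z, ∫ w, triForm (gridKernel N G) (ω, y, z, w) =
      1 / N * ∑ j ∈ gridRange N R, (1 / N * ∑ k ∈ gridRange N R,
      (gridCoef N G ⌊(N : ℝ) * y⌋ j ω + gridCoef N G j ⌊(N : ℝ) * y⌋ ω) * (gridCoef N G j k ω +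
        gridCoef N G k j ω) * (gridCoef N G k ⌊(N : ℝ) * y⌋ ω +
        gridCoef N G ⌊(N : ℝ) * y⌋ k ω)) := fun y => by
    simp only [e1]
    exact integral_comp_floor hN (gridRange N R) (Φ := fun j => 1 / N * ∑ k ∈ gridRange N R,
      (gridCoef N G ⌊(N : ℝ) * y⌋ j ω + gridCoef N G j ⌊(N : ℝ) * y⌋ ω) * (gridCoef N G j k ω +
        gridCoef N G k j ω) * (gridCoef N G k ⌊(N : ℝ) * y⌋ ω +
        gridCoef N G ⌊(N : ℝ) * y⌋ k ω)) fun j hj => by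
      refine mul_eq_zero_of_right _ (Finset.sum_eq_zero fun k _ => ?_)
      rw [z1 hj]; ring
  calc ∫ t, triForm (gridKernel N G) (ω, t) ∂(volume.prod (volume.prod volume))
      = ∫ y, ∫ z, ∫ w, triForm (gridKernel N G) (ω, y, z, w) := by
        rw [integral_prod _ i3]
        refine integral_congr_ae (Eventually.of_forall fun y => ?_)
        exact integral_prod _ (i2 y)
    _ = _ := by
        simp only [e2]
        exact integral_comp_floor hN (gridRange N R) (Φ := fun i => 1 / N * ∑ j ∈ gridRange N R,
          (1 / N * ∑ k ∈ gridRange N R,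
          (gridCoef N G i j ω + gridCoef N G j i ω) * (gridCoef N G j k ω +
            gridCoef N G k j ω) * (gridCoef N G k i ω + gridCoef N G i k ω))) fun i hi => by
          refine mul_eq_zero_of_right _ (Finset.sum_eq_zero fun j _ => ?_)
          refine mul_eq_zero_of_right _ (Finset.sum_eq_zero fun k _ => ?_)
          rw [z1 hi]; ring

lemma sqNorm_grid (hm : m ≤ mΩ) (hG : IsBoundedKernel m R G) (hN : 0 < N) (ω : Ω) :
    sqNorm (gridKernel N G) ω = 1 / N * ∑ i ∈ gridRange N R,
      (1 / N * ∑ j ∈ gridRange N R, gridCoef N G i j ω ^ 2) := by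
  have hb := hG.isBoxBounded_gridKernel hN
  have hmeas := measurable_gridKernel hm hG hN
  have z : ∀ {i j : ℤ}, ¬ (i ∈ gridRange N R ∧ j ∈ gridRange N R) → gridCoef N G i j ω ^ 2 = 0 := by
    intro i j h
    have : gridCoef N G i j ω = 0 := by
      by_contra h'; exact h (hG.mem_gridRange hN h')
    rw [this]; ring
  rw [sqNorm, Measure.volume_eq_prod, integral_prod _ (hb.integrable_sq hmeas ω)]
  have e1 : ∀ y : ℝ, ∫ z, gridKernel N G (ω, y, z) ^ 2 =
      1 / N * ∑ j ∈ gridRange N R, gridCoef N G ⌊(N : ℝ) * y⌋ j ω ^ 2 := fun y =>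
    integral_comp_floor hN (gridRange N R) (Φ := fun j => gridCoef N G ⌊(N : ℝ) * y⌋ j ω ^ 2)
      fun j hj => z fun h => hj h.2
  simp only [e1]
  exact integral_comp_floor hN (gridRange N R)
    (Φ := fun i => 1 / N * ∑ j ∈ gridRange N R, gridCoef N G i j ω ^ 2) fun i hi =>
      mul_eq_zero_of_right _ (Finset.sum_eq_zero fun j _ => z fun h => hi h.1)

lemma integral_gridIntegral_cube [IsProbabilityMeasure P] (hm : m ≤ mΩ)
    {W : FinSet → Ω → ℝ} (hW : IsWhiteNoise P W) (hind : Indep m (noiseSigma W) P)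
    (hG : IsBoundedKernel m R G) (hN : 0 < N) :
    ∫ ω, gridIntegral N R G W ω ^ 3 ∂P = ∫ p, triForm (gridKernel N G) p ∂(triMeasure P) := by
  rw [(integral_pow_gridIntegral hm hW hind hG hN 3).1, integral_triForm_grid hm hG hN]
  refine integral_congr_ae (Eventually.of_forall fun ω => ?_)
  exact integral_quadPoly_cube hW hN _ fun i => by simp [gridCoef]

lemma integral_gridIntegral_fourth_le [IsProbabilityMeasure P] (hm : m ≤ mΩ)
    {W : FinSet → Ω → ℝ} (hW : IsWhiteNoise P W) (hind : Indep m (noiseSigma W) P)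
    (hG : IsBoundedKernel m R G) (hN : 0 < N) :
    ∫ ω, gridIntegral N R G W ω ^ 4 ∂P ≤ 324 * ∫ ω, sqNorm (gridKernel N G) ω ^ 2 ∂P := by
  have hb := hG.isBoxBounded_gridKernel hN
  have hmeas := measurable_gridKernel hm hG hN
  obtain ⟨h1, h2⟩ := integral_pow_gridIntegral hm hW hind hG hN 4
  rw [h1, ← integral_const_mul]
  refine integral_mono h2 (Integrable.const_mul ?_ _) fun ω => ?_
  · refine Integrable.of_bound ((measurable_sqNorm hmeas).pow_const 2).aestronglyMeasurable
      ((∫ q : ℝ × ℝ, ((R : ℝ) + 1) ^ 2 * (boxInd R q.1 * boxInd R q.2)) ^ 2)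
      (Eventually.of_forall fun ω => ?_)
    rw [Real.norm_of_nonneg (sq_nonneg _)]
    exact pow_le_pow_left₀ (hb.sqNorm_le hmeas ω).1 (hb.sqNorm_le hmeas ω).2 2
  · rw [sqNorm_grid hm hG hN]
    exact integral_quadPoly_fourth_le hW hN _ fun i => by simp [gridCoef]

end Bounded

/-! ### The third moment of a double integral -/

section ThirdMoment

section Truncation

variable {Ω : Type*} {m : MeasurableSpace Ω} {G : Ω × ℝ × ℝ → ℝ}

/-- Truncation of a kernel in space and in size. -/
def truncKernel (R : ℕ) (G : Ω × ℝ × ℝ → ℝ) (p : Ω × ℝ × ℝ) : ℝ :=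
  if |p.2.1| ≤ R ∧ |p.2.2| ≤ R then max (-(R : ℝ)) (min R (G p)) else 0

lemma abs_truncKernel_le (R : ℕ) (G : Ω × ℝ × ℝ → ℝ) (p : Ω × ℝ × ℝ) :
    |truncKernel R G p| ≤ |G p| := by
  have hR : (0 : ℝ) ≤ R := by positivity
  unfold truncKernel
  split_ifs
  · rcases le_total (G p) 0 with h | h
    · rw [min_eq_right (h.trans hR), abs_of_nonpos h,
        abs_of_nonpos (max_le (by linarith) h)]
      linarith [le_max_right (-(R : ℝ)) (G p)]
    · rw [max_eq_right ((neg_nonpos.2 hR).trans (le_min hR h)), abs_of_nonneg h,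
        abs_of_nonneg (le_min hR h)]
      exact min_le_right _ _
  · simp

lemma truncKernel_eq {R : ℕ} {p : Ω × ℝ × ℝ} (h1 : |p.2.1| ≤ R) (h2 : |p.2.2| ≤ R)
    (h3 : |G p| ≤ R) : truncKernel R G p = G p := by
  rw [truncKernel, if_pos ⟨h1, h2⟩, min_eq_right (abs_le.1 h3).2, max_eq_right (abs_le.1 h3).1]

lemma tendsto_truncKernel (G : Ω × ℝ × ℝ → ℝ) (p : Ω × ℝ × ℝ) :
    Tendsto (fun R : ℕ => truncKernel R G p) atTop (𝓝 (G p)) := by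
  refine tendsto_const_nhds.congr' ?_
  filter_upwards [eventually_ge_atTop ⌈|p.2.1|⌉₊, eventually_ge_atTop ⌈|p.2.2|⌉₊,
    eventually_ge_atTop ⌈|G p|⌉₊] with R h1 h2 h3
  exact (truncKernel_eq (Nat.ceil_le.1 h1) (Nat.ceil_le.1 h2) (Nat.ceil_le.1 h3)).symm

lemma measurable_truncKernel (R : ℕ) (hG : Measurable G) : Measurable (truncKernel R G) := by
  unfold truncKernel
  have h1 : Measurable fun p : Ω × ℝ × ℝ => |p.2.1| := by fun_prop
  have h2 : Measurable fun p : Ω × ℝ × ℝ => |p.2.2| := by fun_prop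
  exact Measurable.ite ((measurableSet_le h1 measurable_const).inter
    (measurableSet_le h2 measurable_const)) (by fun_prop) measurable_const

lemma isBoundedKernel_truncKernel (R : ℕ) (hG : ∀ y z, Measurable[m] fun ω => G (ω, y, z)) :
    IsBoundedKernel m R (truncKernel R G) where
  measurable_left y z := by
    unfold truncKernel
    dsimp only
    split_ifs
    · exact measurable_const.max (measurable_const.min (hG y z))
    · exact measurable_const
  bound p := by
    have hR : (0 : ℝ) ≤ R := by positivity
    unfold truncKernel
    split_ifs
    · rw [abs_le]
      exact ⟨le_max_left _ _, max_le (by linarith) (min_le_left _ _)⟩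
    · simp
  support p h := by
    by_contra h'
    exact h (by rw [truncKernel, if_neg h'])

lemma continuousAt_truncKernel {R : ℕ} {ω : Ω} {q : ℝ × ℝ}
    (hc : ContinuousAt (fun q => G (ω, q)) q) (h1 : |q.1| ≠ R) (h2 : |q.2| ≠ R) :
    ContinuousAt (fun q => truncKernel R G (ω, q)) q := by
  have c1 : ContinuousAt (fun q : ℝ × ℝ => |q.1|) q := by fun_prop
  have c2 : ContinuousAt (fun q : ℝ × ℝ => |q.2|) q := by fun_prop
  by_cases h : |q.1| < R ∧ |q.2| < R
  · have hc' : ContinuousAt (fun q => max (-(R : ℝ)) (min R (G (ω, q)))) q :=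
      continuousAt_const.max (continuousAt_const.min hc)
    refine hc'.congr ?_
    filter_upwards [c1.eventually_lt continuousAt_const h.1,
      c2.eventually_lt continuousAt_const h.2] with p hp1 hp2
    rw [truncKernel, if_pos ⟨hp1.le, hp2.le⟩]
  · have hz : ContinuousAt (fun _ : ℝ × ℝ => (0 : ℝ)) q := continuousAt_const
    refine hz.congr ?_
    rw [not_and_or, not_lt, not_lt] at h
    rcases h with h | h
    · filter_upwards [continuousAt_const.eventually_lt c1 (lt_of_le_of_ne h h1.symm)] with p hp
      rw [truncKernel, if_neg fun h' => not_lt.2 h'.1 hp]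
    · filter_upwards [continuousAt_const.eventually_lt c2 (lt_of_le_of_ne h h2.symm)] with p hp
      rw [truncKernel, if_neg fun h' => not_lt.2 h'.2 hp]

end Truncation

variable {Ω : Type*} {m : MeasurableSpace Ω} [mΩ : MeasurableSpace Ω] {P : Measure Ω}

/-- Dominated convergence in `L²`. -/
lemma tendsto_eLpNorm_sub_of_dominated {α : Type*} [MeasurableSpace α] {μ : Measure α}
    {f : ℕ → α → ℝ} {g b : α → ℝ} (hf : ∀ n, AEStronglyMeasurable (f n) μ)
    (hg : AEStronglyMeasurable g μ) (hb : Integrable b μ) (h : ∀ n, ∀ᵐ x ∂μ, f n x ^ 2 ≤ b x)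
    (h' : ∀ᵐ x ∂μ, g x ^ 2 ≤ b x)
    (hlim : ∀ᵐ x ∂μ, Tendsto (fun n => f n x) atTop (𝓝 (g x))) :
    Tendsto (fun n => eLpNorm (g - f n) 2 μ) atTop (𝓝 0) := by
  have hbd : ∀ n, ∀ᵐ x ∂μ, (g x - f n x) ^ 2 ≤ 4 * b x := fun n => by
    filter_upwards [h n, h'] with x h1 h2
    nlinarith [sq_nonneg (g x + f n x)]
  have hi : ∀ n, Integrable (fun x => (g x - f n x) ^ 2) μ := fun n => by
    refine (hb.const_mul 4).mono' ((hg.sub (hf n)).pow 2) ?_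
    filter_upwards [hbd n] with x hx
    rwa [Real.norm_of_nonneg (sq_nonneg _)]
  have hm : ∀ n, MemLp (g - f n) 2 μ := fun n =>
    (memLp_two_iff_integrable_sq (hg.sub (hf n))).2 (hi n)
  have hI : Tendsto (fun n => ∫ x, (g x - f n x) ^ 2 ∂μ) atTop (𝓝 (∫ _, (0 : ℝ) ∂μ)) := by
    refine tendsto_integral_of_dominated_convergence (fun x => 4 * b x)
      (fun n => (hi n).aestronglyMeasurable) (hb.const_mul 4) (fun n => ?_) ?_
    · filter_upwards [hbd n] with x hx
      rwa [Real.norm_of_nonneg (sq_nonneg _)]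
    · filter_upwards [hlim] with x hx
      have := ((tendsto_const_nhds (x := g x)).sub hx).pow 2
      simpa using this
  simp only [fun n => eLpNorm_two_eq (hm n), Pi.sub_apply]
  rw [integral_zero] at hI
  have := (ENNReal.continuous_ofReal.comp Real.continuous_sqrt).tendsto 0 |>.comp hI
  simpa [Function.comp_def] using this

/-- If `U n → U` in `L²` with bounded fourth moments then the third moments converge. -/
lemma tendsto_integral_cube [IsProbabilityMeasure P] {U : Ω → ℝ} {V : ℕ → Ω → ℝ} {K : ℝ}
    (hU : MemLp U 2 P) (hV : ∀ n, MemLp (V n) 4 P) (hK : ∀ n, ∫ ω, V n ω ^ 4 ∂P ≤ K)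
    (hlim : Tendsto (fun n => eLpNorm (U - V n) 2 P) atTop (𝓝 0)) :
    Integrable (fun ω => U ω ^ 3) P ∧
      Tendsto (fun n => ∫ ω, V n ω ^ 3 ∂P) atTop (𝓝 (∫ ω, U ω ^ 3 ∂P)) := by
  have hV4 : ∀ n, Integrable (fun ω => V n ω ^ 4) P := fun n => by
    have := (hV n).integrable_norm_pow (p := 4) (by simp)
    simpa [Even.pow_abs (show Even 4 by decide)] using this
  have hV2 : ∀ n, MemLp (V n) 2 P := fun n => (hV n).mono_exponent (by norm_num)
  -- Fatou's lemma along an almost surely convergent subsequence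
  have hU4 : Integrable (fun ω => U ω ^ 4) P := by
    have hlim' : Tendsto (fun n => eLpNorm (V n - U) 2 P) atTop (𝓝 0) := by
      refine hlim.congr fun n => ?_
      rw [← eLpNorm_neg, neg_sub]
    obtain ⟨ns, hns, hae⟩ := (tendstoInMeasure_of_tendsto_eLpNorm (by simp)
      (fun n => (hV n).1) hU.1 hlim').exists_seq_tendsto_ae
    refine ⟨hU.1.pow 4, ?_⟩
    have h1 : ∫⁻ ω, ENNReal.ofReal (U ω ^ 4) ∂P ≤
        liminf (fun k => ∫⁻ ω, ENNReal.ofReal (V (ns k) ω ^ 4) ∂P) atTop := by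
      refine le_trans (le_of_eq ?_) (lintegral_liminf_le' fun k =>
        ((hV (ns k)).1.aemeasurable.pow_const 4).ennreal_ofReal)
      refine lintegral_congr_ae ?_
      filter_upwards [hae] with ω hω
      exact ((ENNReal.continuous_ofReal.tendsto _).comp (hω.pow 4)).liminf_eq.symm
    have h2 : ∀ k, ∫⁻ ω, ENNReal.ofReal (V (ns k) ω ^ 4) ∂P ≤ ENNReal.ofReal K := fun k => by
      rw [← ofReal_integral_eq_lintegral_ofReal (hV4 _)
        (Eventually.of_forall fun ω => by positivity)]
      exact ENNReal.ofReal_le_ofReal (hK _)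
    have h3 : ∫⁻ ω, ENNReal.ofReal (U ω ^ 4) ∂P ≤ ENNReal.ofReal K :=
      h1.trans (liminf_le_of_le (by isBoundedDefault) fun b hb => by
        obtain ⟨k, hk⟩ := hb.exists
        exact hk.trans (h2 k))
    rw [hasFiniteIntegral_iff_ofReal (Eventually.of_forall fun ω => by positivity)]
    exact h3.trans_lt (by simp)
  have hle : ∀ x : ℝ, |x ^ 3| ≤ 1 + x ^ 4 := fun x => by
    rw [abs_le]
    constructor <;> nlinarith [sq_nonneg (x ^ 2 - x), sq_nonneg (x ^ 2 + x),
        sq_nonneg (x ^ 2 - 1), sq_nonneg x, sq_nonneg (x - 1), sq_nonneg (x + 1)]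
  have hU3 : Integrable (fun ω => U ω ^ 3) P :=
    ((integrable_const 1).add hU4).mono' (hU.1.pow 3) (Eventually.of_forall fun ω => hle _)
  have hV3 : ∀ n, Integrable (fun ω => V n ω ^ 3) P := fun n =>
    ((integrable_const 1).add (hV4 n)).mono' ((hV n).1.pow 3)
      (Eventually.of_forall fun ω => hle _)
  refine ⟨hU3, ?_⟩
  set L := ∫ ω, U ω ^ 4 ∂P with hL
  have hLK : 0 ≤ L := integral_nonneg fun ω => by positivity
  have hsq : Tendsto (fun n => √(∫ ω, (U - V n) ω ^ 2 ∂P)) atTop (𝓝 0) := by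
    have h1 : ∀ n, eLpNorm (U - V n) 2 P = ENNReal.ofReal (√(∫ ω, (U - V n) ω ^ 2 ∂P)) :=
      fun n => eLpNorm_two_eq (hU.sub (hV2 n))
    simp only [h1] at hlim
    have := (ENNReal.tendsto_toReal (by simp)).comp hlim
    simpa [Function.comp_def, ENNReal.toReal_ofReal (Real.sqrt_nonneg _)] using this
  -- Young's inequality `|u³ - v³| ≤ t⁻¹ (u - v)² + 2 t (u⁴ + v⁴)`; then `n → ∞` and `t → 0`
  have hest : ∀ n (t : ℝ), 0 < t → |∫ ω, V n ω ^ 3 ∂P - ∫ ω, U ω ^ 3 ∂P| ≤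
      t⁻¹ * ∫ ω, (U - V n) ω ^ 2 ∂P + t * (2 * (K + L)) := by
    intro n t ht
    rw [← integral_sub (hV3 n) hU3]
    have hd : Integrable (fun ω => (U - V n) ω ^ 2) P := (hU.sub (hV2 n)).integrable_sq
    have hs : Integrable (fun ω => V n ω ^ 4 + U ω ^ 4) P := (hV4 n).add hU4
    have h1 : |∫ ω, (V n ω ^ 3 - U ω ^ 3) ∂P| ≤
        ∫ ω, (t⁻¹ * (U - V n) ω ^ 2 + t * (2 * (V n ω ^ 4 + U ω ^ 4))) ∂P := by
      refine (abs_integral_le_integral_abs).trans (integral_mono ((hV3 n).sub hU3).abs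
        ((hd.const_mul _).add ((hs.const_mul _).const_mul _)) fun ω => ?_)
      simp only [Pi.sub_apply]
      set u := U ω
      set v := V n ω
      have hti : t * t⁻¹ = 1 := mul_inv_cancel₀ ht.ne'
      have hx : (v ^ 2 + v * u + u ^ 2) ^ 2 ≤ 8 * (v ^ 4 + u ^ 4) := by
        nlinarith [sq_nonneg (v ^ 2 - u ^ 2), sq_nonneg (v - u), sq_nonneg (v + u),
          mul_nonneg (sq_nonneg (v - u)) (sq_nonneg (v + u)),
          mul_nonneg (sq_nonneg (v - u)) (sq_nonneg v),
          mul_nonneg (sq_nonneg (v - u)) (sq_nonneg u),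
          sq_nonneg (v * u)]
      have hs : ∀ s : ℝ, s ^ 2 = 1 → s * (v ^ 3 - u ^ 3) ≤
          t⁻¹ * (u - v) ^ 2 + t * (2 * (v ^ 4 + u ^ 4)) := by
        intro s hs
        have h2 : 0 ≤ t⁻¹ * ((u - v) + s * t / 2 * (v ^ 2 + v * u + u ^ 2)) ^ 2 := by positivity
        have h3 : t⁻¹ * ((u - v) + s * t / 2 * (v ^ 2 + v * u + u ^ 2)) ^ 2 =
            t⁻¹ * (u - v) ^ 2 - (t * t⁻¹) * (s * (v ^ 3 - u ^ 3)) +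
              (t * t⁻¹) * t * s ^ 2 / 4 * (v ^ 2 + v * u + u ^ 2) ^ 2 := by ring
        rw [h3, hti, hs] at h2
        nlinarith [mul_le_mul_of_nonneg_left hx ht.le]
      rw [abs_le]
      constructor
      · have := hs (-1) (by norm_num); linarith
      · have := hs 1 (by norm_num); linarith
    refine h1.trans ?_
    rw [integral_add (hd.const_mul _) ((hs.const_mul _).const_mul _),
      integral_const_mul, integral_const_mul, integral_const_mul,
      integral_add (hV4 n) hU4]
    gcongr
    exact hK n
  rw [tendsto_iff_norm_sub_tendsto_zero]
  have hK0 : 0 ≤ K := (integral_nonneg fun ω => by positivity).trans (hK 0)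
  rw [Metric.tendsto_atTop]
  intro ε hε
  set t := ε / (4 * (K + L + 1)) with htd
  have ht : 0 < t := by positivity
  have hev := (hsq.pow 2).eventually (gt_mem_nhds (show (0:ℝ) ^ 2 < t * (ε / 4) by
    rw [zero_pow two_ne_zero]; positivity))
  obtain ⟨N, hN⟩ := hev.exists_forall_of_atTop
  refine ⟨N, fun n hn => ?_⟩
  have h1 := hN n hn
  rw [Real.sq_sqrt (integral_nonneg fun _ => sq_nonneg _)] at h1
  have h2 := hest n t ht
  have h3 : t⁻¹ * ∫ ω, (U - V n) ω ^ 2 ∂P < ε / 4 := by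
    rw [inv_mul_lt_iff₀ ht]; exact h1
  have h4 : t * (2 * (K + L)) ≤ ε / 2 := by
    rw [htd, div_mul_eq_mul_div, div_le_iff₀ (by positivity)]
    nlinarith
  rw [dist_zero_right, norm_norm, Real.norm_eq_abs]
  linarith

variable {R : ℕ} {G : Ω × ℝ × ℝ → ℝ} {W : FinSet → Ω → ℝ}

/-- A square integrable kernel, almost everywhere continuous in the two integration variables, with
enough integrability for the third moment of its double integral to be computed. -/
structure IsRegularKernel (m : MeasurableSpace Ω) [mΩ : MeasurableSpace Ω] (P : Measure Ω)
    (G : Ω × ℝ × ℝ → ℝ) : Prop where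
  measurable_left : ∀ y z, Measurable[m] fun ω => G (ω, y, z)
  measurable : Measurable G
  continuous : ∀ᵐ q : ℝ × ℝ, ∀ ω, ContinuousAt (fun q => G (ω, q)) q
  memLp : MemLp G 2 (kerMeasure P)
  integrable_sqNorm : Integrable (fun ω => sqNorm G ω ^ 2) P
  integrable_triForm : Integrable (triForm fun p => |G p|) (triMeasure P)

lemma ae_sub_ne (c : ℝ) : ∀ᵐ q : ℝ × ℝ, q.1 - q.2 ≠ c := by
  have h : ∀ᵐ x : ℝ, x ≠ c := by simp [ae_iff]
  exact (quasiMeasurePreserving_sub (volume : Measure ℝ) (volume : Measure ℝ)).ae h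

lemma ae_fst_abs_ne (c : ℝ) : ∀ᵐ q : ℝ × ℝ, |q.1| ≠ c ∧ |q.2| ≠ c := by
  have h : ∀ᵐ x : ℝ, |x| ≠ c := by
    filter_upwards [(by simp [ae_iff] : ∀ᵐ x : ℝ, x ≠ c), (by simp [ae_iff] : ∀ᵐ x : ℝ, x ≠ -c)]
      with x h1 h2 h3
    rcases abs_choice x with h | h
    · exact h1 (by rw [← h3, h])
    · exact h2 (by rw [← h3, h, neg_neg])
  exact ((Measure.quasiMeasurePreserving_fst (μ := (volume : Measure ℝ))
    (ν := (volume : Measure ℝ))).ae h).and ((Measure.quasiMeasurePreserving_snd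
    (μ := (volume : Measure ℝ)) (ν := (volume : Measure ℝ))).ae h)

lemma ae_triForm_tendsto [SFinite P] {g : ℕ → Ω × ℝ × ℝ → ℝ}
    (h : ∀ᵐ q : ℝ × ℝ, ∀ ω, Tendsto (fun n => g n (ω, q)) atTop (𝓝 (G (ω, q)))) :
    ∀ᵐ p ∂(triMeasure P), Tendsto (fun n => triForm (g n) p) atTop (𝓝 (triForm G p)) := by
  refine Measure.quasiMeasurePreserving_snd.ae (p := fun t : ℝ × ℝ × ℝ => ∀ ω : Ω,
    Tendsto (fun n => triForm (g n) (ω, t)) atTop (𝓝 (triForm G (ω, t)))) ?_ |>.mono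
    fun p hp => hp p.1
  filter_upwards [ae_pairs h] with t ht ω
  exact ((kerSym_tendsto (ht.1.1 ω) (ht.1.2 ω)).mul
    (kerSym_tendsto (ht.2.1.1 ω) (ht.2.1.2 ω))).mul
    (kerSym_tendsto (ht.2.2.1 ω) (ht.2.2.2 ω))

/-- Elementary approximation of a bounded kernel, with convergence of the moments. -/
lemma exists_elementary_of_bounded [IsProbabilityMeasure P] (hm : m ≤ mΩ)
    (hW : IsWhiteNoise P W) (hind : Indep m (noiseSigma W) P) (hG : IsBoundedKernel m R G)
    (hGm : Measurable G) (hc : ∀ᵐ q : ℝ × ℝ, ∀ ω, ContinuousAt (fun q => G (ω, q)) q)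
    {δ : ℝ} (hδ : 0 < δ) :
    ∃ p ∈ elementaryGraph m W, eLpNorm (G - p.1) 2 (kerMeasure P) ≤ ENNReal.ofReal δ ∧
      HasMoments p.2 P ∧ ∫ ω, p.2 ω ^ 4 ∂P ≤ 324 * ∫ ω, sqNorm G ω ^ 2 ∂P + 1 ∧
      |∫ ω, p.2 ω ^ 3 ∂P - ∫ q, triForm G q ∂(triMeasure P)| ≤ δ := by
  have hb := fun n : ℕ => hG.isBoxBounded_gridKernel (Nat.succ_pos n)
  have hbG := hG.isBoxBounded
  have hmeas := fun n : ℕ => measurable_gridKernel hm hG (Nat.succ_pos n)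
  have hlim : ∀ᵐ q : ℝ × ℝ, ∀ ω, Tendsto (fun n : ℕ => gridKernel (n + 1) G (ω, q)) atTop
      (𝓝 (G (ω, q))) := by
    filter_upwards [hc, ae_sub_ne 0] with q h1 h2 ω
    exact tendsto_gridKernel (sub_ne_zero.1 h2) (h1 ω)
  have hlimK : ∀ᵐ p ∂(kerMeasure P), Tendsto (fun n : ℕ => gridKernel (n + 1) G p) atTop
      (𝓝 (G p)) :=
    (Measure.quasiMeasurePreserving_snd.ae hlim).mono fun p hp => hp p.1
  have L1 : Tendsto (fun n : ℕ => eLpNorm (G - gridKernel (n + 1) G) 2 (kerMeasure P)) atTop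
      (𝓝 0) :=
    tendsto_eLpNorm_sub_of_dominated (fun n => (hmeas n).aestronglyMeasurable)
      hGm.aestronglyMeasurable (integrable_box_ker R (((R : ℝ) + 1) ^ 2))
      (fun n => Eventually.of_forall fun p => (hb n).sq_le p.1 p.2)
      (Eventually.of_forall fun p => hbG.sq_le p.1 p.2) hlimK
  have L2 : Tendsto (fun n : ℕ => ∫ q, triForm (gridKernel (n + 1) G) q ∂(triMeasure P)) atTop
      (𝓝 (∫ q, triForm G q ∂(triMeasure P))) :=
    tendsto_integral_of_dominated_convergence _
      (fun n => (measurable_triForm (hmeas n)).aestronglyMeasurable)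
      (integrable_box_tri R (8 * ((R : ℝ) + 1) ^ 3))
      (fun n => Eventually.of_forall fun p => (hb n).abs_triForm_le p)
      (ae_triForm_tendsto hlim)
  have L3 : Tendsto (fun n : ℕ => ∫ ω, sqNorm (gridKernel (n + 1) G) ω ^ 2 ∂P) atTop
      (𝓝 (∫ ω, sqNorm G ω ^ 2 ∂P)) := by
    refine tendsto_integral_of_dominated_convergence
      (fun _ => (∫ q : ℝ × ℝ, ((R : ℝ) + 1) ^ 2 * (boxInd R q.1 * boxInd R q.2)) ^ 2)
      (fun n => ((measurable_sqNorm (hmeas n)).pow_const 2).aestronglyMeasurable)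
      (integrable_const _) (fun n => Eventually.of_forall fun ω => ?_)
      (Eventually.of_forall fun ω => Tendsto.pow ?_ 2)
    · rw [Real.norm_of_nonneg (sq_nonneg _)]
      exact pow_le_pow_left₀ ((hb n).sqNorm_le (hmeas n) ω).1 ((hb n).sqNorm_le (hmeas n) ω).2 2
    · refine tendsto_integral_of_dominated_convergence _
        (fun n => ((hb n).integrable_sq (hmeas n) ω).aestronglyMeasurable)
        (integrable_box_pair R (((R : ℝ) + 1) ^ 2)) (fun n => Eventually.of_forall fun q => ?_) ?_
      · rw [Real.norm_of_nonneg (sq_nonneg _)]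
        exact (hb n).sq_le ω q
      · filter_upwards [hlim] with q hq
        exact (hq ω).pow 2
  have E1 := L1.eventually (ge_mem_nhds (by simpa using hδ : 0 < ENNReal.ofReal δ))
  have E2 := (Metric.tendsto_nhds.1 L2 δ hδ)
  have E3 := L3.eventually (ge_mem_nhds (show ∫ ω, sqNorm G ω ^ 2 ∂P <
    ∫ ω, sqNorm G ω ^ 2 ∂P + 1 / 324 by linarith))
  obtain ⟨n, h1, h2, h3⟩ := (E1.and (E2.and E3)).exists
  refine ⟨_, mem_elementaryGraph_grid hG (Nat.succ_pos n) W, h1,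
    hasMoments_gridIntegral hm hW hG (Nat.succ_pos n), ?_, ?_⟩
  · have := integral_gridIntegral_fourth_le hm hW hind hG (Nat.succ_pos n)
    simp only
    linarith
  · simp only
    rw [integral_gridIntegral_cube hm hW hind hG (Nat.succ_pos n)]
    exact (Real.dist_eq _ _).symm.le.trans h2.le

/-- Elementary approximation of a regular kernel, with bounded fourth moments and convergence of
the third moments. -/
lemma IsRegularKernel.exists_elementary [IsProbabilityMeasure P] (hm : m ≤ mΩ)
    (hW : IsWhiteNoise P W) (hind : Indep m (noiseSigma W) P) (hG : IsRegularKernel m P G) :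
    ∃ h : ℕ → (Ω × ℝ × ℝ → ℝ) × (Ω → ℝ), (∀ n, h n ∈ elementaryGraph m W) ∧
      Tendsto (fun n => eLpNorm (G - (h n).1) 2 (kerMeasure P)) atTop (𝓝 0) ∧
      (∀ n, HasMoments (h n).2 P) ∧
      (∀ n, ∫ ω, (h n).2 ω ^ 4 ∂P ≤ 324 * ∫ ω, sqNorm G ω ^ 2 ∂P + 1) ∧
      Tendsto (fun n => ∫ ω, (h n).2 ω ^ 3 ∂P) atTop (𝓝 (∫ q, triForm G q ∂(triMeasure P))) := by
  have hT := fun R : ℕ => measurable_truncKernel R hG.measurable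
  have hb := fun R : ℕ => isBoundedKernel_truncKernel R hG.measurable_left
  have hc : ∀ R : ℕ, ∀ᵐ q : ℝ × ℝ, ∀ ω, ContinuousAt (fun q => truncKernel R G (ω, q)) q :=
    fun R => by
      filter_upwards [hG.continuous, ae_fst_abs_ne R] with q h1 h2 ω
      exact continuousAt_truncKernel (h1 ω) h2.1 h2.2
  have hsq : ∀ R p, truncKernel R G p ^ 2 ≤ G p ^ 2 := fun R p => by
    rw [← sq_abs, ← sq_abs (G p)]
    exact pow_le_pow_left₀ (abs_nonneg _) (abs_truncKernel_le R G p) 2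
  choose h hh h1 h2 h3 h4 using fun R : ℕ => exists_elementary_of_bounded hm hW hind (hb R) (hT R)
    (hc R) (Nat.one_div_pos_of_nat (α := ℝ) (n := R))
  have hδ : Tendsto (fun R : ℕ => 1 / ((R : ℝ) + 1)) atTop (𝓝 0) :=
    tendsto_one_div_add_atTop_nhds_zero_nat
  refine ⟨h, hh, ?_, h2, fun R => (h3 R).trans ?_, ?_⟩
  · have hl : Tendsto (fun R : ℕ => eLpNorm (G - truncKernel R G) 2 (kerMeasure P)) atTop (𝓝 0) :=
      tendsto_eLpNorm_sub_of_dominated (fun R => (hT R).aestronglyMeasurable)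
        hG.measurable.aestronglyMeasurable hG.memLp.integrable_sq
        (fun R => Eventually.of_forall fun p => hsq R p)
        (Eventually.of_forall fun p => le_rfl)
        (Eventually.of_forall fun p => tendsto_truncKernel G p)
    have hs := hl.add ((ENNReal.continuous_ofReal.tendsto 0).comp hδ)
    rw [ENNReal.ofReal_zero, add_zero] at hs
    refine tendsto_of_tendsto_of_tendsto_of_le_of_le tendsto_const_nhds hs (fun n => zero_le)
      fun R => ?_
    have e : G - (h R).1 = (G - truncKernel R G) + (truncKernel R G - (h R).1) := by abel
    rw [e]
    refine (eLpNorm_add_le (hG.measurable.sub (hT R)).aestronglyMeasurable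
      ((hT R).aestronglyMeasurable.sub (memLp_elementaryGraph hm hW (hh R)).1.1) (by simp)).trans ?_
    exact add_le_add le_rfl (h1 R)
  · have hle : ∫ ω, sqNorm (truncKernel R G) ω ^ 2 ∂P ≤ ∫ ω, sqNorm G ω ^ 2 ∂P := ?_
    · linarith
    refine integral_mono_of_nonneg (Eventually.of_forall fun ω => sq_nonneg _)
      hG.integrable_sqNorm ?_
    filter_upwards [hG.memLp.integrable_sq.prod_right_ae] with ω hω
    refine pow_le_pow_left₀ (integral_nonneg fun _ => sq_nonneg _) ?_ 2
    exact integral_mono ((hb R).isBoxBounded.integrable_sq (hT R) ω) hω fun q => hsq R _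
  · have hl : Tendsto (fun R : ℕ => ∫ q, triForm (truncKernel R G) q ∂(triMeasure P)) atTop
        (𝓝 (∫ q, triForm G q ∂(triMeasure P))) := by
      refine tendsto_integral_of_dominated_convergence _
        (fun R => (measurable_triForm (hT R)).aestronglyMeasurable) hG.integrable_triForm
        (fun R => Eventually.of_forall fun p => ?_)
        (ae_triForm_tendsto (Eventually.of_forall fun q ω => tendsto_truncKernel G (ω, q)))
      have hk : ∀ ω y z, |kerSym (truncKernel R G) ω y z| ≤ kerSym (fun p => |G p|) ω y z :=
        fun ω y z => (abs_add_le _ _).trans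
          (add_le_add (abs_truncKernel_le R G _) (abs_truncKernel_le R G _))
      have hk0 : ∀ ω y z, 0 ≤ kerSym (fun p => |G p|) ω y z := fun ω y z =>
        add_nonneg (abs_nonneg _) (abs_nonneg _)
      rw [Real.norm_eq_abs, triForm, abs_mul, abs_mul]
      exact mul_le_mul (mul_le_mul (hk _ _ _) (hk _ _ _) (abs_nonneg _) (hk0 _ _ _)) (hk _ _ _)
        (abs_nonneg _) (mul_nonneg (hk0 _ _ _) (hk0 _ _ _))
    have hd : Tendsto (fun R => ∫ ω, (h R).2 ω ^ 3 ∂P -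
        ∫ q, triForm (truncKernel R G) q ∂(triMeasure P)) atTop (𝓝 0) :=
      squeeze_zero_norm (fun R => h4 R) hδ
    simpa using hd.add hl

lemma IsRegularKernel.exists_isDoubleIntegral [IsProbabilityMeasure P] (hm : m ≤ mΩ)
    (hW : IsWhiteNoise P W) (hind : Indep m (noiseSigma W) P) (hG : IsRegularKernel m P G) :
    ∃ U, IsDoubleIntegral m P W G U := by
  obtain ⟨h, hh, h1, -⟩ := hG.exists_elementary hm hW hind
  exact SkewField.exists_isDoubleIntegral hm hW hind hG.measurable.aestronglyMeasurable hh h1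

/-- The third moment of the double integral of a random kernel is the expectation of the trace of
the third power of `kerSym G`. -/
theorem IsRegularKernel.integral_cube [IsProbabilityMeasure P] (hm : m ≤ mΩ)
    (hW : IsWhiteNoise P W) (hind : Indep m (noiseSigma W) P) (hG : IsRegularKernel m P G)
    {U : Ω → ℝ} (hU : IsDoubleIntegral m P W G U) :
    Integrable (fun ω => U ω ^ 3) P ∧
      ∫ ω, U ω ^ 3 ∂P = ∫ q, triForm G q ∂(triMeasure P) := by
  obtain ⟨h, hh, h1, h2, h3, h4⟩ := hG.exists_elementary hm hW hind
  have hlim := hU.tendsto hm hW hind hG.measurable.aestronglyMeasurable hh h1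
  obtain ⟨hi, ht⟩ := tendsto_integral_cube hU.1 (fun n => h2 n 4 (by simp)) h3 hlim
  exact ⟨hi, tendsto_nhds_unique ht h4⟩

end ThirdMoment

/-! ### Reduction of the triple integral to a single integral -/

section Triple

lemma integral_comp_measurePreserving {α β : Type*} [MeasurableSpace α] [MeasurableSpace β]
    {μ : Measure α} {ν : Measure β} {f : α → β} (hf : MeasurePreserving f μ ν) {g : β → ℝ}
    (hg : AEStronglyMeasurable g ν) : ∫ x, g (f x) ∂μ = ∫ y, g y ∂ν := by
  have h := integral_map hf.measurable.aemeasurable (f := g) (by rwa [hf.map_eq])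
  rw [← h, hf.map_eq]

/-- The indicator of `[-1, 1]`. -/
def unitInd : ℝ → ℝ := (Icc (-1 : ℝ) 1).indicator 1

lemma measurable_unitInd : Measurable unitInd := measurable_one.indicator measurableSet_Icc

lemma unitInd_nonneg (x : ℝ) : 0 ≤ unitInd x := Set.indicator_nonneg (fun _ _ => zero_le_one) x

lemma unitInd_le_one (x : ℝ) : unitInd x ≤ 1 := by
  unfold unitInd Set.indicator; split_ifs <;> simp

lemma unitInd_eq_one {x : ℝ} (h : |x| ≤ 1) : unitInd x = 1 := by
  rw [unitInd, Set.indicator_of_mem]; · rfl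
  exact abs_le.1 h

lemma unitInd_neg (x : ℝ) : unitInd (-x) = unitInd x := by
  have : -x ∈ Icc (-1 : ℝ) 1 ↔ x ∈ Icc (-1 : ℝ) 1 := by
    simp only [mem_Icc]; constructor <;> rintro ⟨h1, h2⟩ <;> constructor <;> linarith
  simp only [unitInd, Set.indicator, this, Pi.one_apply]

lemma integrable_unitInd : Integrable unitInd :=
  (integrable_indicator_iff measurableSet_Icc).2 (integrableOn_const (by simp))

/-- A bounded odd function supported in `[-1, 1]`. -/
structure IsOddKernel (κ : ℝ → ℝ) : Prop where
  measurable : Measurable κ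
  odd : ∀ x, κ (-x) = -κ x
  bounded : ∃ K, ∀ x, |κ x| ≤ K
  support : ∀ x, 1 < |x| → κ x = 0

lemma IsOddKernel.exists_bound {κ : ℝ → ℝ} (hκ : IsOddKernel κ) :
    ∃ K, 0 ≤ K ∧ ∀ x, |κ x| ≤ K * unitInd x := by
  obtain ⟨K, hK⟩ := hκ.bounded
  refine ⟨K, (abs_nonneg _).trans (hK 0), fun x => ?_⟩
  by_cases h : |x| ≤ 1
  · rw [unitInd_eq_one h, mul_one]; exact hK x
  · rw [hκ.support x (not_le.1 h), abs_zero]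
    exact mul_nonneg ((abs_nonneg _).trans (hK 0)) (unitInd_nonneg x)

/-- An integrable and square integrable function, continuous almost everywhere. -/
structure IsProfile (D : ℝ → ℝ) : Prop where
  measurable : Measurable D
  integrable : Integrable D
  integrable_sq : Integrable fun x => D x ^ 2
  continuousAt : ∀ᵐ x, ContinuousAt D x

/-- The convolution of `κ` with itself. -/
def selfConv (κ : ℝ → ℝ) (h : ℝ) : ℝ := ∫ s, κ (h - s) * κ s

/-- The cubic correlation `∫ D(y)² D(y + h) dy`. -/
def cubicCorr (D : ℝ → ℝ) (h : ℝ) : ℝ := ∫ y, D y ^ 2 * D (y + h)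

/-- The product of the values of `κ` on the three differences of three points. -/
def triProd (κ : ℝ → ℝ) (t : ℝ × ℝ × ℝ) : ℝ :=
  κ (t.1 - t.2.1) * κ (t.2.1 - t.2.2) * κ (t.2.2 - t.1)

/-- The product of the three differences of the values of `D` at three points. -/
def vandermonde (D : ℝ → ℝ) (t : ℝ × ℝ × ℝ) : ℝ :=
  (D t.1 - D t.2.1) * (D t.2.1 - D t.2.2) * (D t.2.2 - D t.1)

/-- An upper bound for `|vandermonde D|`. -/
def vanderBound (D : ℝ → ℝ) (t : ℝ × ℝ × ℝ) : ℝ :=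
  (|D t.1| + |D t.2.1|) * (|D t.2.1| + |D t.2.2|) * (|D t.2.2| + |D t.1|)

/-- Exchange of the last two of three variables. -/
def swapLast (t : ℝ × ℝ × ℝ) : ℝ × ℝ × ℝ := (t.1, t.2.2, t.2.1)

lemma measurePreserving_swapLast : MeasurePreserving swapLast :=
  (MeasurePreserving.id volume).prod (Measure.measurePreserving_swap (μ := volume) (ν := volume))

lemma measurable_triProd {κ : ℝ → ℝ} (hκ : Measurable κ) : Measurable (triProd κ) := by
  unfold triProd; fun_prop

lemma measurable_vanderBound {D : ℝ → ℝ} (hD : Measurable D) : Measurable (vanderBound D) := by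
  unfold vanderBound; fun_prop

lemma abs_vandermonde_le (D : ℝ → ℝ) (t : ℝ × ℝ × ℝ) : |vandermonde D t| ≤ vanderBound D t := by
  unfold vandermonde vanderBound
  rw [abs_mul, abs_mul]
  gcongr <;> exact abs_sub _ _

lemma vanderBound_nonneg (D : ℝ → ℝ) (t : ℝ × ℝ × ℝ) : 0 ≤ vanderBound D t := by
  unfold vanderBound; positivity

lemma triProd_cyc (κ : ℝ → ℝ) (t : ℝ × ℝ × ℝ) : triProd κ (cyc t) = triProd κ t := by
  simp only [triProd, cyc]; ring

lemma triProd_swapLast {κ : ℝ → ℝ} (hκ : ∀ x, κ (-x) = -κ x) (t : ℝ × ℝ × ℝ) :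
    triProd κ (swapLast t) = -triProd κ t := by
  simp only [triProd, swapLast]
  rw [← neg_sub t.2.2 t.1, ← neg_sub t.2.1 t.2.2, ← neg_sub t.1 t.2.1]
  simp only [hκ]; ring_nf

lemma triProd_unitInd_swapLast (t : ℝ × ℝ × ℝ) :
    triProd unitInd (swapLast t) = triProd unitInd t := by
  simp only [triProd, swapLast]
  rw [← neg_sub t.2.2 t.1, ← neg_sub t.2.1 t.2.2, ← neg_sub t.1 t.2.1]
  simp only [unitInd_neg]; ring

lemma triProd_unitInd_nonneg (t : ℝ × ℝ × ℝ) : 0 ≤ triProd unitInd t :=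
  mul_nonneg (mul_nonneg (unitInd_nonneg _) (unitInd_nonneg _)) (unitInd_nonneg _)

lemma abs_triProd_le {κ : ℝ → ℝ} {K : ℝ} (hK : 0 ≤ K) (h : ∀ x, |κ x| ≤ K * unitInd x)
    (t : ℝ × ℝ × ℝ) : |triProd κ t| ≤ K ^ 3 * triProd unitInd t := by
  have h0 := fun x => mul_nonneg hK (unitInd_nonneg x)
  unfold triProd
  rw [abs_mul, abs_mul]
  calc _ ≤ (K * unitInd _) * (K * unitInd _) * (K * unitInd _) :=
        mul_le_mul (mul_le_mul (h _) (h _) (abs_nonneg _) (h0 _)) (h _) (abs_nonneg _)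
          (mul_nonneg (h0 _) (h0 _))
    _ = _ := by ring

variable {D κ : ℝ → ℝ}

lemma IsProfile.integrable_triProd_sq_mul (hD : IsProfile D) :
    Integrable (fun t : ℝ × ℝ × ℝ => triProd unitInd t * (D t.1 ^ 2 * |D t.2.1|)) := by
  have h1 : Integrable (fun q : ℝ × ℝ => |D q.2| * unitInd (q.1 - q.2)) :=
    hD.integrable.abs.convolution_integrand (ContinuousLinearMap.mul ℝ ℝ) integrable_unitInd
  have h2 : Integrable (fun q : ℝ × ℝ => |D q.1| * unitInd (q.2 - q.1)) :=
    (Measure.measurePreserving_swap (μ := (volume : Measure ℝ))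
      (ν := (volume : Measure ℝ))).integrable_comp_of_integrable h1
  have h3 : Integrable (fun t : ℝ × ℝ × ℝ => D t.1 ^ 2 * (|D t.2.1| * unitInd (t.2.2 - t.2.1))) :=
    hD.integrable_sq.mul_prod h2
  have hm := hD.measurable
  refine h3.mono' ((measurable_triProd measurable_unitInd).mul (by fun_prop)).aestronglyMeasurable
    (Eventually.of_forall fun t => ?_)
  have h4 : triProd unitInd t ≤ unitInd (t.2.2 - t.2.1) := by
    rw [triProd, ← unitInd_neg (t.2.2 - t.2.1), neg_sub]
    have h0 := unitInd_nonneg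
    have h1 := unitInd_le_one
    calc _ ≤ 1 * unitInd (t.2.1 - t.2.2) * 1 := by
          exact mul_le_mul (mul_le_mul_of_nonneg_right (h1 _) (h0 _)) (h1 _) (h0 _)
            (mul_nonneg zero_le_one (h0 _))
      _ = _ := by ring
  rw [Real.norm_of_nonneg (mul_nonneg (triProd_unitInd_nonneg t) (by positivity))]
  calc _ ≤ unitInd (t.2.2 - t.2.1) * (D t.1 ^ 2 * |D t.2.1|) := by gcongr
    _ = _ := by ring

lemma IsProfile.integrable_triProd_vanderBound (hD : IsProfile D) :
    Integrable (fun t : ℝ × ℝ × ℝ => triProd unitInd t * vanderBound D t) := by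
  have h1 := hD.integrable_triProd_sq_mul
  have h2 := measurePreserving_swapLast.integrable_comp_of_integrable h1
  have h3 := (h1.add h2)
  have h4 := measurePreserving_cyc.integrable_comp_of_integrable h3
  have h5 := measurePreserving_cyc.integrable_comp_of_integrable h4
  refine (((h3.add h4).add h5).const_mul 2).mono'
    ((measurable_triProd measurable_unitInd).mul
      (measurable_vanderBound hD.measurable)).aestronglyMeasurable
    (Eventually.of_forall fun t => ?_)
  have h0 := triProd_unitInd_nonneg t
  rw [Real.norm_of_nonneg (mul_nonneg h0 (vanderBound_nonneg D t))]
  simp only [Pi.add_apply, Function.comp_apply, triProd_cyc, triProd_unitInd_swapLast]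
  simp only [swapLast, cyc, vanderBound]
  rw [← sq_abs (D t.1), ← sq_abs (D t.2.1), ← sq_abs (D t.2.2)]
  have ha := abs_nonneg (D t.1)
  have hb := abs_nonneg (D t.2.1)
  have hc := abs_nonneg (D t.2.2)
  set a := |D t.1|
  set b := |D t.2.1|
  set c := |D t.2.2|
  have key : (a + b) * (b + c) * (c + a) ≤
      2 * (a ^ 2 * b + a ^ 2 * c + (b ^ 2 * c + b ^ 2 * a) + (c ^ 2 * a + c ^ 2 * b)) := by
    nlinarith [mul_nonneg hc (sq_nonneg (a - b)), mul_nonneg ha (sq_nonneg b),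
      mul_nonneg ha (sq_nonneg c), mul_nonneg hb (sq_nonneg a), mul_nonneg hb (sq_nonneg c),
      mul_nonneg hc (sq_nonneg a), mul_nonneg hc (sq_nonneg b)]
  refine (mul_le_mul_of_nonneg_left key h0).trans (le_of_eq ?_)
  ring

lemma IsOddKernel.integrable_triProd_sq_mul (hκ : IsOddKernel κ) (hD : IsProfile D) :
    Integrable (fun t : ℝ × ℝ × ℝ => triProd κ t * (D t.1 ^ 2 * D t.2.1)) := by
  obtain ⟨K, hK, h⟩ := hκ.exists_bound
  have hm := hD.measurable
  refine (hD.integrable_triProd_sq_mul.const_mul (K ^ 3)).mono'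
    ((measurable_triProd hκ.measurable).mul (by fun_prop)).aestronglyMeasurable
    (Eventually.of_forall fun t => ?_)
  rw [Real.norm_eq_abs, abs_mul, abs_mul, abs_of_nonneg (sq_nonneg (D t.1))]
  exact (mul_le_mul_of_nonneg_right (abs_triProd_le hK h t) (by positivity)).trans
    (le_of_eq (mul_assoc _ _ _))

lemma measurable_selfConv (hκ : Measurable κ) : Measurable (selfConv κ) := by
  have : Measurable fun q : ℝ × ℝ => κ (q.1 - q.2) * κ q.2 := by fun_prop
  exact (this.stronglyMeasurable.integral_prod_right (ν := volume)).measurable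

lemma IsOddKernel.selfConv_bounded (hκ : IsOddKernel κ) : ∃ K, ∀ h, |selfConv κ h| ≤ K := by
  obtain ⟨K, hK, hb⟩ := hκ.exists_bound
  refine ⟨∫ s, K * (K * unitInd s), fun h => ?_⟩
  refine (abs_integral_le_integral_abs).trans (integral_mono_of_nonneg
    (Eventually.of_forall fun s => abs_nonneg _) ((integrable_unitInd.const_mul _).const_mul _)
    (Eventually.of_forall fun s => ?_))
  simp only [abs_mul]
  refine mul_le_mul ((hb _).trans ?_) (hb s) (abs_nonneg _) hK
  exact mul_le_of_le_one_right hK (unitInd_le_one _)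

lemma selfConv_neg (hκ : ∀ x, κ (-x) = -κ x) (h : ℝ) : selfConv κ (-h) = selfConv κ h := by
  unfold selfConv
  rw [← integral_neg_eq_self]
  refine integral_congr_ae (Eventually.of_forall fun s => ?_)
  simp only
  rw [hκ, show -h - -s = -(h - s) by ring, hκ, neg_mul_neg]

lemma IsProfile.integrable_shift (hD : IsProfile D) :
    Integrable (fun q : ℝ × ℝ => D q.1 ^ 2 * D (q.1 + q.2)) := by
  have h := hD.integrable_sq.mul_prod hD.integrable
  exact (measurePreserving_prod_add (volume : Measure ℝ)
    (volume : Measure ℝ)).integrable_comp_of_integrable h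

/-- The third variable enters only through `triProd κ`, and integrating it out yields the
self-convolution of `κ`. -/
lemma IsOddKernel.integral_triProd_sq_mul (hκ : IsOddKernel κ) (hD : IsProfile D) :
    ∫ t : ℝ × ℝ × ℝ, triProd κ t * (D t.1 ^ 2 * D t.2.1) =
      -∫ h, κ h * selfConv κ h * cubicCorr D h := by
  have hi := hκ.integrable_triProd_sq_mul hD
  have hw : ∀ y z : ℝ, ∫ w, triProd κ (y, z, w) * (D y ^ 2 * D z) =
      κ (y - z) * selfConv κ (z - y) * (D y ^ 2 * D z) := fun y z => by
    have h1 := integral_add_right_eq_self (μ := volume)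
      (fun w => triProd κ (y, z, w) * (D y ^ 2 * D z)) y
    rw [← h1, selfConv, ← integral_const_mul, ← integral_mul_const]
    refine integral_congr_ae (Eventually.of_forall fun s => ?_)
    simp only [triProd]
    rw [show z - (s + y) = z - y - s by ring, show s + y - y = s by ring]
    ring
  have hz : ∀ y : ℝ, ∫ z, κ (y - z) * selfConv κ (z - y) * (D y ^ 2 * D z) =
      ∫ h, -(κ h * selfConv κ h) * (D y ^ 2 * D (y + h)) := fun y => by
    have h1 := integral_add_right_eq_self (μ := volume)
      (fun z => κ (y - z) * selfConv κ (z - y) * (D y ^ 2 * D z)) y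
    rw [← h1]
    refine integral_congr_ae (Eventually.of_forall fun h => ?_)
    simp only
    rw [show y - (h + y) = -h by ring, hκ.odd, show h + y - y = h by ring, add_comm h y]
    ring
  have e1 : ∫ t : ℝ × ℝ × ℝ, triProd κ t * (D t.1 ^ 2 * D t.2.1) =
      ∫ y, ∫ h, -(κ h * selfConv κ h) * (D y ^ 2 * D (y + h)) := by
    rw [Measure.volume_eq_prod, integral_prod _ hi]
    refine integral_congr_ae ?_
    filter_upwards [hi.prod_right_ae] with y hy
    rw [← hz, Measure.volume_eq_prod, integral_prod _ hy]
    exact integral_congr_ae (Eventually.of_forall fun z => hw y z)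
  obtain ⟨K, hK⟩ := hκ.bounded
  obtain ⟨L, hL⟩ := hκ.selfConv_bounded
  have hm := hκ.measurable
  have hm' := measurable_selfConv hm
  have hii : Integrable (fun q : ℝ × ℝ => -(κ q.2 * selfConv κ q.2) *
      (D q.1 ^ 2 * D (q.1 + q.2))) := by
    refine hD.integrable_shift.bdd_mul (c := K * L) (by fun_prop)
      (Eventually.of_forall fun q => ?_)
    rw [norm_neg, norm_mul]
    exact mul_le_mul (hK _) (hL _) (abs_nonneg _) ((abs_nonneg _).trans (hK 0))
  rw [e1, integral_integral_swap hii, ← integral_neg]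
  refine integral_congr_ae (Eventually.of_forall fun h => ?_)
  simp only
  rw [integral_const_mul, cubicCorr]
  ring

/-- As `triProd κ` is alternating, each of the six terms of the Vandermonde product contributes the
same amount. -/
lemma IsOddKernel.integral_triProd_vandermonde (hκ : IsOddKernel κ) (hD : IsProfile D) :
    ∫ t, triProd κ t * vandermonde D t = 6 * ∫ h, κ h * selfConv κ h * cubicCorr D h := by
  have h1 := hκ.integrable_triProd_sq_mul hD
  set A : ℝ × ℝ × ℝ → ℝ := fun t => triProd κ t * (D t.1 ^ 2 * D t.2.1) with hA
  have h2 : Integrable fun t => A (swapLast t) :=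
    measurePreserving_swapLast.integrable_comp_of_integrable h1
  set B : ℝ × ℝ × ℝ → ℝ := fun t => A t + A (swapLast t) with hB
  have h3 : Integrable B := h1.add h2
  have h4 : Integrable fun t => B (cyc t) := measurePreserving_cyc.integrable_comp_of_integrable h3
  have h5 : Integrable fun t => B (cyc (cyc t)) :=
    measurePreserving_cyc.integrable_comp_of_integrable h4
  have i2 : ∫ t, A (swapLast t) = ∫ t, A t :=
    integral_comp_measurePreserving measurePreserving_swapLast h1.aestronglyMeasurable
  have i3 : ∫ t, B t = 2 * ∫ t, A t := by rw [hB, integral_add h1 h2, i2]; ring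
  have i4 : ∫ t, B (cyc t) = ∫ t, B t :=
    integral_comp_measurePreserving measurePreserving_cyc h3.aestronglyMeasurable
  have i5 : ∫ t, B (cyc (cyc t)) = ∫ t, B (cyc t) :=
    integral_comp_measurePreserving measurePreserving_cyc h4.aestronglyMeasurable
  have e : ∀ t, triProd κ t * vandermonde D t = -(B t + B (cyc t) + B (cyc (cyc t))) := fun t => by
    simp only [hB, hA, triProd_swapLast hκ.odd, triProd_cyc]
    simp only [vandermonde, swapLast, cyc]
    ring
  simp only [e]
  have h34 : Integrable fun t => B t + B (cyc t) := h3.add h4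
  rw [integral_neg, integral_add h34 h5, integral_add h3 h4, i5, i4, i3,
    hκ.integral_triProd_sq_mul hD]
  ring

end Triple

/-! ### Kernels weighted by the exponential of a stationary Gaussian field -/

section Chaos

/-- Integrability on a product from a uniform bound of the expectations, by Tonelli. -/
lemma integrable_mul_of_integral_le {Ω α : Type*} [MeasurableSpace Ω] [MeasurableSpace α]
    {P : Measure Ω} {μ : Measure α} [SFinite P] [SFinite μ] {ρ : α → ℝ} {f : Ω × α → ℝ} {B : ℝ}
    (hρ : Integrable ρ μ) (hρm : Measurable ρ) (hρ0 : ∀ q, 0 ≤ ρ q) (hf : Measurable f)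
    (hf0 : ∀ p, 0 ≤ f p)
    (hfi : ∀ q, Integrable (fun ω => f (ω, q)) P) (hB : ∀ q, ∫ ω, f (ω, q) ∂P ≤ B) :
    Integrable (fun p : Ω × α => ρ p.2 * f p) (P.prod μ) := by
  have hm : Measurable fun p : Ω × α => ρ p.2 * f p := by fun_prop
  rw [integrable_prod_iff' hm.aestronglyMeasurable]
  refine ⟨Eventually.of_forall fun q => (hfi q).const_mul (ρ q), ?_⟩
  refine (hρ.mul_const B).mono'
    (hm.norm.stronglyMeasurable.integral_prod_left').aestronglyMeasurable
    (Eventually.of_forall fun q => ?_)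
  rw [Real.norm_of_nonneg (integral_nonneg fun _ => norm_nonneg _)]
  simp only [fun ω => Real.norm_of_nonneg (mul_nonneg (hρ0 q) (hf0 (ω, q)))]
  rw [integral_const_mul]
  exact mul_le_mul_of_nonneg_left (hB q) (hρ0 q)

/-- Cauchy-Schwarz for the measure of density `ρ`; the added `1` spares the case `∫ ρ = 0`. -/
lemma sq_integral_mul_le {α : Type*} [MeasurableSpace α] {μ : Measure α} {ρ f : α → ℝ}
    (hρ0 : ∀ q, 0 ≤ ρ q) (hρ : Integrable ρ μ) (h1 : Integrable (fun q => ρ q * f q) μ)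
    (h2 : Integrable (fun q => ρ q * f q ^ 2) μ) :
    (∫ q, ρ q * f q ∂μ) ^ 2 ≤ (∫ q, ρ q ∂μ + 1) * ∫ q, ρ q * f q ^ 2 ∂μ := by
  set r := ∫ q, ρ q ∂μ
  set I := ∫ q, ρ q * f q ∂μ
  set J := ∫ q, ρ q * f q ^ 2 ∂μ
  have hr : 0 ≤ r := integral_nonneg hρ0
  have e : ∫ q, ρ q * (f q * (r + 1) - I) ^ 2 ∂μ =
      (r + 1) ^ 2 * J - 2 * (r + 1) * I * I + I ^ 2 * r := by
    have : ∀ q, ρ q * (f q * (r + 1) - I) ^ 2 =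
        (r + 1) ^ 2 * (ρ q * f q ^ 2) - 2 * (r + 1) * I * (ρ q * f q) + I ^ 2 * ρ q := fun q => by
      ring
    simp only [this]
    have i1 := h2.const_mul ((r + 1) ^ 2)
    have i2 := h1.const_mul (2 * (r + 1) * I)
    have i3 : Integrable (fun q =>
        (r + 1) ^ 2 * (ρ q * f q ^ 2) - 2 * (r + 1) * I * (ρ q * f q)) μ :=
      i1.sub i2
    rw [integral_add i3 (hρ.const_mul _), integral_sub i1 i2, integral_const_mul,
      integral_const_mul, integral_const_mul]
  have h0 : 0 ≤ ∫ q, ρ q * (f q * (r + 1) - I) ^ 2 ∂μ :=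
    integral_nonneg fun q => mul_nonneg (hρ0 q) (sq_nonneg _)
  rw [e] at h0
  have h3 : 0 ≤ (r + 1) * ((r + 1) * J - I ^ 2) := by nlinarith [sq_nonneg I]
  have := nonneg_of_mul_nonneg_right h3 (by linarith)
  linarith

lemma integral_exp_gaussian {Ω : Type*} [MeasurableSpace Ω] {P : Measure Ω} {X : Ω → ℝ}
    (hX : HasGaussianLaw X P) (h0 : ∫ ω, X ω ∂P = 0) (t : ℝ) :
    Integrable (fun ω => Real.exp (t * X ω)) P ∧
      ∫ ω, Real.exp (t * X ω) ∂P = Real.exp (Var[X; P] * t ^ 2 / 2) := by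
  have hm := hX.map_eq_gaussianReal
  rw [h0] at hm
  have hmgf : mgf X P t = Real.exp (Var[X; P] * t ^ 2 / 2) := by
    rw [mgf_gaussianReal hm t, Real.coe_toNNReal _ (variance_nonneg _ _)]; simp
  refine ⟨?_, hmgf⟩
  have := hX.isProbabilityMeasure
  rw [← mgf_pos_iff, hmgf]
  positivity

lemma measurable_exp_field {Ω : Type*} (Xhat : ℝ → ℝ → Ω → ℝ) (γ c ε y : ℝ) :
    Measurable[fieldSigma Xhat ε] fun ω => Real.exp (γ * Xhat ε y ω - c) := by
  have h : Measurable[fieldSigma Xhat ε] fun ω => Xhat ε y ω :=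
    (measurable_pi_apply y).comp (comap_measurable (fun ω x => Xhat ε x ω))
  exact Real.measurable_exp.comp ((h.const_mul γ).sub_const c)

variable {Ω : Type*} [MeasurableSpace Ω] {P : Measure Ω}
  {γ ε : ℝ} {Xhat : ℝ → ℝ → Ω → ℝ} {D k : ℝ → ℝ}

/-- The kernel `D(y) k(y - z) M(z) M(y)`, where `M` is the density `chaosDensity`. -/
def chaosKernel (P : Measure Ω) (γ : ℝ) (Xhat : ℝ → ℝ → Ω → ℝ) (ε : ℝ) (D k : ℝ → ℝ)
    (p : Ω × ℝ × ℝ) : ℝ :=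
  D p.2.1 * k (p.2.1 - p.2.2) * chaosDensity P γ Xhat ε p.2.2 p.1 *
    chaosDensity P γ Xhat ε p.2.1 p.1

/-- The covariance function of the field `Xhat ε`. -/
def fieldCov (P : Measure Ω) (Xhat : ℝ → ℝ → Ω → ℝ) (ε x : ℝ) : ℝ := cov[Xhat ε x, Xhat ε 0; P]

lemma chaosDensity_pos (y : ℝ) (ω : Ω) : 0 < chaosDensity P γ Xhat ε y ω := Real.exp_pos _

namespace IsLogRegularization

lemma measurable_field (hX : IsLogRegularization P Xhat) (hε : ε ∈ Ioc (0 : ℝ) 1) :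
    Measurable fun p : Ω × ℝ => Xhat ε p.2 p.1 :=
  (measurable_uncurry_of_continuous_of_measurable (u := fun (y : ℝ) ω => Xhat ε y ω)
    (hX.continuous ε hε) (hX.measurable ε hε)).comp measurable_swap

lemma measurable_density (hX : IsLogRegularization P Xhat) (hε : ε ∈ Ioc (0 : ℝ) 1) (γ : ℝ) :
    Measurable fun p : Ω × ℝ => chaosDensity P γ Xhat ε p.2 p.1 := by
  exact Real.measurable_exp.comp (((hX.measurable_field hε).const_mul γ).sub_const _)

lemma hasMoments (hX : IsLogRegularization P Xhat) (hε : ε ∈ Ioc (0 : ℝ) 1) (y : ℝ) :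
    HasMoments (Xhat ε y) P := ((hX.gaussian ε hε).hasGaussianLaw_eval y).hasMoments

lemma cov_eq (hX : IsLogRegularization P Xhat) (hε : ε ∈ Ioc (0 : ℝ) 1) (x y : ℝ) :
    cov[Xhat ε x, Xhat ε y; P] = fieldCov P Xhat ε (x - y) := hX.stationary ε hε x y

lemma fieldCov_neg (hX : IsLogRegularization P Xhat) (hε : ε ∈ Ioc (0 : ℝ) 1) (x : ℝ) :
    fieldCov P Xhat ε (-x) = fieldCov P Xhat ε x := by
  rw [← zero_sub, ← hX.cov_eq hε, covariance_comm]; rfl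

lemma variance_eq (hX : IsLogRegularization P Xhat) (hε : ε ∈ Ioc (0 : ℝ) 1) (x : ℝ) :
    Var[Xhat ε x; P] = Var[Xhat ε 0; P] := by
  rw [← covariance_self (hX.measurable ε hε x).aemeasurable, hX.cov_eq hε, sub_self,
    ← covariance_self (hX.measurable ε hε 0).aemeasurable]
  rfl

lemma fieldCov_zero (hX : IsLogRegularization P Xhat) (hε : ε ∈ Ioc (0 : ℝ) 1) :
    fieldCov P Xhat ε 0 = Var[Xhat ε 0; P] :=
  covariance_self (hX.measurable ε hε 0).aemeasurable

lemma fieldCov_eq_integral [IsProbabilityMeasure P] (hX : IsLogRegularization P Xhat)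
    (hε : ε ∈ Ioc (0 : ℝ) 1) (x : ℝ) :
    fieldCov P Xhat ε x = ∫ ω, Xhat ε x ω * Xhat ε 0 ω ∂P := by
  rw [fieldCov, covariance_eq_sub (hX.hasMoments hε x 2 (by simp)) (hX.hasMoments hε 0 2 (by simp)),
    hX.centered ε hε, zero_mul, sub_zero]
  rfl

lemma measurable_fieldCov [IsProbabilityMeasure P] (hX : IsLogRegularization P Xhat)
    (hε : ε ∈ Ioc (0 : ℝ) 1) :
    Measurable (fieldCov P Xhat ε) := by
  have h : Measurable fun p : Ω × ℝ => Xhat ε p.2 p.1 * Xhat ε 0 p.1 :=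
    (hX.measurable_field hε).mul ((hX.measurable ε hε 0).comp measurable_fst)
  have h2 := (h.stronglyMeasurable.integral_prod_left' (μ := P)).measurable
  convert h2 using 1
  ext x
  exact hX.fieldCov_eq_integral hε x

lemma fieldCov_le [IsProbabilityMeasure P] (hX : IsLogRegularization P Xhat)
    (hε : ε ∈ Ioc (0 : ℝ) 1) (x : ℝ) :
    fieldCov P Xhat ε x ≤ Var[Xhat ε 0; P] := by
  have h1 := (hX.hasMoments hε x 2 (by simp))
  have h2 := (hX.hasMoments hε 0 2 (by simp))
  have h := variance_nonneg (fun ω => Xhat ε x ω - Xhat ε 0 ω) P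
  have h3 := variance_sub h1 h2
  change Var[fun ω => Xhat ε x ω - Xhat ε 0 ω; P] = _ at h3
  rw [h3, hX.variance_eq hε] at h
  change 0 ≤ _ - 2 * fieldCov P Xhat ε x + _ at h
  linarith

lemma density_moment [IsProbabilityMeasure P] (hX : IsLogRegularization P Xhat)
    (hε : ε ∈ Ioc (0 : ℝ) 1) (γ : ℝ) (n : ℕ) :
    ∃ B, ∀ y, Integrable (fun ω => chaosDensity P γ Xhat ε y ω ^ n) P ∧
      ∫ ω, chaosDensity P γ Xhat ε y ω ^ n ∂P = B := by
  set c := Var[Xhat ε 0; P]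
  refine ⟨Real.exp (-(n * (γ ^ 2 * c))) * Real.exp (c * (n * γ) ^ 2 / 2), fun y => ?_⟩
  have e : ∀ ω, chaosDensity P γ Xhat ε y ω ^ n =
      Real.exp (-(n * (γ ^ 2 * c))) * Real.exp ((n * γ) * Xhat ε y ω) := fun ω => by
    rw [chaosDensity, ← Real.exp_nat_mul, ← Real.exp_add]; congr 1; ring
  have h := integral_exp_gaussian ((hX.gaussian ε hε).hasGaussianLaw_eval y)
    (hX.centered ε hε y) (n * γ)
  simp only [e]
  refine ⟨h.1.const_mul _, ?_⟩
  rw [integral_const_mul, h.2, hX.variance_eq hε]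

lemma density_mul_moment [IsProbabilityMeasure P] (hX : IsLogRegularization P Xhat)
    (hε : ε ∈ Ioc (0 : ℝ) 1) (γ : ℝ)
    (n : ℕ) :
    ∃ B, ∀ y z, Integrable
        (fun ω => (chaosDensity P γ Xhat ε z ω * chaosDensity P γ Xhat ε y ω) ^ n) P ∧
      ∫ ω, (chaosDensity P γ Xhat ε z ω * chaosDensity P γ Xhat ε y ω) ^ n ∂P ≤ B := by
  obtain ⟨B, hB⟩ := hX.density_moment hε γ (2 * n)
  refine ⟨B, fun y z => ?_⟩
  have hi : Integrable (fun ω => 1 / 2 * (chaosDensity P γ Xhat ε z ω ^ (2 * n) +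
      chaosDensity P γ Xhat ε y ω ^ (2 * n))) P := ((hB z).1.add (hB y).1).const_mul _
  have hle : ∀ ω, (chaosDensity P γ Xhat ε z ω * chaosDensity P γ Xhat ε y ω) ^ n ≤
      1 / 2 * (chaosDensity P γ Xhat ε z ω ^ (2 * n) +
      chaosDensity P γ Xhat ε y ω ^ (2 * n)) := fun ω => by
    rw [mul_pow, mul_comm 2 n, pow_mul, pow_mul]
    nlinarith [sq_nonneg (chaosDensity P γ Xhat ε z ω ^ n - chaosDensity P γ Xhat ε y ω ^ n)]
  have hM := hX.measurable_density hε γ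
  have hm : ∀ y, Measurable fun ω => chaosDensity P γ Xhat ε y ω := fun y =>
    hM.comp (by fun_prop : Measurable fun ω : Ω => (ω, y))
  have h0 : ∀ ω, 0 ≤ (chaosDensity P γ Xhat ε z ω * chaosDensity P γ Xhat ε y ω) ^ n := fun ω =>
    pow_nonneg (mul_nonneg (chaosDensity_pos z ω).le (chaosDensity_pos y ω).le) n
  have hI : Integrable
      (fun ω => (chaosDensity P γ Xhat ε z ω * chaosDensity P γ Xhat ε y ω) ^ n) P :=
    hi.mono' (((hm z).mul (hm y)).pow_const n).aestronglyMeasurable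
      (Eventually.of_forall fun ω => by rw [Real.norm_of_nonneg (h0 ω)]; exact hle ω)
  refine ⟨hI, (integral_mono hI hi hle).trans (le_of_eq ?_)⟩
  rw [integral_const_mul, integral_add (hB z).1 (hB y).1, (hB z).2, (hB y).2]
  ring

/-- The Gaussian exponential moment: the diagonal terms of the variance of the exponent are
cancelled by the normalisation of `chaosDensity`. -/
lemma integral_density_three [IsProbabilityMeasure P] (hX : IsLogRegularization P Xhat)
    (hε : ε ∈ Ioc (0 : ℝ) 1)
    (γ y z w : ℝ) :
    Integrable (fun ω => (chaosDensity P γ Xhat ε y ω * chaosDensity P γ Xhat ε z ω *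
        chaosDensity P γ Xhat ε w ω) ^ 2) P ∧
      ∫ ω, (chaosDensity P γ Xhat ε y ω * chaosDensity P γ Xhat ε z ω *
        chaosDensity P γ Xhat ε w ω) ^ 2 ∂P =
      Real.exp (4 * γ ^ 2 * (fieldCov P Xhat ε (y - z) + fieldCov P Xhat ε (z - w) +
        fieldCov P Xhat ε (w - y))) := by
  set c := Var[Xhat ε 0; P] with hc
  set S : Ω → ℝ := fun ω => ∑ i, Xhat ε (![y, z, w] i) ω with hS
  have hG : HasGaussianLaw S P :=
    ((hX.gaussian ε hε).comp_right ![y, z, w]).hasGaussianLaw_fun_sum (I := Finset.univ)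
  have h0 : ∫ ω, S ω ∂P = 0 := by
    rw [hS, integral_finsetSum _ fun i _ => (hX.hasMoments hε _).integrable]
    exact Finset.sum_eq_zero fun i _ => hX.centered ε hε _
  have hV : Var[S; P] = 3 * c + 2 * (fieldCov P Xhat ε (y - z) + fieldCov P Xhat ε (z - w) +
        fieldCov P Xhat ε (w - y)) := by
    rw [← covariance_self hG.aemeasurable, hS,
      covariance_fun_sum_fun_sum (fun i => hX.hasMoments hε _ 2 (by simp))
        (fun i => hX.hasMoments hε _ 2 (by simp))]
    simp only [hX.cov_eq hε, Fin.sum_univ_three, Matrix.cons_val, sub_self]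
    rw [hX.fieldCov_zero hε, ← hc, ← neg_sub y z, ← neg_sub z w, ← neg_sub w y]
    simp only [hX.fieldCov_neg hε]
    ring
  have e : ∀ ω, (chaosDensity P γ Xhat ε y ω * chaosDensity P γ Xhat ε z ω *
        chaosDensity P γ Xhat ε w ω) ^ 2 = Real.exp (-(6 * (γ ^ 2 * c))) *
        Real.exp (2 * γ * S ω) := fun ω => by
    simp only [chaosDensity, hS, Fin.sum_univ_three, Matrix.cons_val]
    rw [← Real.exp_add, ← Real.exp_add, ← Real.exp_nat_mul, ← Real.exp_add]
    congr 1
    push_cast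
    ring
  have h := integral_exp_gaussian hG h0 (2 * γ)
  simp only [e]
  refine ⟨h.1.const_mul _, ?_⟩
  rw [integral_const_mul, h.2, hV, ← Real.exp_add]
  congr 1
  ring

end IsLogRegularization

lemma kerSym_chaosKernel (hk : ∀ x, k (-x) = -k x) (ω : Ω) (y z : ℝ) :
    kerSym (chaosKernel P γ Xhat ε D k) ω y z = k (y - z) * (D y - D z) *
      (chaosDensity P γ Xhat ε y ω * chaosDensity P γ Xhat ε z ω) := by
  simp only [kerSym, chaosKernel]
  rw [← neg_sub y z, hk]; ring

/-- As `k` is odd, `kerSym` of the kernel carries the difference `D y - D z`, so that the trace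
integrand splits into an alternating product, a Vandermonde product and squared densities. -/
lemma triForm_chaosKernel (hk : ∀ x, k (-x) = -k x) (p : Ω × ℝ × ℝ × ℝ) :
    triForm (chaosKernel P γ Xhat ε D k) p = triProd k p.2 * vandermonde D p.2 *
      (chaosDensity P γ Xhat ε p.2.1 p.1 * chaosDensity P γ Xhat ε p.2.2.1 p.1 *
        chaosDensity P γ Xhat ε p.2.2.2 p.1) ^ 2 := by
  simp only [triForm, kerSym_chaosKernel hk, triProd, vandermonde]; ring

lemma triForm_abs_chaosKernel (hk : ∀ x, k (-x) = -k x) (p : Ω × ℝ × ℝ × ℝ) :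
    triForm (fun p => |chaosKernel P γ Xhat ε D k p|) p = |triProd k p.2| * vanderBound D p.2 *
      (chaosDensity P γ Xhat ε p.2.1 p.1 * chaosDensity P γ Xhat ε p.2.2.1 p.1 *
        chaosDensity P γ Xhat ε p.2.2.2 p.1) ^ 2 := by
  have h : ∀ ω y z, kerSym (fun p => |chaosKernel P γ Xhat ε D k p|) ω y z =
      |k (y - z)| * (|D y| + |D z|) *
      (chaosDensity P γ Xhat ε y ω * chaosDensity P γ Xhat ε z ω) := fun ω y z => by
    simp only [kerSym, chaosKernel, abs_mul]
    rw [← neg_sub y z, hk, abs_neg, abs_of_pos (chaosDensity_pos y ω),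
      abs_of_pos (chaosDensity_pos z ω)]
    ring
  simp only [triForm, h, triProd, vanderBound, abs_mul]; ring

/-- The kernel `k` weighted by `exp(4γ² C(x))`, where `C` is the covariance function of the field.
It carries all that is left of the field after integration. -/
def corrKernel (P : Measure Ω) (γ : ℝ) (Xhat : ℝ → ℝ → Ω → ℝ) (k : ℝ → ℝ) (ε x : ℝ) : ℝ :=
  k x * Real.exp (4 * γ ^ 2 * fieldCov P Xhat ε x)

lemma isOddKernel_corrKernel [IsProbabilityMeasure P] (hX : IsLogRegularization P Xhat)
    (hε : ε ∈ Ioc (0 : ℝ) 1) (γ : ℝ)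
    (hk : IsOddKernel k) : IsOddKernel (corrKernel P γ Xhat k ε) where
  measurable := hk.measurable.mul
    (Real.measurable_exp.comp ((hX.measurable_fieldCov hε).const_mul _))
  odd x := by rw [corrKernel, hk.odd, hX.fieldCov_neg hε, corrKernel, neg_mul]
  bounded := by
    obtain ⟨K, hK⟩ := hk.bounded
    refine ⟨K * Real.exp (4 * γ ^ 2 * Var[Xhat ε 0; P]), fun x => ?_⟩
    rw [corrKernel, abs_mul, Real.abs_exp]
    exact mul_le_mul (hK x) (Real.exp_le_exp.2
      (mul_le_mul_of_nonneg_left (hX.fieldCov_le hε x) (by positivity))) (Real.exp_pos _).le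
      ((abs_nonneg _).trans (hK 0))
  support x hx := by rw [corrKernel, hk.support x hx, zero_mul]

lemma integrable_profile_sq_mul (hD : IsProfile D) (hk : IsOddKernel k) :
    Integrable fun q : ℝ × ℝ => D q.1 ^ 2 * k (q.1 - q.2) ^ 2 := by
  obtain ⟨K, hK, hb⟩ := hk.exists_bound
  have h1 : Integrable (fun q : ℝ × ℝ => D q.2 ^ 2 * unitInd (q.1 - q.2)) :=
    hD.integrable_sq.convolution_integrand (ContinuousLinearMap.mul ℝ ℝ) integrable_unitInd
  have h2 : Integrable (fun q : ℝ × ℝ => D q.1 ^ 2 * unitInd (q.2 - q.1)) :=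
    (Measure.measurePreserving_swap (μ := (volume : Measure ℝ))
      (ν := (volume : Measure ℝ))).integrable_comp_of_integrable h1
  have hm := hD.measurable
  have hm' := hk.measurable
  refine (h2.const_mul (K ^ 2)).mono'
    (by fun_prop : Measurable fun q : ℝ × ℝ => D q.1 ^ 2 * k (q.1 - q.2) ^ 2).aestronglyMeasurable
    (Eventually.of_forall fun q => ?_)
  rw [Real.norm_of_nonneg (by positivity), ← neg_sub q.1 q.2, unitInd_neg]
  have h3 : k (q.1 - q.2) ^ 2 ≤ K ^ 2 * unitInd (q.1 - q.2) := by
    have h0 := unitInd_nonneg (q.1 - q.2)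
    have h1 := unitInd_le_one (q.1 - q.2)
    rw [← sq_abs]
    calc _ ≤ (K * unitInd (q.1 - q.2)) ^ 2 := pow_le_pow_left₀ (abs_nonneg _) (hb _) 2
      _ = K ^ 2 * (unitInd (q.1 - q.2) * unitInd (q.1 - q.2)) := by ring
      _ ≤ K ^ 2 * unitInd (q.1 - q.2) := by gcongr; exact mul_le_of_le_one_right h0 h1
  nlinarith [mul_le_mul_of_nonneg_left h3 (sq_nonneg (D q.1))]

lemma chaosKernel_sq (p : Ω × ℝ × ℝ) : chaosKernel P γ Xhat ε D k p ^ 2 =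
    D p.2.1 ^ 2 * k (p.2.1 - p.2.2) ^ 2 *
      (chaosDensity P γ Xhat ε p.2.2 p.1 * chaosDensity P γ Xhat ε p.2.1 p.1) ^ 2 := by
  unfold chaosKernel; ring

/-- The kernel of the field is regular: its norms are controlled by the exponential moments of the
field, which are uniform in space by stationarity. -/
lemma isRegularKernel_chaosKernel [IsProbabilityMeasure P] (hX : IsLogRegularization P Xhat)
    (hε : ε ∈ Ioc (0 : ℝ) 1)
    (γ : ℝ) (hD : IsProfile D) (hk : IsOddKernel k) (hkc : ∀ᵐ x, ContinuousAt k x) :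
    IsRegularKernel (fieldSigma Xhat ε) P (chaosKernel P γ Xhat ε D k) := by
  have hM := hX.measurable_density hε γ
  have hDm := hD.measurable
  have hkm := hk.measurable
  have hM1 : Measurable fun p : Ω × ℝ × ℝ => chaosDensity P γ Xhat ε p.2.1 p.1 :=
    hM.comp (by fun_prop : Measurable fun p : Ω × ℝ × ℝ => (p.1, p.2.1))
  have hM2 : Measurable fun p : Ω × ℝ × ℝ => chaosDensity P γ Xhat ε p.2.2 p.1 :=
    hM.comp (by fun_prop : Measurable fun p : Ω × ℝ × ℝ => (p.1, p.2.2))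
  have hmeas : Measurable (chaosKernel P γ Xhat ε D k) := by
    unfold chaosKernel; fun_prop
  have hρ := integrable_profile_sq_mul hD hk
  have hρm : Measurable fun q : ℝ × ℝ => D q.1 ^ 2 * k (q.1 - q.2) ^ 2 := by fun_prop
  have hρ0 : ∀ q : ℝ × ℝ, 0 ≤ D q.1 ^ 2 * k (q.1 - q.2) ^ 2 := fun q => by positivity
  have hint : ∀ n : ℕ, Integrable (fun p : Ω × ℝ × ℝ => D p.2.1 ^ 2 * k (p.2.1 - p.2.2) ^ 2 *
      (chaosDensity P γ Xhat ε p.2.2 p.1 * chaosDensity P γ Xhat ε p.2.1 p.1) ^ n)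
      (kerMeasure P) := fun n => by
    obtain ⟨B, hB⟩ := hX.density_mul_moment hε γ n
    exact integrable_mul_of_integral_le (ρ := fun q : ℝ × ℝ => D q.1 ^ 2 * k (q.1 - q.2) ^ 2)
      (f := fun p : Ω × ℝ × ℝ => (chaosDensity P γ Xhat ε p.2.2 p.1 *
        chaosDensity P γ Xhat ε p.2.1 p.1) ^ n) hρ hρm hρ0 (by fun_prop)
      (fun p => pow_nonneg (mul_nonneg (chaosDensity_pos _ _).le (chaosDensity_pos _ _).le) n)
      (fun q => (hB q.1 q.2).1) (fun q => (hB q.1 q.2).2)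
  refine ⟨fun y z => ?_, hmeas, ?_, ?_, ?_, ?_⟩
  · exact ((measurable_exp_field Xhat γ _ ε z).const_mul (D y * k (y - z))).mul
      (measurable_exp_field Xhat γ _ ε y)
  · filter_upwards [(Measure.quasiMeasurePreserving_fst (μ := (volume : Measure ℝ))
      (ν := (volume : Measure ℝ))).ae hD.continuousAt,
      (quasiMeasurePreserving_sub (volume : Measure ℝ) (volume : Measure ℝ)).ae hkc]
      with q h1 h2 ω
    have hc : ∀ {f : ℝ × ℝ → ℝ}, Continuous f → Continuous fun q =>
        chaosDensity P γ Xhat ε (f q) ω := fun {f} hf => by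
      exact Real.continuous_exp.comp
        ((((hX.continuous ε hε ω).comp hf).const_mul γ).sub continuous_const)
    have c1 : ContinuousAt (fun q : ℝ × ℝ => D q.1) q :=
      ContinuousAt.comp (f := fun q : ℝ × ℝ => q.1) h1 continuousAt_fst
    have c2 : ContinuousAt (fun q : ℝ × ℝ => k (q.1 - q.2)) q :=
      ContinuousAt.comp (f := fun q : ℝ × ℝ => q.1 - q.2) h2 (by fun_prop)
    exact ((c1.mul c2).mul (hc continuous_snd).continuousAt).mul (hc continuous_fst).continuousAt
  · rw [memLp_two_iff_integrable_sq hmeas.aestronglyMeasurable]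
    simp only [chaosKernel_sq]
    exact hint 2
  · have h4 := (hint 4).integral_prod_left
    refine (h4.const_mul ((∫ q : ℝ × ℝ, D q.1 ^ 2 * k (q.1 - q.2) ^ 2) + 1)).mono'
      ((measurable_sqNorm hmeas).pow_const 2).aestronglyMeasurable ?_
    filter_upwards [(hint 2).prod_right_ae, (hint 4).prod_right_ae] with ω h2 h4
    rw [Real.norm_of_nonneg (sq_nonneg _), sqNorm]
    simp only [chaosKernel_sq]
    have h4' : Integrable (fun q : ℝ × ℝ => D q.1 ^ 2 * k (q.1 - q.2) ^ 2 *
      ((chaosDensity P γ Xhat ε q.2 ω * chaosDensity P γ Xhat ε q.1 ω) ^ 2) ^ 2) := by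
      simp only [← pow_mul]
      exact h4
    refine (sq_integral_mul_le hρ0 hρ h2 h4').trans (le_of_eq ?_)
    simp only [← pow_mul]
    rfl
  · obtain ⟨K, hK, hb⟩ := hk.exists_bound
    have hV := hD.integrable_triProd_vanderBound
    have hM3 : Measurable fun p : Ω × ℝ × ℝ × ℝ => (chaosDensity P γ Xhat ε p.2.1 p.1 *
        chaosDensity P γ Xhat ε p.2.2.1 p.1 * chaosDensity P γ Xhat ε p.2.2.2 p.1) ^ 2 :=
      (((hM.comp (by fun_prop : Measurable fun p : Ω × ℝ × ℝ × ℝ => (p.1, p.2.1))).mul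
        (hM.comp (by fun_prop : Measurable fun p : Ω × ℝ × ℝ × ℝ => (p.1, p.2.2.1)))).mul
        (hM.comp (by fun_prop : Measurable fun p : Ω × ℝ × ℝ × ℝ => (p.1, p.2.2.2)))).pow_const 2
    have hVk : Integrable fun t : ℝ × ℝ × ℝ => |triProd k t| * vanderBound D t := by
      refine (hV.const_mul (K ^ 3)).mono' (((measurable_triProd hkm).abs).mul
        (measurable_vanderBound hDm)).aestronglyMeasurable (Eventually.of_forall fun t => ?_)
      rw [Real.norm_of_nonneg (mul_nonneg (abs_nonneg _) (vanderBound_nonneg D t)), ← mul_assoc]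
      exact mul_le_mul_of_nonneg_right (abs_triProd_le hK hb t) (vanderBound_nonneg D t)
    have h := integrable_mul_of_integral_le (P := P) (B := Real.exp (4 * γ ^ 2 *
        (Var[Xhat ε 0; P] + Var[Xhat ε 0; P] + Var[Xhat ε 0; P]))) hVk
      (((measurable_triProd hkm).abs).mul (measurable_vanderBound hDm))
      (fun t => mul_nonneg (abs_nonneg _) (vanderBound_nonneg D t)) hM3 (fun p => sq_nonneg _)
      (fun t => (hX.integral_density_three hε γ t.1 t.2.1 t.2.2).1) (fun t => by
        refine (hX.integral_density_three hε γ t.1 t.2.1 t.2.2).2.le.trans (Real.exp_le_exp.2 ?_)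
        have := hX.fieldCov_le hε
        gcongr <;> exact this _)
    exact h.congr (Eventually.of_forall fun p => (triForm_abs_chaosKernel hk.odd p).symm)

lemma integral_triForm_chaosKernel [IsProbabilityMeasure P] (hX : IsLogRegularization P Xhat)
    (hε : ε ∈ Ioc (0 : ℝ) 1)
    (γ : ℝ) (hD : IsProfile D) (hk : IsOddKernel k) (hkc : ∀ᵐ x, ContinuousAt k x) :
    ∫ p, triForm (chaosKernel P γ Xhat ε D k) p ∂(triMeasure P) =
      6 * ∫ h, corrKernel P γ Xhat k ε h * selfConv (corrKernel P γ Xhat k ε) h *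
        cubicCorr D h := by
  have hR := isRegularKernel_chaosKernel hX hε γ hD hk hkc
  rw [← (isOddKernel_corrKernel hX hε γ hk).integral_triProd_vandermonde hD]
  have hi : Integrable (triForm (chaosKernel P γ Xhat ε D k)) (triMeasure P) := by
    refine hR.integrable_triForm.mono' (measurable_triForm hR.measurable).aestronglyMeasurable
      (Eventually.of_forall fun p => ?_)
    rw [triForm_chaosKernel hk.odd, triForm_abs_chaosKernel hk.odd, Real.norm_eq_abs, abs_mul,
      abs_mul, abs_of_nonneg (sq_nonneg (_ : ℝ))]
    gcongr
    exact abs_vandermonde_le D p.2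
  have hi' := hi
  rw [triMeasure] at hi'
  rw [triMeasure, integral_prod_symm _ hi']
  refine integral_congr_ae (Eventually.of_forall fun t => ?_)
  simp only [triForm_chaosKernel hk.odd]
  rw [integral_const_mul, (hX.integral_density_three hε γ t.1 t.2.1 t.2.2).2]
  simp only [triProd, corrKernel, mul_add, Real.exp_add]
  ring

end Chaos

/-! ### The field as a weighted kernel -/

section Field

lemma integrable_of_even {f : ℝ → ℝ} (hf : ∀ x, f (-x) = f x) (h : IntegrableOn f (Ioi 0)) :
    Integrable f := by
  have h1 : IntegrableOn f (Iio 0) := by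
    have h2 := (Measure.measurePreserving_neg (volume : Measure ℝ)).integrableOn_comp_preimage
      (Homeomorph.neg ℝ).measurableEmbedding (f := f) (s := Ioi 0)
    have h3 : (Neg.neg ⁻¹' Ioi (0 : ℝ) : Set ℝ) = Iio 0 := by ext; simp
    have h4 : f ∘ Neg.neg = f := funext hf
    rw [h3, h4] at h2
    exact h2.2 h
  rw [← integrableOn_univ, ← Iic_union_Ioi (a := (0 : ℝ))]
  refine IntegrableOn.union ?_ h
  rw [integrableOn_Iic_iff_integrableOn_Iio]
  exact h1

lemma integrable_rpow_mul {s p : ℝ} (hs : -1 < s) (hp : s + 1 < p) :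
    Integrable fun u : ℝ => |u| ^ s * (1 + |u|) ^ (-p) := by
  have hm : Measurable fun u : ℝ => |u| ^ s * (1 + |u|) ^ (-p) := by fun_prop
  refine integrable_of_even (fun x => by rw [abs_neg]) ?_
  rw [← Ioc_union_Ioi_eq_Ioi (zero_le_one' ℝ)]
  refine IntegrableOn.union ?_ ?_
  · have h1 : IntegrableOn (fun u : ℝ => u ^ s) (Ioc 0 1) := by
      rw [← intervalIntegrable_iff_integrableOn_Ioc_of_le zero_le_one]
      exact intervalIntegral.intervalIntegrable_rpow' hs
    refine h1.mono' hm.aestronglyMeasurable ?_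
    refine (ae_restrict_iff' measurableSet_Ioc).2 (Eventually.of_forall fun u hu => ?_)
    rw [Real.norm_of_nonneg (by positivity), abs_of_pos hu.1]
    exact mul_le_of_le_one_right (Real.rpow_nonneg hu.1.le _)
      (Real.rpow_le_one_of_one_le_of_nonpos (by linarith [hu.1]) (by linarith))
  · have h1 : IntegrableOn (fun u : ℝ => u ^ (s - p)) (Ioi 1) :=
      integrableOn_Ioi_rpow_of_lt (by linarith) one_pos
    refine h1.mono' hm.aestronglyMeasurable ?_
    refine (ae_restrict_iff' measurableSet_Ioi).2 (Eventually.of_forall fun u hu => ?_)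
    have hu0 : 0 < u := one_pos.trans hu
    rw [Real.norm_of_nonneg (by positivity), abs_of_pos hu0, sub_eq_add_neg,
      Real.rpow_add hu0]
    gcongr ?_ * ?_
    exact Real.rpow_le_rpow_of_nonpos hu0 (by linarith) (by linarith)

lemma schwartz_bound (φ : SchwartzMap ℝ ℝ) (n : ℕ) :
    ∃ C, 0 < C ∧ ∀ x, |φ x| ≤ C * (1 + |x|) ^ (-(n : ℝ)) := by
  refine ⟨2 ^ n * (Finset.Iic (n, 0)).sup (fun m => SchwartzMap.seminorm ℝ m.1 m.2) φ + 1,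
    by positivity, fun x => ?_⟩
  have h := SchwartzMap.one_add_le_sup_seminorm_apply (𝕜 := ℝ) (m := (n, 0)) le_rfl le_rfl φ x
  rw [norm_iteratedFDeriv_zero, Real.norm_eq_abs, Real.norm_eq_abs] at h
  rw [Real.rpow_neg (by positivity), Real.rpow_natCast, ← div_eq_mul_inv,
    le_div_iff₀ (by positivity), mul_comm]
  simp only at h
  linarith

variable {H : ℝ}

lemma bigPhi_eq (H : ℝ) (φ : ℝ → ℝ) (x : ℝ) : bigPhi H φ x = φ x * |x| ^ (H - 1 / 2) := by
  rw [bigPhi, one_div, ← Real.rpow_neg (abs_nonneg x), neg_sub]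

lemma isProfile_bigPhi (hH : H ∈ Ioo (0 : ℝ) 1) (φ : SchwartzMap ℝ ℝ) : IsProfile (bigPhi H φ) := by
  have hm : Measurable (bigPhi H φ) := by
    have := φ.continuous.measurable
    unfold bigPhi; fun_prop
  obtain ⟨C, hC, hφ⟩ := schwartz_bound φ 2
  have hb : ∀ x, |bigPhi H φ x| ≤ C * (|x| ^ (H - 1 / 2) * (1 + |x|) ^ (-(2 : ℝ))) := fun x => by
    have := hφ x
    push_cast at this
    rw [bigPhi_eq, abs_mul, abs_of_nonneg (Real.rpow_nonneg (abs_nonneg x) _)]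
    calc _ ≤ C * (1 + |x|) ^ (-(2 : ℝ)) * |x| ^ (H - 1 / 2) := by gcongr
      _ = _ := by ring
  refine ⟨hm, ?_, ?_, ?_⟩
  · exact ((integrable_rpow_mul (by linarith [hH.1]) (by linarith [hH.2])).const_mul C).mono'
      hm.aestronglyMeasurable (Eventually.of_forall hb)
  · refine ((integrable_rpow_mul (s := 2 * (H - 1 / 2)) (p := 4) (by linarith [hH.1])
      (by linarith [hH.2])).const_mul (C ^ 2)).mono' (hm.pow_const 2).aestronglyMeasurable
      (Eventually.of_forall fun x => ?_)
    rw [Real.norm_of_nonneg (sq_nonneg _), ← sq_abs]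
    refine (pow_le_pow_left₀ (abs_nonneg _) (hb x) 2).trans (le_of_eq ?_)
    rw [mul_pow, mul_pow, ← Real.rpow_mul_natCast (abs_nonneg x),
      ← Real.rpow_mul_natCast (by positivity)]
    norm_num [mul_comm]
  · filter_upwards [(by simp [ae_iff] : ∀ᵐ x : ℝ, x ≠ 0)] with x hx
    have e : bigPhi H φ = fun x => φ x * |x| ^ (H - 1 / 2) := funext (bigPhi_eq H φ)
    rw [e]
    exact φ.continuous.continuousAt.mul
      (continuous_abs.continuousAt.rpow_const (Or.inl (abs_ne_zero.2 hx)))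

lemma IsProfile.comp_sub {D : ℝ → ℝ} (hD : IsProfile D) (x : ℝ) : IsProfile fun y => D (x - y) where
  measurable := hD.measurable.comp (measurable_const.sub measurable_id)
  integrable := hD.integrable.comp_sub_left x
  integrable_sq := hD.integrable_sq.comp_sub_left x
  continuousAt := by
    have h := (Measure.measurePreserving_sub_left (volume : Measure ℝ) x).quasiMeasurePreserving.ae
      hD.continuousAt
    filter_upwards [h] with y hy
    exact ContinuousAt.comp (f := fun y => x - y) hy (by fun_prop)

lemma IsProfile.sub {D D' : ℝ → ℝ} (hD : IsProfile D) (hD' : IsProfile D') :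
    IsProfile fun y => D y - D' y where
  measurable := hD.measurable.sub hD'.measurable
  integrable := hD.integrable.sub hD'.integrable
  integrable_sq := by
    have h := hD.measurable
    have h' := hD'.measurable
    refine ((hD.integrable_sq.add hD'.integrable_sq).const_mul 2).mono'
      (by fun_prop : Measurable fun y => (D y - D' y) ^ 2).aestronglyMeasurable
      (Eventually.of_forall fun y => ?_)
    rw [Real.norm_of_nonneg (sq_nonneg _), Pi.add_apply]
    nlinarith [sq_nonneg (D y + D' y)]
  continuousAt := by
    filter_upwards [hD.continuousAt, hD'.continuousAt] with y h h'
    exact h.sub h'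

variable {N : ℝ → ℝ → ℝ} {ε : ℝ}

lemma IsRegularizedNorm.isOddKernel (hN : IsRegularizedNorm N) (hε : ε ∈ Ioc (0 : ℝ) 1) :
    IsOddKernel (kEps N ε) := by
  have hc : Continuous fun x => x / N ε x ^ (3 / 2 : ℝ) :=
    continuous_id.div ((hN.continuous ε hε).rpow_const fun x => Or.inl (hN.pos ε hε x).ne')
      fun x => (Real.rpow_pos_of_pos (hN.pos ε hε x) _).ne'
  refine ⟨?_, fun x => ?_, ?_, fun x hx => by rw [kEps, if_neg (not_le.2 hx)]⟩
  · exact Measurable.ite (measurableSet_le continuous_abs.measurable measurable_const)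
      hc.measurable measurable_const
  · simp only [kEps, abs_neg, hN.even ε hε]
    split_ifs
    · rw [neg_div]
    · rw [neg_zero]
  · obtain ⟨K, hK⟩ := (isCompact_Icc (a := (-1 : ℝ)) (b := 1)).exists_bound_of_continuousOn
      hc.continuousOn
    refine ⟨max K 0, fun x => ?_⟩
    simp only [kEps]
    split_ifs with h
    · exact (hK x (abs_le.1 h)).trans (le_max_left _ _)
    · rw [abs_zero]; exact le_max_right _ _

lemma IsRegularizedNorm.ae_continuousAt (hN : IsRegularizedNorm N) (hε : ε ∈ Ioc (0 : ℝ) 1) :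
    ∀ᵐ x, ContinuousAt (kEps N ε) x := by
  have hc : Continuous fun x => x / N ε x ^ (3 / 2 : ℝ) :=
    continuous_id.div ((hN.continuous ε hε).rpow_const fun x => Or.inl (hN.pos ε hε x).ne')
      fun x => (Real.rpow_pos_of_pos (hN.pos ε hε x) _).ne'
  filter_upwards [(by simp [ae_iff] : ∀ᵐ x : ℝ, x ≠ 1), (by simp [ae_iff] : ∀ᵐ x : ℝ, x ≠ -1)]
    with x h1 h2
  have h3 : |x| ≠ 1 := fun h => by
    rcases abs_choice x with h' | h'
    · exact h1 (by rw [← h, h'])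
    · exact h2 (by rw [← h, h', neg_neg])
  rcases lt_or_gt_of_ne h3 with h | h
  · refine hc.continuousAt.congr ?_
    filter_upwards [continuous_abs.continuousAt.eventually_lt continuousAt_const h] with y hy
    rw [kEps, if_pos (le_of_lt hy)]
  · refine (continuousAt_const (y := (0 : ℝ))).congr ?_
    filter_upwards [continuousAt_const.eventually_lt continuous_abs.continuousAt h] with y hy
    rw [kEps, if_neg (not_le.2 hy)]

/-- The increment in `x` of the function `y ↦ ϕ(x - y)`. -/
def phiIncr (H : ℝ) (φ : ℝ → ℝ) (x x' y : ℝ) : ℝ := bigPhi H φ (x - y) - bigPhi H φ (x' - y)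

lemma isProfile_phiIncr (hH : H ∈ Ioo (0 : ℝ) 1) (φ : SchwartzMap ℝ ℝ) (x x' : ℝ) :
    IsProfile (phiIncr H φ x x') :=
  ((isProfile_bigPhi hH φ).comp_sub x).sub ((isProfile_bigPhi hH φ).comp_sub x')

variable {Ω : Type*} [MeasurableSpace Ω] {P : Measure Ω} {γ : ℝ} {Xhat : ℝ → ℝ → Ω → ℝ}
  {W : FinSet → Ω → ℝ}

lemma IsLogRegularization.fieldSigma_le (hX : IsLogRegularization P Xhat)
    (hε : ε ∈ Ioc (0 : ℝ) 1) : fieldSigma Xhat ε ≤ ‹MeasurableSpace Ω› :=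
  (measurable_pi_lambda (fun ω x => Xhat ε x ω) (hX.measurable ε hε)).comap_le

variable [IsProbabilityMeasure P]

/-- The double integral defining `u_ε(x)` exists. -/
theorem isDoubleIntegral_uEps (hX : IsLogRegularization P Xhat) (hε : ε ∈ Ioc (0 : ℝ) 1)
    (hH : H ∈ Ioo (0 : ℝ) 1) (φ : SchwartzMap ℝ ℝ) (hN : IsRegularizedNorm N)
    (hW : IsWhiteNoise P W)
    (hXW : IndepFun (fun ω x => Xhat ε x ω) (fun ω A => W A ω) P) (γ x : ℝ) :
    IsDoubleIntegral (fieldSigma Xhat ε) P W (fieldKernel P γ H φ N Xhat ε x)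
      (uEps P γ H φ N W Xhat ε x) := by
  have hind : Indep (fieldSigma Xhat ε) (noiseSigma W) P := (IndepFun_iff_Indep _ _ _).1 hXW
  have hR := isRegularKernel_chaosKernel hX hε γ ((isProfile_bigPhi hH φ).comp_sub x)
    (hN.isOddKernel hε) (hN.ae_continuousAt hε)
  have h : ∃ U, IsDoubleIntegral (fieldSigma Xhat ε) P W (fieldKernel P γ H φ N Xhat ε x) U :=
    hR.exists_isDoubleIntegral (hX.fieldSigma_le hε) hW hind
  rw [uEps, doubleIntegral, dif_pos h]
  exact h.choose_spec

/-- The third moment of the increments of `u_ε`. -/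
theorem integral_uEps_sub_cube (hX : IsLogRegularization P Xhat) (hε : ε ∈ Ioc (0 : ℝ) 1)
    (hH : H ∈ Ioo (0 : ℝ) 1) (φ : SchwartzMap ℝ ℝ) (hN : IsRegularizedNorm N)
    (hW : IsWhiteNoise P W)
    (hXW : IndepFun (fun ω x => Xhat ε x ω) (fun ω A => W A ω) P) (γ x x' : ℝ) :
    Integrable (fun ω => (uEps P γ H φ N W Xhat ε x ω - uEps P γ H φ N W Xhat ε x' ω) ^ 3) P ∧
      ∫ ω, (uEps P γ H φ N W Xhat ε x ω - uEps P γ H φ N W Xhat ε x' ω) ^ 3 ∂P =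
        6 * ∫ h, corrKernel P γ Xhat (kEps N ε) ε h *
          selfConv (corrKernel P γ Xhat (kEps N ε) ε) h * cubicCorr (phiIncr H φ x x') h := by
  have hind : Indep (fieldSigma Xhat ε) (noiseSigma W) P := (IndepFun_iff_Indep _ _ _).1 hXW
  have hk := hN.isOddKernel hε
  have hkc := hN.ae_continuousAt hε
  have hR := fun x => isRegularKernel_chaosKernel hX hε γ ((isProfile_bigPhi hH φ).comp_sub x)
    hk hkc
  have hI := isRegularKernel_chaosKernel hX hε γ (isProfile_phiIncr hH φ x x') hk hkc
  have hU : IsDoubleIntegral (fieldSigma Xhat ε) P W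
      (chaosKernel P γ Xhat ε (fun y => bigPhi H φ (x - y)) (kEps N ε) -
        chaosKernel P γ Xhat ε (fun y => bigPhi H φ (x' - y)) (kEps N ε)) _ :=
          (isDoubleIntegral_uEps hX hε hH φ hN hW hXW γ x).sub (hX.fieldSigma_le hε) hW
    (hR x).measurable.aestronglyMeasurable (hR x').measurable.aestronglyMeasurable
    (isDoubleIntegral_uEps hX hε hH φ hN hW hXW γ x')
  have e : chaosKernel P γ Xhat ε (fun y => bigPhi H φ (x - y)) (kEps N ε) -
      chaosKernel P γ Xhat ε (fun y => bigPhi H φ (x' - y)) (kEps N ε) =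
      chaosKernel P γ Xhat ε (phiIncr H φ x x') (kEps N ε) := by
    ext p
    simp only [Pi.sub_apply, chaosKernel, phiIncr]
    ring
  rw [e] at hU
  have h := hI.integral_cube (hX.fieldSigma_le hε) hW hind hU
  rw [integral_triForm_chaosKernel hX hε γ (isProfile_phiIncr hH φ x x') hk hkc] at h
  exact h

end Field

/-! ### Functions comparable to a power -/

section PowerLike

/-- An even function whose increments are controlled, up to the constant `C`, by those of a typical
function of size `|u| ^ α`: between points of comparable moduli they are small in proportion to the
relative distance. If `α ≠ 0` then `|0| ^ α = 0` by convention, even for `α < 0`, and the condition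
with `v = 0` is the bound `|ψ u - ψ 0| ≤ C |u| ^ α`. -/
structure IsPowerLike (C α : ℝ) (ψ : ℝ → ℝ) : Prop where
  measurable : Measurable ψ
  even : ∀ u, ψ (-u) = ψ u
  sub_le : ∀ u v, |ψ u - ψ v| ≤ C * (|(|u| - |v|)| / (|u| + |v|) * (|u| ^ α + |v| ^ α))

/-- `φ(l u) |u| ^ α`, which is `|u| ^ α` seen through a cut-off at scale `1 / l`. -/
def scaledPower (φ : ℝ → ℝ) (α l u : ℝ) : ℝ := φ (l * u) * |u| ^ α

lemma rpow_le_add {α q p u : ℝ} (hq : 0 < q) (hqu : q ≤ u) (hup : u ≤ p) :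
    u ^ α ≤ p ^ α + q ^ α := by
  have hu := hq.trans_le hqu
  have h1 := Real.rpow_nonneg hq.le α
  have h2 := Real.rpow_nonneg (hu.le.trans hup) α
  rcases le_total 0 α with h | h
  · linarith [Real.rpow_le_rpow hu.le hup h]
  · linarith [Real.rpow_le_rpow_of_nonpos hq hqu h]

lemma exists_deriv_bound (φ : SchwartzMap ℝ ℝ) :
    ∃ C, 0 ≤ C ∧ (∀ x, |φ x| ≤ C) ∧ ∀ x, |x * deriv φ x| ≤ C := by
  obtain ⟨C, hC, h⟩ := φ.decay 0 0
  obtain ⟨C', hC', h'⟩ := φ.decay 1 1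
  refine ⟨max C C', hC.le.trans (le_max_left _ _), fun x => ?_, fun x => ?_⟩
  · have := h x
    rw [pow_zero, one_mul, norm_iteratedFDeriv_zero] at this
    exact this.trans (le_max_left _ _)
  · have := h' x
    rw [norm_iteratedFDeriv_eq_norm_iteratedDeriv, iteratedDeriv_one, pow_one, ← norm_mul] at this
    exact this.trans (le_max_right _ _)

/-- If `q ≤ p / 2` the increment is bounded by the values; otherwise the mean value inequality
applies, the derivative being of order `u ^ (α - 1)` uniformly in `l` because `x φ'(x)` is
bounded. -/
lemma abs_scaledPower_sub_le {φ : SchwartzMap ℝ ℝ} {C α : ℝ} (hC : 0 ≤ C) (h0 : ∀ x, |φ x| ≤ C)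
    (h1 : ∀ x, |x * deriv φ x| ≤ C) (hα : |α| ≤ 1) (hα0 : α ≠ 0) (l : ℝ) {p q : ℝ}
    (hq : 0 ≤ q) (hqp : q ≤ p) :
    |scaledPower φ α l p - scaledPower φ α l q| ≤
      6 * C * ((p - q) / (p + q) * (p ^ α + q ^ α)) := by
  have hp : 0 ≤ p := hq.trans hqp
  have hpα := Real.rpow_nonneg hp α
  have hqα := Real.rpow_nonneg hq α
  have htriv : |scaledPower φ α l p - scaledPower φ α l q| ≤ C * (p ^ α + q ^ α) := by
    unfold scaledPower
    rw [abs_of_nonneg hp, abs_of_nonneg hq, mul_add]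
    refine (abs_sub _ _).trans (add_le_add ?_ ?_)
    · rw [abs_mul, abs_of_nonneg hpα]; exact mul_le_mul_of_nonneg_right (h0 _) hpα
    · rw [abs_mul, abs_of_nonneg hqα]; exact mul_le_mul_of_nonneg_right (h0 _) hqα
  rcases eq_or_lt_of_le hp with rfl | hp'
  · have : q = 0 := le_antisymm hqp hq
    subst this
    simp [Real.zero_rpow hα0]
  rcases le_or_gt q (p / 2) with hq2 | hq2
  · refine htriv.trans ?_
    have hr : 1 / 3 ≤ (p - q) / (p + q) := by
      rw [div_le_div_iff₀ (by norm_num) (by linarith)]; linarith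
    calc C * (p ^ α + q ^ α) ≤ 3 * C * (1 / 3 * (p ^ α + q ^ α)) := by linarith
      _ ≤ 6 * C * ((p - q) / (p + q) * (p ^ α + q ^ α)) := by gcongr; norm_num
  · have hq' : 0 < q := by linarith
    have hd : ∀ u ∈ Icc q p, HasDerivWithinAt (fun u => φ (l * u) * u ^ α)
        (l * deriv φ (l * u) * u ^ α + φ (l * u) * (α * u ^ (α - 1))) (Icc q p) u := by
      intro u hu
      have hu0 : 0 < u := hq'.trans_le hu.1
      have d1 : HasDerivAt (fun u => φ (l * u)) (l * deriv φ (l * u)) u := by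
        have h : HasDerivAt (fun u => φ (l * u)) (deriv φ (l * u) * (l * 1)) u :=
          (φ.differentiableAt (x := l * u)).hasDerivAt.comp u ((hasDerivAt_id u).const_mul l)
        convert h using 1
        ring
      have d2 := Real.hasDerivAt_rpow_const (x := u) (p := α) (Or.inl hu0.ne')
      exact (d1.mul d2).hasDerivWithinAt
    have hb : ∀ u ∈ Icc q p,
        ‖l * deriv φ (l * u) * u ^ α + φ (l * u) * (α * u ^ (α - 1))‖ ≤
          2 * C * ((p ^ α + q ^ α) / q) := by
      intro u hu
      have hu0 : 0 < u := hq'.trans_le hu.1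
      have hlu := h1 (l * u)
      have e : l * deriv φ (l * u) * u ^ α + φ (l * u) * (α * u ^ (α - 1)) =
          (l * u * deriv φ (l * u) + φ (l * u) * α) * (u ^ α / u) := by
        rw [Real.rpow_sub_one hu0.ne']; field_simp
      have hub : u ^ α / u ≤ (p ^ α + q ^ α) / q :=
        div_le_div₀ (by positivity) (rpow_le_add hq' hu.1 hu.2) hq' hu.1
      have hc : |l * u * deriv φ (l * u) + φ (l * u) * α| ≤ 2 * C := by
        refine (abs_add_le _ _).trans ?_
        have : |φ (l * u) * α| ≤ C := by
          rw [abs_mul]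
          exact (mul_le_mul (h0 _) hα (abs_nonneg _) hC).trans (by rw [mul_one])
        linarith
      rw [e, norm_mul, Real.norm_eq_abs, Real.norm_of_nonneg (by positivity)]
      exact mul_le_mul hc hub (by positivity) (by positivity)
    have h := (convex_Icc q p).norm_image_sub_le_of_norm_hasDerivWithin_le hd hb
      (left_mem_Icc.2 hqp) (right_mem_Icc.2 hqp)
    unfold scaledPower
    rw [abs_of_nonneg hp, abs_of_nonneg hq]
    refine h.trans ?_
    rw [Real.norm_of_nonneg (sub_nonneg.2 hqp)]
    have hr : 1 / q ≤ 3 / (p + q) := by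
      rw [div_le_div_iff₀ hq' (by linarith)]; linarith
    calc 2 * C * ((p ^ α + q ^ α) / q) * (p - q) =
          2 * C * ((p ^ α + q ^ α) * (p - q)) * (1 / q) := by ring
      _ ≤ 2 * C * ((p ^ α + q ^ α) * (p - q)) * (3 / (p + q)) := by
          have := sub_nonneg.2 hqp
          gcongr
      _ = _ := by ring

/-- The cut-off powers vary like the power, uniformly in the scale of the cut-off. -/
lemma exists_isPowerLike (φ : SchwartzMap ℝ ℝ) (hφ : ∀ x, φ (-x) = φ x) {α : ℝ} (hα : |α| ≤ 1)
    (hα0 : α ≠ 0) : ∃ C, 0 ≤ C ∧ ∀ l, IsPowerLike C α (scaledPower φ α l) := by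
  obtain ⟨C, hC, h0, h1⟩ := exists_deriv_bound φ
  have hev : ∀ l u, scaledPower φ α l (-u) = scaledPower φ α l u := fun l u => by
    simp only [scaledPower, mul_neg, hφ, abs_neg]
  have habs : ∀ l u, scaledPower φ α l |u| = scaledPower φ α l u := fun l u => by
    rcases abs_choice u with h | h <;> rw [h]
    exact hev l u
  refine ⟨6 * C, by positivity, fun l => ⟨?_, hev l, fun u v => ?_⟩⟩
  · have := φ.continuous.measurable
    unfold scaledPower; fun_prop
  · rw [← habs l u, ← habs l v]
    rcases le_total |v| |u| with h | h
    · rw [abs_of_nonneg (sub_nonneg.2 h)]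
      exact abs_scaledPower_sub_le hC h0 h1 hα hα0 l (abs_nonneg _) h
    · rw [abs_sub_comm, abs_sub_comm |u|, abs_of_nonneg (sub_nonneg.2 h), add_comm |u|,
        add_comm (|u| ^ α)]
      exact abs_scaledPower_sub_le hC h0 h1 hα hα0 l (abs_nonneg _) h

/-- The increment of `ψ` on the unit interval centred at `x`. -/
def incr (ψ : ℝ → ℝ) (x : ℝ) : ℝ := ψ (x + 1 / 2) - ψ (x - 1 / 2)

/-- The correlation of the increments of `ψ` with their squares. -/
def incrCorr (ψ : ℝ → ℝ) (h : ℝ) : ℝ := ∫ x, incr ψ x * incr ψ (x + h) ^ 2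

/-- The square integrable function which bounds the increments of functions that vary like
`|u| ^ α`. -/
def incrBound (α x : ℝ) : ℝ := (|x + 1 / 2| ^ α + |x - 1 / 2| ^ α) * (1 + |x|) ^ (-(1 : ℝ))

/-- The bound of `incrCorr ψ`, up to a constant, for functions `ψ` which vary like `|u| ^ α`. -/
def corrBound (α h : ℝ) : ℝ := ∫ x, incrBound α x * incrBound α (x + h) ^ 2

lemma incrBound_nonneg (α x : ℝ) : 0 ≤ incrBound α x := by unfold incrBound; positivity

lemma measurable_incrBound (α : ℝ) : Measurable (incrBound α) := by unfold incrBound; fun_prop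

lemma IsPowerLike.abs_incr_le {C α : ℝ} {ψ : ℝ → ℝ} (hψ : IsPowerLike C α ψ) (hC : 0 ≤ C) (x : ℝ) :
    |incr ψ x| ≤ 2 * C * incrBound α x := by
  refine (hψ.sub_le _ _).trans ?_
  have h1 : |(|x + 1 / 2| - |x - 1 / 2|)| ≤ 1 := by
    refine (abs_abs_sub_abs_le _ _).trans (le_of_eq ?_)
    rw [show x + 1 / 2 - (x - 1 / 2) = 1 by ring, abs_one]
  have h2 : 1 ≤ |x + 1 / 2| + |x - 1 / 2| := by
    have := abs_sub (x + 1 / 2) (x - 1 / 2)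
    rwa [show x + 1 / 2 - (x - 1 / 2) = 1 by ring, abs_one] at this
  have h3 : 2 * |x| ≤ |x + 1 / 2| + |x - 1 / 2| := by
    have := abs_add_le (x + 1 / 2) (x - 1 / 2)
    rwa [show x + 1 / 2 + (x - 1 / 2) = 2 * x by ring, abs_mul, abs_two] at this
  have h4 : |(|x + 1 / 2| - |x - 1 / 2|)| / (|x + 1 / 2| + |x - 1 / 2|) ≤
      2 * (1 + |x|) ^ (-(1 : ℝ)) := by
    rw [Real.rpow_neg_one, ← div_eq_mul_inv, div_le_div_iff₀ (by linarith) (by positivity)]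
    nlinarith [abs_nonneg x]
  calc _ ≤ C * (2 * (1 + |x|) ^ (-(1 : ℝ)) * (|x + 1 / 2| ^ α + |x - 1 / 2| ^ α)) := by gcongr
    _ = _ := by unfold incrBound; ring

lemma integrable_shift_rpow_mul {s p : ℝ} (hs : -1 < s) (hp : s + 1 < p) (hp0 : 0 ≤ p) {a : ℝ}
    (ha : |a| ≤ 1) : Integrable (fun u : ℝ => |u - a| ^ s * (1 + |u|) ^ (-p)) ∧
      ∫ u : ℝ, |u - a| ^ s * (1 + |u|) ^ (-p) ≤ 2 ^ p * ∫ u : ℝ, |u| ^ s * (1 + |u|) ^ (-p) := by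
  have h := ((integrable_rpow_mul hs hp).comp_sub_right a).const_mul (2 ^ p)
  have hb : ∀ u : ℝ, |u - a| ^ s * (1 + |u|) ^ (-p) ≤
      2 ^ p * (|u - a| ^ s * (1 + |u - a|) ^ (-p)) := fun u => by
    have h1 : 1 + |u - a| ≤ 2 * (1 + |u|) := by
      have := abs_sub u a; linarith [abs_nonneg u]
    have h2 : (1 + |u|) ^ (-p) ≤ 2 ^ p * (1 + |u - a|) ^ (-p) := by
      have h3 := Real.rpow_le_rpow_of_nonpos (by positivity) h1 (neg_nonpos.2 hp0)
      rw [Real.mul_rpow (by norm_num) (by positivity)] at h3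
      calc _ = 2 ^ p * (2 ^ (-p) * (1 + |u|) ^ (-p)) := by
            rw [← mul_assoc, ← Real.rpow_add two_pos, add_neg_cancel, Real.rpow_zero, one_mul]
        _ ≤ _ := by gcongr
    calc _ ≤ |u - a| ^ s * (2 ^ p * (1 + |u - a|) ^ (-p)) := by gcongr
      _ = _ := by ring
  have hi : Integrable (fun u : ℝ => |u - a| ^ s * (1 + |u|) ^ (-p)) := by
    refine h.mono' (by fun_prop : Measurable fun u : ℝ =>
      |u - a| ^ s * (1 + |u|) ^ (-p)).aestronglyMeasurable (Eventually.of_forall fun u => ?_)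
    rw [Real.norm_of_nonneg (by positivity)]
    exact hb u
  refine ⟨hi, (integral_mono hi h hb).trans (le_of_eq ?_)⟩
  rw [integral_const_mul, integral_sub_right_eq_self (fun u : ℝ => |u| ^ s * (1 + |u|) ^ (-p))]

lemma sq_rpow (x α : ℝ) : (|x| ^ α) ^ 2 = |x| ^ (2 * α) := by
  rw [← Real.rpow_mul_natCast (abs_nonneg x), mul_comm]; norm_num

variable {α : ℝ}

lemma integrable_incrBound_sq (hα : |α| < 1 / 2) : Integrable fun x => incrBound α x ^ 2 := by
  have ha := abs_lt.1 hα
  have h := fun a (ha' : |a| ≤ 1) => (integrable_shift_rpow_mul (s := 2 * α) (p := 2)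
    (by linarith) (by linarith) (by norm_num) (a := a) ha').1
  have h1 := h (-(1 / 2)) (by rw [abs_neg, abs_of_pos] <;> norm_num)
  have h2 := h (1 / 2) (by rw [abs_of_pos] <;> norm_num)
  refine ((h1.add h2).const_mul 2).mono' ((measurable_incrBound α).pow_const 2).aestronglyMeasurable
    (Eventually.of_forall fun x => ?_)
  rw [Real.norm_of_nonneg (sq_nonneg _), incrBound, mul_pow,
    ← Real.rpow_mul_natCast (by positivity), Pi.add_apply, ← sq_rpow, ← sq_rpow, sub_neg_eq_add]
  norm_num only [Nat.cast_ofNat]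
  rw [← add_mul, ← mul_assoc]
  gcongr
  nlinarith [sq_nonneg (|x + 1 / 2| ^ α - |x - 1 / 2| ^ α)]

/-- The bound of the correlations is integrable at infinity against a decaying power, by Young's
inequality. -/
lemma integrable_weight_incrBound (hα : |α| < 1 / 2) {b : ℝ} (hb : 1 / 2 < b) :
    Integrable fun q : ℝ × ℝ =>
      (1 + |q.1|) ^ (-b) * (incrBound α q.2 * incrBound α (q.2 + q.1) ^ 2) := by
  have h2 := integrable_incrBound_sq hα
  have hm := measurable_incrBound α
  have hw : Integrable fun h : ℝ => (1 + |h|) ^ (-(2 * b)) := by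
    simpa using integrable_rpow_mul (s := 0) (p := 2 * b) (by norm_num) (by linarith)
  have i1 : Integrable fun q : ℝ × ℝ => (1 + |q.1|) ^ (-(2 * b)) * incrBound α (q.1 + q.2) ^ 2 :=
    (measurePreserving_prod_add (volume : Measure ℝ)
      (volume : Measure ℝ)).integrable_comp_of_integrable (hw.mul_prod h2)
  have i2 : Integrable fun q : ℝ × ℝ => incrBound α q.1 ^ 2 * incrBound α (q.1 + q.2) ^ 2 :=
    (measurePreserving_prod_add (volume : Measure ℝ)
      (volume : Measure ℝ)).integrable_comp_of_integrable (h2.mul_prod h2)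
  have i3 : Integrable fun q : ℝ × ℝ => incrBound α q.2 ^ 2 * incrBound α (q.2 + q.1) ^ 2 :=
    (Measure.measurePreserving_swap (μ := (volume : Measure ℝ))
      (ν := (volume : Measure ℝ))).integrable_comp_of_integrable i2
  refine (i1.add i3).mono' (by fun_prop : Measurable fun q : ℝ × ℝ =>
    (1 + |q.1|) ^ (-b) * (incrBound α q.2 * incrBound α (q.2 + q.1) ^ 2)).aestronglyMeasurable
    (Eventually.of_forall fun q => ?_)
  have h0 := incrBound_nonneg α
  rw [Real.norm_of_nonneg (mul_nonneg (by positivity) (mul_nonneg (h0 _) (sq_nonneg _))),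
    Pi.add_apply, add_comm q.1 q.2, ← add_mul, ← mul_assoc]
  have e : (1 + |q.1|) ^ (-(2 * b)) = ((1 + |q.1|) ^ (-b)) ^ 2 := by
    rw [← Real.rpow_mul_natCast (by positivity)]; congr 1; push_cast; ring
  rw [e]
  gcongr
  nlinarith [sq_nonneg ((1 + |q.1|) ^ (-b) - incrBound α q.2),
    mul_nonneg (Real.rpow_nonneg (by positivity : 0 ≤ 1 + |q.1|) (-b)) (h0 q.2)]

lemma integrable_corrBound (hα : |α| < 1 / 2) {b : ℝ} (hb : 1 / 2 < b) :
    Integrable fun h : ℝ => (1 + |h|) ^ (-b) * corrBound α h := by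
  have h := (integrable_weight_incrBound hα hb).integral_prod_left
  refine h.congr (Eventually.of_forall fun h => ?_)
  simp only
  rw [integral_const_mul, corrBound]

lemma ae_integrable_incrBound (hα : |α| < 1 / 2) :
    ∀ᵐ h : ℝ, Integrable fun x => incrBound α x * incrBound α (x + h) ^ 2 := by
  filter_upwards [(integrable_weight_incrBound hα (b := 1) (by norm_num)).prod_right_ae] with h hh
  have h0 : (1 + |h|) ^ (-(1 : ℝ)) ≠ 0 := by positivity
  exact (integrable_const_mul_iff (isUnit_iff_ne_zero.2 h0) _).1 hh

variable {C : ℝ} {ψ : ℝ → ℝ}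

lemma IsPowerLike.measurable_incr (hψ : IsPowerLike C α ψ) : Measurable (incr ψ) := by
  have := hψ.measurable
  unfold incr; fun_prop

lemma IsPowerLike.incr_neg (hψ : IsPowerLike C α ψ) (x : ℝ) : incr ψ (-x) = -incr ψ x := by
  unfold incr
  rw [← hψ.even, ← hψ.even (-x - 1 / 2)]
  ring_nf

lemma IsPowerLike.abs_incr_mul_le (hψ : IsPowerLike C α ψ) (hC : 0 ≤ C) (x y : ℝ) :
    |incr ψ x * incr ψ y ^ 2| ≤ (2 * C) ^ 3 * (incrBound α x * incrBound α y ^ 2) := by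
  have h0 := incrBound_nonneg α
  rw [abs_mul, abs_pow]
  calc _ ≤ (2 * C * incrBound α x) * (2 * C * incrBound α y) ^ 2 := by
        gcongr
        · exact mul_nonneg (by positivity) (h0 x)
        · exact hψ.abs_incr_le hC x
        · exact hψ.abs_incr_le hC y
    _ = _ := by ring

lemma IsPowerLike.integrable_incr (hψ : IsPowerLike C α ψ) (hC : 0 ≤ C) {h : ℝ}
    (hh : Integrable fun x => incrBound α x * incrBound α (x + h) ^ 2) :
    Integrable fun x => incr ψ x * incr ψ (x + h) ^ 2 := by
  have hm := hψ.measurable_incr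
  exact (hh.const_mul ((2 * C) ^ 3)).mono'
    (by fun_prop : Measurable fun x => incr ψ x * incr ψ (x + h) ^ 2).aestronglyMeasurable
    (Eventually.of_forall fun x => hψ.abs_incr_mul_le hC _ _)

lemma IsPowerLike.abs_incrCorr_le (hψ : IsPowerLike C α ψ) (hC : 0 ≤ C) {h : ℝ}
    (hh : Integrable fun x => incrBound α x * incrBound α (x + h) ^ 2) :
    |incrCorr ψ h| ≤ (2 * C) ^ 3 * corrBound α h := by
  rw [corrBound, ← integral_const_mul]
  exact (abs_integral_le_integral_abs).trans (integral_mono (hψ.integrable_incr hC hh).abs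
    (hh.const_mul _) fun x => hψ.abs_incr_mul_le hC _ _)

lemma IsPowerLike.measurable_incrCorr (hψ : IsPowerLike C α ψ) : Measurable (incrCorr ψ) := by
  have hm := hψ.measurable_incr
  have : Measurable fun q : ℝ × ℝ => incr ψ q.2 * incr ψ (q.2 + q.1) ^ 2 := by fun_prop
  exact (this.stronglyMeasurable.integral_prod_right (ν := volume)).measurable

/-- The increments of an even function are odd, hence so is their correlation. -/
lemma IsPowerLike.incrCorr_neg (hψ : IsPowerLike C α ψ) (h : ℝ) :
    incrCorr ψ (-h) = -incrCorr ψ h := by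
  unfold incrCorr
  rw [← integral_neg_eq_self, ← integral_neg]
  refine integral_congr_ae (Eventually.of_forall fun x => ?_)
  simp only
  rw [show -x + -h = -(x + h) by ring, hψ.incr_neg, hψ.incr_neg]
  ring

lemma tendsto_incrCorr {ι : Type*} {L : Filter ι} [L.IsCountablyGenerated] {f : ι → ℝ → ℝ}
    (hC : 0 ≤ C) (hf : ∀ᶠ i in L, IsPowerLike C α (f i))
    (hlim : ∀ u, Tendsto (fun i => f i u) L (𝓝 (ψ u))) {h : ℝ}
    (hh : Integrable fun x => incrBound α x * incrBound α (x + h) ^ 2) :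
    Tendsto (fun i => incrCorr (f i) h) L (𝓝 (incrCorr ψ h)) := by
  have hd : ∀ x, Tendsto (fun i => incr (f i) x) L (𝓝 (incr ψ x)) := fun x =>
    (hlim _).sub (hlim _)
  refine tendsto_integral_filter_of_dominated_convergence
    (fun x => (2 * C) ^ 3 * (incrBound α x * incrBound α (x + h) ^ 2)) ?_ ?_ (hh.const_mul _)
    (Eventually.of_forall fun x => (hd x).mul ((hd (x + h)).pow 2))
  · filter_upwards [hf] with i hi
    exact (hi.integrable_incr hC hh).aestronglyMeasurable
  · filter_upwards [hf] with i hi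
    exact Eventually.of_forall fun x => hi.abs_incr_mul_le hC _ _

end PowerLike

/-! ### The correlation of the increments at small distances -/

section SmallDistance

variable {C α : ℝ} {ψ : ℝ → ℝ}

/-- One of `a`, `b` is at distance at least `η / 2` from `u`, so that its factor is harmless; the
product of the other two is bounded by the sum of their squares. -/
lemma triple_rpow_le (hα : |α| < 1 / 2) {η : ℝ} (hη : 0 < η) (hη1 : η ≤ 1) {a b c : ℝ}
    (ha : |a| ≤ 1) (hb : |b| ≤ 1) (hab : η ≤ |a - b|) (u : ℝ) :
    |u - a| ^ α * |u - b| ^ α * |u - c| ^ α ≤ 2 / η * (1 + |u|) ^ (1 / 2 : ℝ) *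
      (|u - a| ^ (2 * α) + |u - b| ^ (2 * α) + |u - c| ^ (2 * α)) := by
  have hα' := abs_lt.1 hα
  have hw : 1 ≤ (1 + |u|) ^ (1 / 2 : ℝ) :=
    Real.one_le_rpow (by linarith [abs_nonneg u]) (by norm_num)
  have h2η : 1 ≤ 2 / η := by rw [le_div_iff₀ hη]; linarith
  have hfar : ∀ p : ℝ, |p| ≤ 1 → η / 2 ≤ |u - p| →
      |u - p| ^ α ≤ 2 / η * (1 + |u|) ^ (1 / 2 : ℝ) := by
    intro p hp hup
    rcases le_total 0 α with h | h
    · calc |u - p| ^ α ≤ (1 + |u|) ^ α := by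
            refine Real.rpow_le_rpow (abs_nonneg _) ?_ h
            have := abs_sub u p; linarith
        _ ≤ (1 + |u|) ^ (1 / 2 : ℝ) :=
            Real.rpow_le_rpow_of_exponent_le (by linarith [abs_nonneg u]) hα'.2.le
        _ ≤ _ := le_mul_of_one_le_left (by linarith) h2η
    · calc |u - p| ^ α ≤ (η / 2) ^ α := Real.rpow_le_rpow_of_nonpos (by positivity) hup h
        _ ≤ (η / 2) ^ (-1 : ℝ) :=
            Real.rpow_le_rpow_of_exponent_ge (by positivity) (by linarith) (by linarith)
        _ = 2 / η := by rw [Real.rpow_neg_one, inv_div]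
        _ ≤ _ := le_mul_of_one_le_right (by positivity) hw
  set K := 2 / η * (1 + |u|) ^ (1 / 2 : ℝ)
  have hK : 0 ≤ K := by positivity
  have key : ∀ x y z : ℝ, 0 ≤ x → 0 ≤ y → 0 ≤ z → x ≤ K →
      x * (y * z) ≤ K * (x ^ 2 + y ^ 2 + z ^ 2) := fun x y z hx hy hz hxK => by
    refine mul_le_mul hxK ?_ (mul_nonneg hy hz) hK
    nlinarith [sq_nonneg (y - z), mul_nonneg hy hz, sq_nonneg x]
  rw [← sq_rpow, ← sq_rpow, ← sq_rpow]
  have h0 : ∀ p : ℝ, 0 ≤ |u - p| ^ α := fun p => by positivity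
  by_cases h : η / 2 ≤ |u - a|
  · have := key _ _ _ (h0 a) (h0 b) (h0 c) (hfar a ha h)
    rwa [← mul_assoc] at this
  · have h' : η / 2 ≤ |u - b| := by
      have h1 := abs_sub_le a u b
      rw [abs_sub_comm a u] at h1
      linarith
    have := key _ _ _ (h0 b) (h0 a) (h0 c) (hfar b hb h')
    linarith

/-- The sum of the squares of the powers of the distances to the singular points. -/
def singSum (α h u : ℝ) : ℝ :=
  |u - h| ^ (2 * α) + |u - -h| ^ (2 * α) + |u - 1| ^ (2 * α) + |u - -1| ^ (2 * α) +
    |u - 0| ^ (2 * α)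

lemma integrable_singSum (hα : |α| < 1 / 2) : ∃ K, 0 ≤ K ∧ ∀ h : ℝ, |h| ≤ 1 →
    Integrable (fun u => singSum α h u * (1 + |u|) ^ (-(5 / 2) : ℝ)) ∧
      ∫ u, singSum α h u * (1 + |u|) ^ (-(5 / 2) : ℝ) ≤ K := by
  have ha := abs_lt.1 hα
  set J := 2 ^ (5 / 2 : ℝ) * ∫ u : ℝ, |u| ^ (2 * α) * (1 + |u|) ^ (-(5 / 2) : ℝ)
  have hJ : 0 ≤ J := mul_nonneg (by positivity) (integral_nonneg fun u => by positivity)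
  set g : ℝ → ℝ → ℝ := fun a u => |u - a| ^ (2 * α) * (1 + |u|) ^ (-(5 / 2) : ℝ)
  have hs : ∀ a : ℝ, |a| ≤ 1 → Integrable (g a) ∧ ∫ u, g a u ≤ J := fun a ha' =>
    integrable_shift_rpow_mul (by linarith) (by linarith) (by norm_num) ha'
  refine ⟨5 * J, by positivity, fun h hh => ?_⟩
  obtain ⟨i1, j1⟩ := hs h hh
  obtain ⟨i2, j2⟩ := hs (-h) (by rwa [abs_neg])
  obtain ⟨i3, j3⟩ := hs 1 (by simp)
  obtain ⟨i4, j4⟩ := hs (-1) (by simp)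
  obtain ⟨i5, j5⟩ := hs 0 (by simp)
  have i12 := i1.add i2
  have i123 := i12.add i3
  have i1234 := i123.add i4
  have e : (fun u => singSum α h u * (1 + |u|) ^ (-(5 / 2) : ℝ)) =
      g h + g (-h) + g 1 + g (-1) + g 0 := by
    ext u
    simp only [singSum, Pi.add_apply, g]
    ring
  rw [e]
  refine ⟨i1234.add i5, ?_⟩
  rw [integral_add' i1234 i5, integral_add' i123 i4, integral_add' i12 i3, integral_add' i1 i2]
  linarith

lemma ratio_le_one (x y : ℝ) : |(|x| - |y|)| / (|x| + |y|) ≤ 1 :=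
  div_le_one_of_le₀ (by
    rw [abs_le]; constructor <;> linarith [abs_nonneg x, abs_nonneg y]) (by positivity)

/-- The relative size of an increment of length `2 h` of an even function is at most `h / |u|`. -/
lemma ratio_mul_le {u h : ℝ} (hh : 0 ≤ h) :
    |(|u + h| - |u - h|)| / (|u + h| + |u - h|) * |u| ≤ h := by
  have h1 : |(|u + h| - |u - h|)| ≤ 2 * h := by
    refine (abs_abs_sub_abs_le _ _).trans (le_of_eq ?_)
    rw [show u + h - (u - h) = 2 * h by ring, abs_of_nonneg (by linarith)]
  have h2 : 2 * |u| ≤ |u + h| + |u - h| := by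
    have := abs_add_le (u + h) (u - h)
    rwa [show u + h + (u - h) = 2 * u by ring, abs_mul, abs_two] at this
  rcases eq_or_lt_of_le (abs_nonneg u) with h0 | h0
  · rw [← h0, mul_zero]; exact hh
  · rw [div_mul_eq_mul_div, div_le_iff₀ (by linarith)]
    nlinarith

lemma ratio_one_mul_le (u : ℝ) :
    |(|u + 1| - |u - 1|)| / (|u + 1| + |u - 1|) * (1 + |u|) ^ 2 ≤ 4 * |u| := by
  have h1 : |(|u + 1| - |u - 1|)| ≤ 2 := by
    refine (abs_abs_sub_abs_le _ _).trans (le_of_eq ?_)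
    rw [show u + 1 - (u - 1) = 2 by ring, abs_two]
  have h1' : |(|u + 1| - |u - 1|)| ≤ 2 * |u| := by
    rw [abs_sub_comm u 1]
    refine (abs_abs_sub_abs_le _ _).trans (le_of_eq ?_)
    rw [show u + 1 - (1 - u) = 2 * u by ring, abs_mul, abs_two]
  have h2 : 2 * |u| ≤ |u + 1| + |u - 1| := by
    have := abs_add_le (u + 1) (u - 1)
    rwa [show u + 1 + (u - 1) = 2 * u by ring, abs_mul, abs_two] at this
  have h2' : 2 ≤ |u + 1| + |u - 1| := by
    have := abs_sub (u + 1) (u - 1)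
    rwa [show u + 1 - (u - 1) = 2 by ring, abs_two] at this
  have h0 := abs_nonneg u
  rw [div_mul_eq_mul_div, div_le_iff₀ (by linarith)]
  rcases le_total |u| 1 with h | h
  · calc _ ≤ 2 * |u| * 4 := by gcongr; nlinarith
      _ ≤ _ := by nlinarith
  · calc _ ≤ 2 * (4 * |u| ^ 2) := by gcongr; nlinarith
      _ ≤ _ := by nlinarith

lemma IsPowerLike.abs_sub_le_of_one_le (hψ : IsPowerLike C α ψ) (hC : 0 ≤ C) {u v : ℝ}
    (h1 : |(|u| - |v|)| ≤ 1) (h2 : 1 ≤ |u| + |v|) :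
    |ψ u - ψ v| ≤ 2 * C * (1 + |v|) ^ (-(1 : ℝ)) * (|u| ^ α + |v| ^ α) := by
  refine (hψ.sub_le u v).trans ?_
  have : |(|u| - |v|)| / (|u| + |v|) ≤ 2 * (1 + |v|) ^ (-(1 : ℝ)) := by
    rw [Real.rpow_neg_one, ← div_eq_mul_inv, div_le_div_iff₀ (by linarith) (by positivity)]
    nlinarith [abs_nonneg u, abs_nonneg v, abs_nonneg (|u| - |v|)]
  calc _ ≤ C * (2 * (1 + |v|) ^ (-(1 : ℝ)) * (|u| ^ α + |v| ^ α)) := by gcongr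
    _ = _ := by ring

lemma IsPowerLike.abs_sub_one_le (hψ : IsPowerLike C α ψ) (hC : 0 ≤ C) (u : ℝ) :
    |ψ (u + 1) - ψ u| ≤ 2 * C * (1 + |u|) ^ (-(1 : ℝ)) * (|u - -1| ^ α + |u - 0| ^ α) ∧
    |ψ (u - 1) - ψ u| ≤ 2 * C * (1 + |u|) ^ (-(1 : ℝ)) * (|u - 1| ^ α + |u - 0| ^ α) := by
  rw [sub_neg_eq_add, sub_zero]
  constructor
  · refine hψ.abs_sub_le_of_one_le hC ?_ ?_
    · refine (abs_abs_sub_abs_le _ _).trans (le_of_eq ?_)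
      rw [show u + 1 - u = 1 by ring, abs_one]
    · have := abs_sub (u + 1) u
      rwa [show u + 1 - u = 1 by ring, abs_one] at this
  · refine hψ.abs_sub_le_of_one_le hC ?_ ?_
    · refine (abs_abs_sub_abs_le _ _).trans (le_of_eq ?_)
      rw [show u - 1 - u = -1 by ring, abs_neg, abs_one]
    · have := abs_sub (u - 1) u
      rwa [show u - 1 - u = -1 by ring, abs_neg, abs_one] at this

lemma IsPowerLike.abs_sub_h_le (hψ : IsPowerLike C α ψ) (hC : 0 ≤ C) {h : ℝ} (hh : 0 ≤ h)
    (hh1 : h ≤ 1) (u : ℝ) : |ψ (u + h) - ψ (u - h)| ≤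
      2 * C * (1 + |u|) ^ (-(1 : ℝ)) * (|u - -h| ^ α + |u - h| ^ α) := by
  rw [sub_neg_eq_add]
  refine (hψ.sub_le _ _).trans ?_
  have h1 := ratio_le_one (u + h) (u - h)
  have h2 := ratio_mul_le (u := u) hh
  have : |(|u + h| - |u - h|)| / (|u + h| + |u - h|) ≤ 2 * (1 + |u|) ^ (-(1 : ℝ)) := by
    rw [Real.rpow_neg_one, ← div_eq_mul_inv, le_div_iff₀ (by positivity)]
    nlinarith
  calc _ ≤ C * (2 * (1 + |u|) ^ (-(1 : ℝ)) * (|u + h| ^ α + |u - h| ^ α)) := by gcongr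
    _ = _ := by ring

lemma rpow_neg_three_mul (u : ℝ) :
    (1 + |u|) ^ (-(3 : ℝ)) * (1 + |u|) ^ (1 / 2 : ℝ) = (1 + |u|) ^ (-(5 / 2) : ℝ) := by
  rw [← Real.rpow_add (by positivity)]; norm_num

lemma rpow_neg_one_cube (u : ℝ) :
    (1 + |u|) ^ (-(1 : ℝ)) * (1 + |u|) ^ (-(1 : ℝ)) * (1 + |u|) ^ (-(1 : ℝ)) =
      (1 + |u|) ^ (-(3 : ℝ)) := by
  rw [← Real.rpow_add (by positivity), ← Real.rpow_add (by positivity)]; norm_num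

lemma triple_singSum (hα : |α| < 1 / 2) {η : ℝ} (hη : 0 < η) (hη1 : η ≤ 1) {h a b c : ℝ}
    (ha : |a| ≤ 1) (hb : |b| ≤ 1) (hab : η ≤ |a - b|) (u : ℝ)
    (h1 : |u - a| ^ (2 * α) ≤ singSum α h u) (h2 : |u - b| ^ (2 * α) ≤ singSum α h u)
    (h3 : |u - c| ^ (2 * α) ≤ singSum α h u) :
    |u - a| ^ α * |u - b| ^ α * |u - c| ^ α ≤
      6 / η * ((1 + |u|) ^ (1 / 2 : ℝ) * singSum α h u) := by
  refine (triple_rpow_le (c := c) hα hη hη1 ha hb hab u).trans ?_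
  calc _ ≤ 2 / η * (1 + |u|) ^ (1 / 2 : ℝ) * (singSum α h u + singSum α h u + singSum α h u) := by
        gcongr
    _ = _ := by ring

lemma le_singSum (α h u : ℝ) : |u - h| ^ (2 * α) ≤ singSum α h u ∧
    |u - -h| ^ (2 * α) ≤ singSum α h u ∧ |u - 1| ^ (2 * α) ≤ singSum α h u ∧
    |u - -1| ^ (2 * α) ≤ singSum α h u ∧ |u - 0| ^ (2 * α) ≤ singSum α h u := by
  have h1 : 0 ≤ |u - h| ^ (2 * α) := by positivity
  have h2 : 0 ≤ |u - -h| ^ (2 * α) := by positivity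
  have h3 : 0 ≤ |u - 1| ^ (2 * α) := by positivity
  have h4 : 0 ≤ |u - -1| ^ (2 * α) := by positivity
  have h5 : 0 ≤ |u - 0| ^ (2 * α) := by positivity
  unfold singSum
  refine ⟨?_, ?_, ?_, ?_, ?_⟩ <;> linarith

/-- Integrability of the square of an increment of length one against an increment of length
`2 h`. -/
lemma IsPowerLike.integrable_sq_mul (hψ : IsPowerLike C α ψ) (hC : 0 ≤ C) (hα : |α| < 1 / 2)
    {h : ℝ} (hh : 0 < h) (hh1 : h ≤ 1 / 2) :
    Integrable (fun u => (ψ (u + 1) - ψ u) ^ 2 * (ψ (u + h) - ψ (u - h))) ∧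
    Integrable (fun u => (ψ (u - 1) - ψ u) ^ 2 * (ψ (u + h) - ψ (u - h))) := by
  obtain ⟨K, -, hK⟩ := integrable_singSum hα
  have hi := (hK h (by rw [abs_of_pos hh]; linarith)).1
  have hm := hψ.measurable
  have hah : |h| ≤ 1 := by rw [abs_of_pos hh]; linarith
  have hah' : |-h| ≤ 1 := by rwa [abs_neg]
  -- `e = ± 1` is the end point of the long increment other than `u`
  have main : ∀ e u : ℝ, |e| ≤ 1 → h ≤ |e - h| → h ≤ |e - -h| → |u - e| ^ (2 * α) ≤ singSum α h u →
      (2 * C * (1 + |u|) ^ (-(1 : ℝ)) * (|u - e| ^ α + |u - 0| ^ α)) ^ 2 *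
        (2 * C * (1 + |u|) ^ (-(1 : ℝ)) * (|u - -h| ^ α + |u - h| ^ α)) ≤
      8 * C ^ 3 * (8 * (6 / h)) * (singSum α h u * (1 + |u|) ^ (-(5 / 2) : ℝ)) := by
    intro e u he h1 h2 hse
    obtain ⟨s1, s2, -, -, s5⟩ := le_singSum α h u
    have hh' : h ≤ 1 := by linarith
    have t1 := triple_singSum hα hh hh' he hah' h2 u hse s2 hse
    have t2 := triple_singSum hα hh hh' he hah h1 u hse s1 hse
    have t3 := triple_singSum hα hh hh' (by simp) hah' (by simp [abs_of_pos hh]) u s5 s2 s5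
    have t4 := triple_singSum hα hh hh' (by simp) hah (by simp [abs_of_pos hh]) u s5 s1 s5
    set T := 6 / h * ((1 + |u|) ^ (1 / 2 : ℝ) * singSum α h u)
    set x := |u - e| ^ α
    set y := |u - 0| ^ α
    set p := |u - -h| ^ α
    set q := |u - h| ^ α
    have hp : 0 ≤ p := by positivity
    have hq : 0 ≤ q := by positivity
    have hxy : (x + y) ^ 2 * (p + q) ≤ 8 * T := by
      have : (x + y) ^ 2 ≤ 2 * (x ^ 2 + y ^ 2) := by nlinarith [sq_nonneg (x - y)]
      nlinarith [mul_le_mul_of_nonneg_right this (add_nonneg hp hq)]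
    calc _ = 8 * C ^ 3 * ((1 + |u|) ^ (-(1 : ℝ)) * (1 + |u|) ^ (-(1 : ℝ)) *
          (1 + |u|) ^ (-(1 : ℝ))) * ((x + y) ^ 2 * (p + q)) := by ring
      _ ≤ 8 * C ^ 3 * (1 + |u|) ^ (-(3 : ℝ)) * (8 * T) := by
          rw [rpow_neg_one_cube]; gcongr
      _ = _ := by rw [← rpow_neg_three_mul]; simp only [T]; ring
  have habs : ∀ x y X Y : ℝ, |x| ≤ X → |y| ≤ Y → ‖x ^ 2 * y‖ ≤ X ^ 2 * Y := fun x y X Y hx hy => by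
    have hX := (abs_nonneg x).trans hx
    rw [norm_mul, norm_pow]
    exact mul_le_mul (pow_le_pow_left₀ (abs_nonneg _) hx 2) hy (abs_nonneg _) (by positivity)
  constructor
  · refine (hi.const_mul (8 * C ^ 3 * (8 * (6 / h)))).mono' (by fun_prop : Measurable fun u =>
      (ψ (u + 1) - ψ u) ^ 2 * (ψ (u + h) - ψ (u - h))).aestronglyMeasurable
      (Eventually.of_forall fun u => (habs _ _ _ _ (hψ.abs_sub_one_le hC u).1
        (hψ.abs_sub_h_le hC hh.le (by linarith) u)).trans (main (-1) u (by simp) ?_ ?_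
          (le_singSum α h u).2.2.2.1))
    · rw [le_abs]; right; linarith
    · rw [le_abs]; right; linarith
  · refine (hi.const_mul (8 * C ^ 3 * (8 * (6 / h)))).mono' (by fun_prop : Measurable fun u =>
      (ψ (u - 1) - ψ u) ^ 2 * (ψ (u + h) - ψ (u - h))).aestronglyMeasurable
      (Eventually.of_forall fun u => (habs _ _ _ _ (hψ.abs_sub_one_le hC u).2
        (hψ.abs_sub_h_le hC hh.le (by linarith) u)).trans (main 1 u (by simp) ?_ ?_
          (le_singSum α h u).2.2.1))
    · rw [le_abs]; left; linarith
    · rw [le_abs]; left; linarith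

/-- The antisymmetrised formula for the correlation. In `incrCorr ψ h - incrCorr ψ (-h)` the
increment that is not squared becomes a difference of increments of length `2 h` at the two end
points of the unit interval. Centering each of them at the origin leaves the difference of two
squares. -/
lemma IsPowerLike.two_mul_incrCorr (hψ : IsPowerLike C α ψ) (hC : 0 ≤ C) (hα : |α| < 1 / 2)
    {h : ℝ} (hh : 0 < h) (hh1 : h ≤ 1 / 2)
    (hi : Integrable fun x => incrBound α x * incrBound α (x + h) ^ 2)
    (hi' : Integrable fun x => incrBound α x * incrBound α (x + -h) ^ 2) :
    2 * incrCorr ψ h = ∫ u, (ψ (u + 1) - ψ (u - 1)) * ((ψ (u + 1) - ψ u) + (ψ (u - 1) - ψ u)) *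
      (ψ (u + h) - ψ (u - h)) := by
  have h1 : ∀ s : ℝ, Integrable (fun x => incrBound α x * incrBound α (x + s) ^ 2) →
      Integrable (fun x => incr ψ (x - s) * incr ψ x ^ 2) ∧
      incrCorr ψ s = ∫ x, incr ψ (x - s) * incr ψ x ^ 2 := fun s hs => by
    have h2 := (hψ.integrable_incr hC hs).comp_sub_right s
    simp only [sub_add_cancel] at h2
    refine ⟨h2, ?_⟩
    rw [incrCorr, ← integral_sub_right_eq_self _ s]
    simp only [sub_add_cancel]
  obtain ⟨i1, e1⟩ := h1 h hi
  obtain ⟨i2, e2⟩ := h1 (-h) hi'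
  obtain ⟨j1, j2⟩ := hψ.integrable_sq_mul hC hα hh hh1
  have e3 : 2 * incrCorr ψ h = incrCorr ψ h - incrCorr ψ (-h) := by rw [hψ.incrCorr_neg]; ring
  have e4 := integral_sub_right_eq_self (μ := volume)
    (fun u => (ψ (u + 1) - ψ u) ^ 2 * (ψ (u + h) - ψ (u - h))) (1 / 2)
  have e5 := integral_add_right_eq_self (μ := volume)
    (fun u => (ψ (u - 1) - ψ u) ^ 2 * (ψ (u + h) - ψ (u - h))) (1 / 2)
  rw [e3, e1, e2, ← integral_sub i1 i2]
  have e6 : ∫ u, (ψ (u + 1) - ψ (u - 1)) * ((ψ (u + 1) - ψ u) + (ψ (u - 1) - ψ u)) *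
      (ψ (u + h) - ψ (u - h)) = ∫ u, ((ψ (u + 1) - ψ u) ^ 2 * (ψ (u + h) - ψ (u - h)) -
        (ψ (u - 1) - ψ u) ^ 2 * (ψ (u + h) - ψ (u - h))) :=
    integral_congr_ae (Eventually.of_forall fun u => by simp only; ring)
  rw [e6, integral_sub j1 j2, ← e4, ← e5,
    ← integral_sub (j1.comp_sub_right (1 / 2)) (j2.comp_add_right (1 / 2))]
  refine integral_congr_ae (Eventually.of_forall fun x => ?_)
  simp only [incr]
  rw [show x - h + 1 / 2 = x + 1 / 2 - h by ring, show x - h - 1 / 2 = x - 1 / 2 - h by ring,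
    show x - -h + 1 / 2 = x + 1 / 2 + h by ring, show x - -h - 1 / 2 = x - 1 / 2 + h by ring,
    show x - 1 / 2 + 1 = x + 1 / 2 by ring, show x + 1 / 2 - 1 = x - 1 / 2 by ring]
  ring

/-- The correlation vanishes at least linearly at the origin. In the antisymmetrised formula the
factors `ψ (u + h) - ψ (u - h)` and `ψ (u + 1) - ψ (u - 1)` are of relative sizes `h / |u|` and
`|u| / (1 + |u|)²`, so that the singularities at `u = 0` compensate. -/
lemma exists_incrCorr_small (hα : |α| < 1 / 2) : ∃ K, 0 ≤ K ∧ ∀ (C : ℝ) (ψ : ℝ → ℝ), 0 ≤ C →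
    IsPowerLike C α ψ → ∀ h, 0 < h → h ≤ 1 / 2 →
    Integrable (fun x => incrBound α x * incrBound α (x + h) ^ 2) →
    Integrable (fun x => incrBound α x * incrBound α (x + -h) ^ 2) →
    |incrCorr ψ h| ≤ C ^ 3 * K * h := by
  obtain ⟨K, hK0, hK⟩ := integrable_singSum hα
  refine ⟨8 * (16 * 12) * K, by positivity, fun C ψ hC hψ h hh hh1 hi hi' => ?_⟩
  have hah : |h| ≤ 1 := by rw [abs_of_pos hh]; linarith
  have hah' : |-h| ≤ 1 := by rwa [abs_neg]
  obtain ⟨hint, hle⟩ := hK h hah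
  have key : ∀ u, ‖(ψ (u + 1) - ψ (u - 1)) * ((ψ (u + 1) - ψ u) + (ψ (u - 1) - ψ u)) *
      (ψ (u + h) - ψ (u - h))‖ ≤
      C ^ 3 * 8 * (16 * 12) * h * (singSum α h u * (1 + |u|) ^ (-(5 / 2) : ℝ)) := by
    intro u
    obtain ⟨s1, s2, s3, s4, s5⟩ := le_singSum α h u
    have b1 := hψ.sub_le (u + 1) (u - 1)
    have b2 := (abs_add_le (ψ (u + 1) - ψ u) (ψ (u - 1) - ψ u)).trans
      (add_le_add (hψ.abs_sub_one_le hC u).1 (hψ.abs_sub_one_le hC u).2)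
    have b3 := hψ.sub_le (u + h) (u - h)
    have r1 := ratio_one_mul_le u
    have r2 := ratio_mul_le (u := u) hh.le
    set ρ := |(|u + 1| - |u - 1|)| / (|u + 1| + |u - 1|) with hρ
    set σ := |(|u + h| - |u - h|)| / (|u + h| + |u - h|) with hσ
    have hρ0 : 0 ≤ ρ := by positivity
    have hσ0 : 0 ≤ σ := by positivity
    have hr : ρ * σ ≤ 4 * h * ((1 + |u|) ^ (-(1 : ℝ)) * (1 + |u|) ^ (-(1 : ℝ))) := by
      have h1 : ρ * σ * (1 + |u|) ^ 2 ≤ 4 * h := by nlinarith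
      have h2 : (1 + |u|) ^ (-(1 : ℝ)) * (1 + |u|) ^ (-(1 : ℝ)) = ((1 + |u|) ^ 2)⁻¹ := by
        rw [Real.rpow_neg_one, ← mul_inv, sq]
      rw [h2, ← div_eq_mul_inv, le_div_iff₀ (by positivity)]
      exact h1
    have ex : |u + 1| ^ α = |u - -1| ^ α := by rw [sub_neg_eq_add]
    have ep : |u + h| ^ α = |u - -h| ^ α := by rw [sub_neg_eq_add]
    rw [ex] at b1
    rw [ep] at b3
    have m1 : (1 / 2 : ℝ) ≤ |(-h) - (-1)| := by rw [le_abs]; left; linarith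
    have m2 : (1 / 2 : ℝ) ≤ |(-h) - 1| := by rw [le_abs]; right; linarith
    have m3 : (1 / 2 : ℝ) ≤ |h - (-1)| := by rw [le_abs]; left; linarith
    have m4 : (1 / 2 : ℝ) ≤ |h - 1| := by rw [le_abs]; right; linarith
    have n1 : |(1 : ℝ)| ≤ 1 := by simp
    have n2 : |(-1 : ℝ)| ≤ 1 := by simp
    have T1 := fun c => triple_singSum (c := c) hα one_half_pos (by norm_num) hah' n2 m1 u s2 s4
    have T2 := fun c => triple_singSum (c := c) hα one_half_pos (by norm_num) hah' n1 m2 u s2 s3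
    have T3 := fun c => triple_singSum (c := c) hα one_half_pos (by norm_num) hah n2 m3 u s1 s4
    have T4 := fun c => triple_singSum (c := c) hα one_half_pos (by norm_num) hah n1 m4 u s1 s3
    have t1 := T1 (-1) s4
    have t2 := T1 1 s3
    have t3 := T1 0 s5
    have t4 := T2 (-1) s4
    have t5 := T2 1 s3
    have t6 := T2 0 s5
    have t7 := T3 (-1) s4
    have t8 := T3 1 s3
    have t9 := T3 0 s5
    have t10 := T4 (-1) s4
    have t11 := T4 1 s3
    have t12 := T4 0 s5
    have x0 : 0 ≤ |u - -1| ^ α := by positivity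
    have y0 : 0 ≤ |u - 1| ^ α := by positivity
    have z0 : 0 ≤ |u - 0| ^ α := by positivity
    have p0 : 0 ≤ |u - -h| ^ α := by positivity
    have q0 : 0 ≤ |u - h| ^ α := by positivity
    clear T1 T2 T3 T4 hρ hσ r1 r2 hint hle hK s1 s2 s3 s4 s5
    set x := |u - -1| ^ α
    set y := |u - 1| ^ α
    set z := |u - 0| ^ α
    set p := |u - -h| ^ α
    set q := |u - h| ^ α
    set S := singSum α h u
    set w := (1 + |u|) ^ (1 / 2 : ℝ)
    set v := (1 + |u|) ^ (-(1 : ℝ)) with hv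
    have hv0 : 0 ≤ v := by positivity
    have hprod : (x + y) * (x + y + 2 * z) * (p + q) ≤ 16 * (12 * (w * S)) := by
      have : (6 : ℝ) / (1 / 2) = 12 := by norm_num
      rw [this] at t1 t2 t3 t4 t5 t6 t7 t8 t9 t10 t11 t12
      linarith
    rw [norm_mul, norm_mul]
    calc _ ≤ (C * (ρ * (x + y))) * (2 * C * v * (x + z) + 2 * C * v * (y + z)) *
          (C * (σ * (p + q))) := by
          refine mul_le_mul (mul_le_mul b1 b2 (abs_nonneg _) ?_) b3 (abs_nonneg _) ?_ <;> positivity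
      _ = 2 * C ^ 3 * v * (ρ * σ) * ((x + y) * (x + y + 2 * z) * (p + q)) := by ring
      _ ≤ 2 * C ^ 3 * v * (4 * h * (v * v)) * (16 * (12 * (w * S))) := by
          gcongr
      _ = C ^ 3 * 8 * (16 * 12) * h * (S * (v * v * v * w)) := by ring
      _ = _ := by rw [hv, rpow_neg_one_cube, rpow_neg_three_mul]
  have h2 : |2 * incrCorr ψ h| ≤ C ^ 3 * 8 * (16 * 12) * h * K := by
    rw [hψ.two_mul_incrCorr hC hα hh hh1 hi hi']
    refine (norm_integral_le_of_norm_le (hint.const_mul _) (Eventually.of_forall key)).trans ?_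
    rw [integral_const_mul]
    gcongr
  rw [abs_mul, abs_two] at h2
  nlinarith [abs_nonneg (incrCorr ψ h)]

end SmallDistance

/-! ### Domination and passage to the limit -/

section Limits

/-- A common bound of the correlations, integrable against all powers `|h| ^ (-β)`, `1/2 < β < 2`:
linear at the origin, and `corrBound` away from it. -/
lemma exists_corr_dominating {α : ℝ} (hα : |α| < 1 / 2) : ∃ Ψ : ℝ → ℝ,
    (∀ β : ℝ, 1 / 2 < β → β < 2 → Integrable fun h => |h| ^ (-β) * Ψ h) ∧
    ∀ (C : ℝ) (ψ : ℝ → ℝ), 0 ≤ C → IsPowerLike C α ψ → ∀ᵐ h, |incrCorr ψ h| ≤ C ^ 3 * Ψ h := by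
  obtain ⟨K, hK, hsmall⟩ := exists_incrCorr_small hα
  have hcm : Measurable (corrBound α) := by
    have hm := measurable_incrBound α
    have : Measurable fun q : ℝ × ℝ => incrBound α q.2 * incrBound α (q.2 + q.1) ^ 2 := by fun_prop
    exact (this.stronglyMeasurable.integral_prod_right (ν := volume)).measurable
  have hc0 : ∀ h, 0 ≤ corrBound α h := fun h =>
    integral_nonneg fun x => mul_nonneg (incrBound_nonneg α x) (sq_nonneg _)
  refine ⟨fun h => if |h| ≤ 1 / 2 then K * |h| else 8 * corrBound α h, fun β hβ hβ2 => ?_,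
    fun C ψ hC hψ => ?_⟩
  · have i1 := (integrable_rpow_mul (s := 1 - β) (p := 3) (by linarith) (by linarith)).const_mul
      (8 * K)
    have i2 := (integrable_corrBound hα hβ).const_mul (3 ^ β * 8)
    have hm : Measurable fun h : ℝ => |h| ^ (-β) * (if |h| ≤ 1 / 2 then K * |h| else
        8 * corrBound α h) := by
      refine Measurable.mul (by fun_prop) (Measurable.ite ?_ (by fun_prop) (by fun_prop))
      exact measurableSet_le continuous_abs.measurable measurable_const
    refine (i1.add i2).mono' hm.aestronglyMeasurable ?_
    filter_upwards [(by simp [ae_iff] : ∀ᵐ h : ℝ, h ≠ 0)] with h hh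
    have hh' : 0 < |h| := abs_pos.2 hh
    have e1 : 0 ≤ 8 * K * (|h| ^ (1 - β) * (1 + |h|) ^ (-(3 : ℝ))) := by positivity
    have e2 : 0 ≤ 3 ^ β * 8 * ((1 + |h|) ^ (-β) * corrBound α h) :=
      mul_nonneg (by positivity) (mul_nonneg (by positivity) (hc0 h))
    rw [Pi.add_apply]
    split_ifs with h2
    · rw [Real.norm_of_nonneg (by positivity)]
      have h3 : 1 ≤ 8 * (1 + |h|) ^ (-(3 : ℝ)) := by
        rw [Real.rpow_neg (by positivity), ← div_eq_mul_inv, le_div_iff₀ (by positivity), one_mul]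
        calc (1 + |h|) ^ (3 : ℝ) ≤ 2 ^ (3 : ℝ) := by gcongr; linarith
          _ = 8 := by norm_num
      have h4 : |h| ^ (-β) * (K * |h|) = K * |h| ^ (1 - β) := by
        rw [show 1 - β = -β + 1 by ring, Real.rpow_add_one hh'.ne']; ring
      have h5 : 0 ≤ K * |h| ^ (1 - β) := by positivity
      rw [h4]
      nlinarith
    · rw [Real.norm_of_nonneg (mul_nonneg (by positivity) (by linarith [hc0 h]))]
      have h3 : |h| ^ (-β) ≤ 3 ^ β * (1 + |h|) ^ (-β) := by
        have h4 : 1 + |h| ≤ 3 * |h| := by linarith [not_le.1 h2]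
        have h5 := Real.rpow_le_rpow_of_nonpos (z := -β) (by positivity) h4 (by linarith)
        rw [Real.mul_rpow (by norm_num) (by positivity)] at h5
        calc |h| ^ (-β) = 3 ^ β * (3 ^ (-β) * |h| ^ (-β)) := by
              rw [← mul_assoc, ← Real.rpow_add three_pos, add_neg_cancel, Real.rpow_zero, one_mul]
          _ ≤ _ := by gcongr
      have h6 : |h| ^ (-β) * (8 * corrBound α h) ≤
          3 ^ β * (1 + |h|) ^ (-β) * (8 * corrBound α h) :=
        mul_le_mul_of_nonneg_right h3 (by linarith [hc0 h])
      linarith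
  · have hae := ae_integrable_incrBound hα
    have hae' := (Measure.measurePreserving_neg (volume : Measure ℝ)).quasiMeasurePreserving.ae hae
    filter_upwards [hae, hae', (by simp [ae_iff] : ∀ᵐ h : ℝ, h ≠ 0)] with h h1 h2 h0
    split_ifs with h3
    · rcases lt_or_gt_of_ne h0 with h4 | h4
      · have h5 := hsmall C ψ hC hψ (-h) (by linarith) (by rwa [abs_of_neg h4] at h3) h2
          (by rwa [neg_neg])
        rw [hψ.incrCorr_neg, abs_neg] at h5
        rw [abs_of_neg h4, ← mul_assoc]
        exact h5
      · rw [abs_of_pos h4, ← mul_assoc]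
        exact hsmall C ψ hC hψ h h4 (by rwa [abs_of_pos h4] at h3) h1 h2
    · exact (hψ.abs_incrCorr_le hC h1).trans (le_of_eq (by ring))

/-- The odd function `t ↦ sign t / |t| ^ a`; it vanishes at `t = 0` since `0 / 0 = 0`. -/
def oddPow (a t : ℝ) : ℝ := t / |t| ^ (a + 1)

variable {a : ℝ}

lemma oddPow_neg (a t : ℝ) : oddPow a (-t) = -oddPow a t := by
  rw [oddPow, abs_neg, neg_div, oddPow]

lemma oddPow_of_pos {t : ℝ} (ht : 0 < t) : oddPow a t = t ^ (-a) := by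
  rw [oddPow, abs_of_pos ht, Real.rpow_add_one ht.ne', Real.rpow_neg ht.le]
  field_simp

lemma abs_oddPow (ha : a ≠ 0) (t : ℝ) : |oddPow a t| = |t| ^ (-a) := by
  rcases lt_trichotomy t 0 with h | h | h
  · rw [← neg_neg t, oddPow_neg, abs_neg, abs_neg, oddPow_of_pos (by linarith),
      abs_of_nonneg (Real.rpow_nonneg (by linarith) _), abs_of_pos (by linarith)]
  · rw [h, oddPow, zero_div, abs_zero, Real.zero_rpow (neg_ne_zero.2 ha)]
  · rw [oddPow_of_pos h, abs_of_pos h, abs_of_nonneg (Real.rpow_nonneg h.le _)]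

lemma measurable_oddPow (a : ℝ) : Measurable (oddPow a) := by unfold oddPow; fun_prop

lemma oddPow_mul (a : ℝ) {l : ℝ} (hl : 0 < l) (t : ℝ) :
    oddPow a (l * t) = l ^ (-a) * oddPow a t := by
  rw [oddPow, oddPow, abs_mul, abs_of_pos hl, Real.mul_rpow hl.le (abs_nonneg t),
    Real.rpow_add_one hl.ne', Real.rpow_neg hl.le]
  have := Real.rpow_pos_of_pos hl a
  field_simp

lemma integrable_pow_mul_pow_one (h1 : 1 / 2 < a) (h2 : a < 1) :
    Integrable fun s : ℝ => |1 - s| ^ (-a) * |s| ^ (-a) := by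
  have i1 := integrable_rpow_mul (s := -a) (p := a) (by linarith) (by linarith)
  have i2 := i1.comp_sub_left 1
  refine ((i2.add i1).const_mul (3 ^ a)).mono' (by fun_prop : Measurable fun s : ℝ =>
    |1 - s| ^ (-a) * |s| ^ (-a)).aestronglyMeasurable ?_
  filter_upwards [(by simp [ae_iff] : ∀ᵐ h : ℝ, h ≠ 0), (by simp [ae_iff] : ∀ᵐ h : ℝ, h ≠ 1)]
    with s hs0 hs1
  have p0 : 0 < |s| := abs_pos.2 hs0
  have p1 : 0 < |1 - s| := abs_pos.2 (sub_ne_zero.2 hs1.symm)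
  have htri : 1 ≤ |1 - s| + |s| := by
    have := abs_add_le (1 - s) s
    rwa [sub_add_cancel, abs_one] at this
  -- the larger of the two distances is comparable with one plus the smaller one
  have key : ∀ x y : ℝ, 0 < x → x ≤ y → 1 ≤ x + y → y ^ (-a) * x ^ (-a) ≤
      3 ^ a * (x ^ (-a) * (1 + x) ^ (-a)) := fun x y hx hxy h => by
    have h3 : 1 + x ≤ 3 * y := by linarith
    have h5 := Real.rpow_le_rpow_of_nonpos (z := -a) (by positivity) h3 (by linarith)
    rw [Real.mul_rpow (by norm_num) (by linarith)] at h5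
    have h6 : y ^ (-a) ≤ 3 ^ a * (1 + x) ^ (-a) := by
      calc y ^ (-a) = 3 ^ a * (3 ^ (-a) * y ^ (-a)) := by
            rw [← mul_assoc, ← Real.rpow_add three_pos, add_neg_cancel, Real.rpow_zero, one_mul]
        _ ≤ _ := by gcongr
    calc _ ≤ (3 ^ a * (1 + x) ^ (-a)) * x ^ (-a) := by gcongr
      _ = _ := by ring
  rw [Real.norm_of_nonneg (by positivity), Pi.add_apply, mul_add]
  have q1 : 0 ≤ 3 ^ a * (|1 - s| ^ (-a) * (1 + |1 - s|) ^ (-a)) := by positivity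
  have q2 : 0 ≤ 3 ^ a * (|s| ^ (-a) * (1 + |s|) ^ (-a)) := by positivity
  rcases le_total |s| |1 - s| with h | h
  · linarith [key _ _ p0 h (by linarith)]
  · have := key _ _ p1 h (by linarith)
    rw [mul_comm] at this
    linarith

/-- The convolution of `|s| ^ (-a)` with itself, by scaling. -/
lemma integral_pow_mul_pow (h1 : 1 / 2 < a) (h2 : a < 1) {t : ℝ} (ht : t ≠ 0) :
    Integrable (fun s : ℝ => |t - s| ^ (-a) * |s| ^ (-a)) ∧
      ∫ s : ℝ, |t - s| ^ (-a) * |s| ^ (-a) =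
        |t| ^ (1 - 2 * a) * ∫ s : ℝ, |1 - s| ^ (-a) * |s| ^ (-a) := by
  have hp : 0 < |t| := abs_pos.2 ht
  have hi := (integrable_pow_mul_pow_one h1 h2).const_mul (|t| ^ (-(2 * a)))
  have e : ∀ u : ℝ, |t - t * u| ^ (-a) * |t * u| ^ (-a) =
      |t| ^ (-(2 * a)) * (|1 - u| ^ (-a) * |u| ^ (-a)) := fun u => by
    rw [show t - t * u = t * (1 - u) by ring, abs_mul, abs_mul,
      Real.mul_rpow hp.le (abs_nonneg _), Real.mul_rpow hp.le (abs_nonneg _),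
      show -(2 * a) = -a + -a by ring, Real.rpow_add hp]
    ring
  have hi' : Integrable fun u : ℝ => |t - t * u| ^ (-a) * |t * u| ^ (-a) := by
    simp only [e]; exact hi
  refine ⟨(integrable_comp_mul_left_iff (fun s : ℝ => |t - s| ^ (-a) * |s| ^ (-a)) ht).1 hi', ?_⟩
  have h := Measure.integral_comp_mul_left (fun s : ℝ => |t - s| ^ (-a) * |s| ^ (-a)) t
  simp only [e] at h
  rw [integral_const_mul, smul_eq_mul, abs_inv] at h
  have h3 : |t| ^ (1 - 2 * a) = |t| * |t| ^ (-(2 * a)) := by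
    rw [sub_eq_add_neg, add_comm, Real.rpow_add_one hp.ne', mul_comm]
  rw [h3, mul_assoc, h]
  field_simp

lemma selfConv_oddPow (a : ℝ) {t : ℝ} (ht : 0 < t) :
    selfConv (oddPow a) t = t ^ (1 - 2 * a) * selfConv (oddPow a) 1 := by
  have h := Measure.integral_comp_mul_left (fun s : ℝ => oddPow a (t - s) * oddPow a s) t
  have e : ∀ u : ℝ, oddPow a (t - t * u) * oddPow a (t * u) =
      t ^ (-(2 * a)) * (oddPow a (1 - u) * oddPow a u) := fun u => by
    rw [show t - t * u = t * (1 - u) by ring, oddPow_mul a ht, oddPow_mul a ht,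
      show -(2 * a) = -a + -a by ring, Real.rpow_add ht]
    ring
  simp only [e] at h
  rw [integral_const_mul, smul_eq_mul, abs_inv, abs_of_pos ht] at h
  have h3 : t ^ (1 - 2 * a) = t * t ^ (-(2 * a)) := by
    rw [sub_eq_add_neg, add_comm, Real.rpow_add_one ht.ne', mul_comm]
  unfold selfConv
  rw [h3, mul_assoc, h]
  field_simp

variable {ι : Type*} {L : Filter ι} [L.IsCountablyGenerated] {κ : ι → ℝ → ℝ} {κ' : ℝ → ℝ} {C : ℝ}

lemma abs_conv_le {k : ℝ → ℝ} (hb : ∀ t, |k t| ≤ C * |t| ^ (-a)) (t s : ℝ) :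
    |k (t - s) * k s| ≤ C ^ 2 * (|t - s| ^ (-a) * |s| ^ (-a)) := by
  rw [abs_mul]
  calc _ ≤ (C * |t - s| ^ (-a)) * (C * |s| ^ (-a)) :=
        mul_le_mul (hb _) (hb _) (abs_nonneg _) ((abs_nonneg _).trans (hb _))
    _ = _ := by ring

lemma abs_selfConv_le (h1 : 1 / 2 < a) (h2 : a < 1) {k : ℝ → ℝ}
    (hb : ∀ t, |k t| ≤ C * |t| ^ (-a)) {t : ℝ} (ht : t ≠ 0) :
    |selfConv k t| ≤ C ^ 2 * (|t| ^ (1 - 2 * a) * ∫ s : ℝ, |1 - s| ^ (-a) * |s| ^ (-a)) := by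
  obtain ⟨hi, he⟩ := integral_pow_mul_pow h1 h2 ht
  have h := norm_integral_le_of_norm_le (f := fun s => k (t - s) * k s) (hi.const_mul (C ^ 2))
    (Eventually.of_forall fun s => abs_conv_le hb t s)
  rwa [integral_const_mul, he] at h

lemma tendsto_selfConv (h1 : 1 / 2 < a) (h2 : a < 1) (hm : ∀ᶠ i in L, Measurable (κ i))
    (hb : ∀ᶠ i in L, ∀ t, |κ i t| ≤ C * |t| ^ (-a))
    (hlim : ∀ t, t ≠ 0 → Tendsto (fun i => κ i t) L (𝓝 (κ' t))) {t : ℝ} (ht : t ≠ 0) :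
    Tendsto (fun i => selfConv (κ i) t) L (𝓝 (selfConv κ' t)) := by
  refine tendsto_integral_filter_of_dominated_convergence
    (fun s => C ^ 2 * (|t - s| ^ (-a) * |s| ^ (-a))) ?_ ?_
    ((integral_pow_mul_pow h1 h2 ht).1.const_mul _) ?_
  · filter_upwards [hm] with i hi
    exact (by fun_prop : Measurable fun s => κ i (t - s) * κ i s).aestronglyMeasurable
  · filter_upwards [hb] with i hi
    exact Eventually.of_forall fun s => abs_conv_le hi t s
  · filter_upwards [(by simp [ae_iff] : ∀ᵐ s : ℝ, s ≠ 0), (by simp [ae_iff] : ∀ᵐ s : ℝ, s ≠ t)]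
      with s hs hst
    exact (hlim _ (sub_ne_zero.2 hst.symm)).mul (hlim _ hs)

/-- Passage to the limit in the integral which gives the third moment. The convolution of two
kernels of order `|t| ^ (-a)` is of order `|t| ^ (1 - 2 a)`, which explains the exponent `3 a -
1`. -/
lemma tendsto_integral_selfConv (h1 : 1 / 2 < a) (h2 : a < 1)
    (hm : ∀ᶠ i in L, Measurable (κ i))
    (hb : ∀ᶠ i in L, ∀ t, |κ i t| ≤ C * |t| ^ (-a))
    (hlim : ∀ t, t ≠ 0 → Tendsto (fun i => κ i t) L (𝓝 (κ' t)))
    {f : ι → ℝ → ℝ} {f' Ψ : ℝ → ℝ} (hfm : ∀ᶠ i in L, Measurable (f i))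
    (hΨ : Integrable fun h => |h| ^ (-(3 * a - 1)) * Ψ h)
    (hfb : ∀ᶠ i in L, ∀ᵐ h, |f i h| ≤ Ψ h)
    (hf : ∀ᵐ h, Tendsto (fun i => f i h) L (𝓝 (f' h))) :
    Tendsto (fun i => ∫ h, κ i h * selfConv (κ i) h * f i h) L
      (𝓝 (∫ h, κ' h * selfConv κ' h * f' h)) := by
  set c := ∫ s : ℝ, |1 - s| ^ (-a) * |s| ^ (-a)
  have hc : 0 ≤ c := integral_nonneg fun s => by positivity
  refine tendsto_integral_filter_of_dominated_convergence
    (fun h => C ^ 3 * c * (|h| ^ (-(3 * a - 1)) * Ψ h)) ?_ ?_ (hΨ.const_mul _) ?_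
  · filter_upwards [hm, hfm] with i hi hi'
    have := measurable_selfConv hi
    exact (by fun_prop : Measurable fun h => κ i h * selfConv (κ i) h * f i h).aestronglyMeasurable
  · filter_upwards [hb, hfb] with i hi hi'
    filter_upwards [hi', (by simp [ae_iff] : ∀ᵐ s : ℝ, s ≠ 0)] with h hh h0
    have hp : 0 < |h| := abs_pos.2 h0
    have hk := hi h
    have hs := abs_selfConv_le h1 h2 hi h0
    rw [norm_mul, norm_mul]
    calc _ ≤ (C * |h| ^ (-a)) * (C ^ 2 * (|h| ^ (1 - 2 * a) * c)) * Ψ h :=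
          mul_le_mul (mul_le_mul hk hs (abs_nonneg _) ((abs_nonneg _).trans hk)) hh (abs_nonneg _)
            (mul_nonneg ((abs_nonneg _).trans hk) (by positivity))
      _ = C ^ 3 * c * ((|h| ^ (-a) * |h| ^ (1 - 2 * a)) * Ψ h) := by ring
      _ = _ := by rw [← Real.rpow_add hp]; ring_nf
  · filter_upwards [hf, (by simp [ae_iff] : ∀ᵐ s : ℝ, s ≠ 0)] with h hh h0
    exact ((hlim h h0).mul (tendsto_selfConv h1 h2 hm hb hlim h0)).mul hh

end Limits

/-! ### The constant `r_γ` -/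

section Constant

variable {a : ℝ}

lemma integrable_oddPow_mul (h1 : 1 / 2 < a) (h2 : a < 1) :
    Integrable fun s : ℝ => oddPow a (s - 1) * oddPow a s := by
  have hm := measurable_oddPow a
  refine (integrable_pow_mul_pow_one h1 h2).mono' (by fun_prop : Measurable fun s : ℝ =>
    oddPow a (s - 1) * oddPow a s).aestronglyMeasurable (Eventually.of_forall fun s => ?_)
  rw [norm_mul, Real.norm_eq_abs, Real.norm_eq_abs, abs_oddPow (by linarith),
    abs_oddPow (by linarith), abs_sub_comm s 1]

lemma selfConv_oddPow_one (a : ℝ) :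
    selfConv (oddPow a) 1 = -∫ s, oddPow a (s - 1) * oddPow a s := by
  rw [selfConv, ← integral_neg]
  refine integral_congr_ae (Eventually.of_forall fun s => ?_)
  simp only
  rw [← neg_sub s 1, oddPow_neg, neg_mul]

lemma integral_Iic_oddPow_mul (a : ℝ) : ∫ s in Iic 0, oddPow a (s - 1) * oddPow a s =
    ∫ x in Ioi 0, oddPow a x * oddPow a (x + 1) := by
  have h := integral_comp_neg_Ioi 0 (fun s => oddPow a (s - 1) * oddPow a s)
  rw [neg_zero] at h
  rw [← h]
  refine setIntegral_congr_fun measurableSet_Ioi fun x _ => ?_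
  rw [show -x - 1 = -(x + 1) by ring, oddPow_neg, oddPow_neg]
  ring

/-- The two terms of `r_γ` are the contributions of the two half-lines. -/
lemma rGamma_eq {γ : ℝ} (h1 : 1 / 2 < 1 / 2 + 4 * γ ^ 2) (h2 : 1 / 2 + 4 * γ ^ 2 < 1) :
    rGamma γ = ∫ s, oddPow (1 / 2 + 4 * γ ^ 2) (s - 1) * oddPow (1 / 2 + 4 * γ ^ 2) s := by
  set a := 1 / 2 + 4 * γ ^ 2 with ha
  have hi := integrable_oddPow_mul h1 h2
  have hi' : IntegrableOn (fun x => oddPow a x * oddPow a (x + 1)) (Ioi 0) := by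
    have := (hi.comp_add_right 1).integrableOn (s := Ioi 0)
    simpa only [add_sub_cancel_right] using this
  rw [← intervalIntegral.integral_Iic_add_Ioi hi.integrableOn hi.integrableOn,
    integral_Iic_oddPow_mul, ← integral_add hi' hi.integrableOn, rGamma]
  refine setIntegral_congr_fun measurableSet_Ioi fun x hx => ?_
  have hx' : 0 < x := hx
  rw [oddPow_of_pos hx', oddPow, oddPow, ha, abs_of_pos hx', Real.sqrt_eq_rpow,
    ← Real.rpow_add hx', one_div, ← Real.rpow_neg hx'.le,
    show 1 / 2 + 4 * γ ^ 2 + 1 = 3 / 2 + 4 * γ ^ 2 by ring]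
  ring

/-- The inversion `s = 1 / x`. -/
lemma integral_Ioi_one_oddPow_mul (h1 : 1 / 2 < a) (h2 : a < 1) :
    IntervalIntegrable (fun x : ℝ => x ^ (2 * a - 2) * (1 - x) ^ (-a)) volume 0 1 ∧
      ∫ s in Ioi 1, oddPow a (s - 1) * oddPow a s =
        ∫ x in (0 : ℝ)..1, x ^ (2 * a - 2) * (1 - x) ^ (-a) := by
  set F : ℝ → ℝ := (Ioi 1).indicator fun s => oddPow a (s - 1) * oddPow a s with hF
  have hFi : IntegrableOn F (Ioi 0) :=
    ((integrable_oddPow_mul h1 h2).indicator measurableSet_Ioi).integrableOn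
  have e : ∀ x ∈ Ioi (0 : ℝ), (|(-1 : ℝ)| * x ^ ((-1 : ℝ) - 1)) • F (x ^ (-1 : ℝ)) =
      (Ioo 0 1).indicator (fun x : ℝ => x ^ (2 * a - 2) * (1 - x) ^ (-a)) x := by
    intro x hx
    have hx' : 0 < x := hx
    rw [Real.rpow_neg_one]
    by_cases h : x < 1
    · have h' : 1 < x⁻¹ := (one_lt_inv₀ hx').2 h
      rw [hF, indicator_of_mem (show x⁻¹ ∈ Ioi 1 from h'),
        indicator_of_mem (show x ∈ Ioo 0 1 from ⟨hx', h⟩), oddPow_of_pos (by positivity),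
        oddPow_of_pos (by linarith), show x⁻¹ - 1 = (1 - x) * x⁻¹ by field_simp,
        Real.mul_rpow (by linarith) (by positivity), Real.inv_rpow hx'.le, ← Real.rpow_neg hx'.le,
        neg_neg, abs_neg, abs_one, one_mul, smul_eq_mul,
        show 2 * a - 2 = (-1 - 1) + (a + a) by ring, Real.rpow_add hx', Real.rpow_add hx']
      ring
    · rw [hF, indicator_of_notMem (show x⁻¹ ∉ Ioi 1 by
          rw [mem_Ioi, not_lt]; exact inv_le_one_of_one_le₀ (not_lt.1 h)),
        indicator_of_notMem (fun h' : x ∈ Ioo 0 1 => h h'.2), smul_zero]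
  constructor
  · rw [intervalIntegrable_iff_integrableOn_Ioo_of_le zero_le_one]
    have h := (integrableOn_Ioi_comp_rpow_iff F (p := -1) (by norm_num)).2 hFi
    have h' := h.congr_fun e measurableSet_Ioi
    rw [IntegrableOn, integrable_indicator_iff measurableSet_Ioo, IntegrableOn,
      Measure.restrict_restrict measurableSet_Ioo] at h'
    rwa [inter_eq_left.2 (fun x hx => hx.1)] at h'
  · have h := integral_comp_rpow_Ioi F (p := -1) (by norm_num)
    rw [setIntegral_congr_fun measurableSet_Ioi e, setIntegral_indicator measurableSet_Ioo, hF,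
      setIntegral_indicator measurableSet_Ioi, inter_eq_right.2 (fun x hx => hx.1),
      inter_eq_right.2 (Ioi_subset_Ioi (zero_le_one' ℝ))] at h
    rw [← h, intervalIntegral.integral_of_le zero_le_one, integral_Ioc_eq_integral_Ioo]

/-- Both unbounded parts of the integral are turned into integrals over `[0, 1]`. With the negative
middle part they add up, after symmetrisation under `x ↦ 1 - x`, to the integral of
`x ^ (-a) (1 - x) ^ (-a) (x ^ s + (1 - x) ^ s - 1)` with `s = 3 a - 2 < 1`, which is positive. -/
lemma integral_oddPow_mul_pos (h1 : 1 / 2 < a) (h2 : a < 1) :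
    0 < ∫ s, oddPow a (s - 1) * oddPow a s := by
  have hi := integrable_oddPow_mul h1 h2
  obtain ⟨hq, eq1⟩ := integral_Ioi_one_oddPow_mul h1 h2
  set q : ℝ → ℝ := fun x => x ^ (2 * a - 2) * (1 - x) ^ (-a) with hqd
  have e0 : ∫ s in Iic 0, oddPow a (s - 1) * oddPow a s =
      ∫ s in Ioi 1, oddPow a (s - 1) * oddPow a s := by
    rw [integral_Iic_oddPow_mul, ← integral_indicator measurableSet_Ioi,
      ← integral_indicator measurableSet_Ioi, ← integral_add_right_eq_self
        ((Ioi 1).indicator fun s => oddPow a (s - 1) * oddPow a s) (1 : ℝ)]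
    refine integral_congr_ae (Eventually.of_forall fun x => ?_)
    simp only [indicator, mem_Ioi, add_sub_cancel_right, lt_add_iff_pos_left]
  have hp : IntervalIntegrable (fun x => oddPow a (x - 1) * oddPow a x) volume 0 1 :=
    hi.intervalIntegrable
  have hq' : IntervalIntegrable (fun x => q (1 - x)) volume 0 1 := by
    have := hq.comp_sub_left 1
    simp only [sub_zero, sub_self] at this
    exact this.symm
  have eq2 : ∫ x in (0 : ℝ)..1, q (1 - x) = ∫ x in (0 : ℝ)..1, q x := by
    rw [intervalIntegral.integral_comp_sub_left q 1]; simp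
  have eU : ∫ s in Ioi 0, oddPow a (s - 1) * oddPow a s =
      (∫ x in (0 : ℝ)..1, oddPow a (x - 1) * oddPow a x) +
        ∫ s in Ioi 1, oddPow a (s - 1) * oddPow a s := by
    have hd : Disjoint (Ioc (0 : ℝ) 1) (Ioi 1) :=
      Set.disjoint_left.2 fun x hx hx' => not_lt.2 hx.2 hx'
    rw [intervalIntegral.integral_of_le zero_le_one,
      ← setIntegral_union hd measurableSet_Ioi hi.integrableOn hi.integrableOn,
      Ioc_union_Ioi_eq_Ioi (zero_le_one' ℝ)]
  have e3 : ∫ s, oddPow a (s - 1) * oddPow a s =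
      ∫ x in (0 : ℝ)..1, (q x + q (1 - x) + oddPow a (x - 1) * oddPow a x) := by
    rw [intervalIntegral.integral_add (hq.add hq') hp, intervalIntegral.integral_add hq hq', eq2,
      ← intervalIntegral.integral_Iic_add_Ioi hi.integrableOn hi.integrableOn (b := 0), e0, eU, eq1]
    ring
  rw [e3]
  refine intervalIntegral.intervalIntegral_pos_of_pos_on ((hq.add hq').add hp) (fun x hx => ?_)
    one_pos
  have hx0 := hx.1
  have hx1 : 0 < 1 - x := by linarith [hx.2]
  have key : ∀ y : ℝ, 0 < y → y < 1 → y < y ^ (3 * a - 2) := fun y hy hy1 => by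
    conv_lhs => rw [← Real.rpow_one y]
    exact Real.rpow_lt_rpow_of_exponent_gt hy hy1 (by linarith)
  have k1 := key x hx0 hx.2
  have k2 := key (1 - x) hx1 (by linarith)
  have e4 : q x + q (1 - x) + oddPow a (x - 1) * oddPow a x =
      x ^ (-a) * (1 - x) ^ (-a) * (x ^ (3 * a - 2) + (1 - x) ^ (3 * a - 2) - 1) := by
    rw [← neg_sub 1 x, oddPow_neg, oddPow_of_pos hx1, oddPow_of_pos hx0, hqd]
    simp only [sub_sub_cancel]
    rw [show 2 * a - 2 = -a + (3 * a - 2) by ring, Real.rpow_add hx0, Real.rpow_add hx1]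
    ring
  simp only [e4]
  have := Real.rpow_pos_of_pos hx0 (-a)
  have := Real.rpow_pos_of_pos hx1 (-a)
  exact mul_pos (by positivity) (by linarith)

end Constant

/-! ### Scaling and limits of the third moment -/

section Scaling

/-- The function `t ↦ l ^ a κ(l t)`. -/
def rescale (a l : ℝ) (κ : ℝ → ℝ) (t : ℝ) : ℝ := l ^ a * κ (l * t)

variable {a α l H γ : ℝ} {κ f : ℝ → ℝ}

lemma selfConv_rescale (hl : 0 < l) (t : ℝ) :
    selfConv (rescale a l κ) t = l ^ (2 * a - 1) * selfConv κ (l * t) := by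
  have h := Measure.integral_comp_mul_left (fun s => κ (l * t - s) * κ s) l
  rw [smul_eq_mul, abs_of_pos (inv_pos.2 hl)] at h
  unfold selfConv
  rw [Real.rpow_sub_one hl.ne', two_mul, Real.rpow_add hl, div_mul_eq_mul_div, mul_div_assoc,
    div_eq_inv_mul, ← h, ← integral_const_mul]
  refine integral_congr_ae (Eventually.of_forall fun s => ?_)
  simp only [rescale]
  rw [← mul_sub]
  ring

lemma integral_rescale (hl : 0 < l) :
    ∫ h, κ h * selfConv κ h * (l ^ (1 + 3 * α) * f (h / l)) =
      l ^ (3 + 3 * α - 3 * a) *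
        ∫ t, rescale a l κ t * selfConv (rescale a l κ) t * f t := by
  have h := Measure.integral_comp_mul_left
    (fun h => κ h * selfConv κ h * (l ^ (1 + 3 * α) * f (h / l))) l
  rw [smul_eq_mul, abs_of_pos (inv_pos.2 hl)] at h
  have h' : ∫ h, κ h * selfConv κ h * (l ^ (1 + 3 * α) * f (h / l)) =
      l * ∫ t, κ (l * t) * selfConv κ (l * t) * (l ^ (1 + 3 * α) * f (l * t / l)) := by
    rw [h, mul_inv_cancel_left₀ hl.ne']
  rw [h', ← integral_const_mul, ← integral_const_mul]
  refine integral_congr_ae (Eventually.of_forall fun t => ?_)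
  simp only [selfConv_rescale hl]
  rw [rescale, mul_div_cancel_left₀ _ hl.ne',
    show 3 + 3 * α - 3 * a = (1 + 3 * α) + 1 - (a + (2 * a - 1)) by ring,
    Real.rpow_sub hl, Real.rpow_add hl a, Real.rpow_add_one hl.ne']
  have := Real.rpow_pos_of_pos hl a
  have := Real.rpow_pos_of_pos hl (2 * a - 1)
  field_simp

lemma bigPhi_mul (φ : ℝ → ℝ) (hl : 0 < l) (u : ℝ) :
    bigPhi H φ (l * u) = l ^ (H - 1 / 2) * scaledPower φ (H - 1 / 2) l u := by
  rw [bigPhi_eq, scaledPower, abs_mul, abs_of_pos hl, Real.mul_rpow hl.le (abs_nonneg u)]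
  ring

/-- The substitution `y = (x + x') / 2 - h - (x - x') s` brings the increments to unit length. -/
lemma cubicCorr_phiIncr (φ : ℝ → ℝ) {x x' : ℝ} (hx : x' < x) (h : ℝ) :
    cubicCorr (phiIncr H φ x x') h = (x - x') ^ (1 + 3 * (H - 1 / 2)) *
      incrCorr (scaledPower φ (H - 1 / 2) (x - x')) (h / (x - x')) := by
  set l := x - x' with hl'
  have hl : 0 < l := sub_pos.2 hx
  set ψ := scaledPower φ (H - 1 / 2) l
  set D := phiIncr H φ x x'
  have hD : ∀ s, D ((x + x') / 2 - l * s) = l ^ (H - 1 / 2) * incr ψ s := fun s => by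
    simp only [D, phiIncr, incr, ψ]
    rw [mul_sub, ← bigPhi_mul φ hl, ← bigPhi_mul φ hl]
    congr 2 <;> rw [hl'] <;> ring
  have h1 := Measure.integral_comp_mul_left
    (fun u => D ((x + x') / 2 - h - u) ^ 2 * D ((x + x') / 2 - h - u + h)) l
  rw [integral_sub_left_eq_self (fun y => D y ^ 2 * D (y + h)) volume, smul_eq_mul,
    abs_of_pos (inv_pos.2 hl)] at h1
  have h2 : ∀ s, D ((x + x') / 2 - h - l * s) ^ 2 * D ((x + x') / 2 - h - l * s + h) =
      l ^ (3 * (H - 1 / 2)) * (incr ψ s * incr ψ (s + h / l) ^ 2) := fun s => by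
    rw [show (x + x') / 2 - h - l * s + h = (x + x') / 2 - l * s by ring,
      show (x + x') / 2 - h - l * s = (x + x') / 2 - l * (s + h / l) by field_simp; ring, hD, hD,
      show 3 * (H - 1 / 2) = (H - 1 / 2) + (H - 1 / 2) + (H - 1 / 2) by ring, Real.rpow_add hl,
      Real.rpow_add hl]
    ring
  simp only [h2] at h1
  rw [integral_const_mul] at h1
  rw [cubicCorr, incrCorr, Real.rpow_add hl, Real.rpow_one, mul_assoc, h1]
  field_simp

/-- The limit as `ε → 0` of the rescaled kernels `corrKernel`. -/
def limKernel (a l t : ℝ) : ℝ := if |l * t| ≤ 1 then oddPow a t else 0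

lemma measurable_limKernel (a l : ℝ) : Measurable (limKernel a l) := by
  have h : Measurable fun t : ℝ => |l * t| := by fun_prop
  exact Measurable.ite (measurableSet_le h measurable_const) (measurable_oddPow a) measurable_const

lemma abs_limKernel_le (ha : a ≠ 0) (l t : ℝ) : |limKernel a l t| ≤ 1 * |t| ^ (-a) := by
  rw [limKernel]
  split_ifs
  · rw [abs_oddPow ha, one_mul]
  · rw [abs_zero]; positivity

lemma tendsto_limKernel (a t : ℝ) :
    Tendsto (fun l => limKernel a l t) (𝓝[>] 0) (𝓝 (oddPow a t)) := by
  refine tendsto_const_nhds.congr' ?_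
  have h : Tendsto (fun l : ℝ => |l * t|) (𝓝[>] 0) (𝓝 0) := by
    have h1 : ContinuousAt (fun l : ℝ => |l * t|) 0 := by fun_prop
    have h2 := h1.tendsto
    simp only [zero_mul, abs_zero] at h2
    exact h2.mono_left nhdsWithin_le_nhds
  filter_upwards [h.eventually (ge_mem_nhds one_pos)] with l hl
  rw [limKernel, if_pos hl]

variable {Ω : Type*} [MeasurableSpace Ω] {P : Measure Ω} {Xhat : ℝ → ℝ → Ω → ℝ} {N : ℝ → ℝ → ℝ}

lemma posLog_one_div_abs {x : ℝ} (hx : x ≠ 0) (h1 : |x| ≤ 1) :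
    Real.posLog (1 / |x|) = -Real.log |x| := by
  have hp := abs_pos.2 hx
  rw [Real.posLog_eq_log (by rw [abs_of_pos (by positivity)]; exact (one_le_div hp).2 h1), one_div,
    Real.log_inv]

lemma exp_log_eq {x : ℝ} (hx : x ≠ 0) (c : ℝ) : Real.exp (c * -Real.log |x|) = |x| ^ (-c) := by
  rw [Real.rpow_def_of_pos (abs_pos.2 hx)]; congr 1; ring

/-- The kernels `corrKernel` have a singularity of order `1/2 + 4γ²`, uniformly in `ε`. -/
lemma exists_abs_corrKernel_le (hX : IsLogRegularization P Xhat) (hN : IsRegularizedNorm N)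
    (γ : ℝ) : ∃ C, ∀ ε ∈ Ioc (0 : ℝ) 1, ∀ x,
      |corrKernel P γ Xhat (kEps N ε) ε x| ≤ C * |x| ^ (-(1 / 2 + 4 * γ ^ 2)) := by
  obtain ⟨c, hc, hNc⟩ := hN.lower
  obtain ⟨K, hK⟩ := hX.bound
  refine ⟨(c ^ (3 / 2 : ℝ))⁻¹ * Real.exp (4 * γ ^ 2 * K), fun ε hε x => ?_⟩
  rw [corrKernel, kEps]
  split_ifs with h
  · rcases eq_or_ne x 0 with rfl | hx
    · rw [zero_div, zero_mul, abs_zero]; positivity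
    · have hp := abs_pos.2 hx
      have h1 : |x / N ε x ^ (3 / 2 : ℝ)| ≤ (c ^ (3 / 2 : ℝ))⁻¹ * (|x| / |x| ^ (3 / 2 : ℝ)) := by
        rw [abs_div, abs_of_pos (Real.rpow_pos_of_pos (hN.pos ε hε x) _)]
        calc _ ≤ |x| / (c * |x|) ^ (3 / 2 : ℝ) := by
              gcongr; exact hNc ε hε x
          _ = _ := by rw [Real.mul_rpow hc.le hp.le]; field_simp
      have h2 : Real.exp (4 * γ ^ 2 * fieldCov P Xhat ε x) ≤
          Real.exp (4 * γ ^ 2 * K) * |x| ^ (-(4 * γ ^ 2)) := by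
        rw [← exp_log_eq hx, ← posLog_one_div_abs hx h, ← Real.exp_add, ← mul_add]
        refine Real.exp_le_exp.2 (mul_le_mul_of_nonneg_left ?_ (by positivity))
        rw [add_comm]
        exact hK ε hε x hx
      have h3 : |x| / |x| ^ (3 / 2 : ℝ) * |x| ^ (-(4 * γ ^ 2)) =
          |x| ^ (-(1 / 2 + 4 * γ ^ 2)) := by
        rw [show -(1 / 2 + 4 * γ ^ 2) = 1 - 3 / 2 + -(4 * γ ^ 2) by ring, Real.rpow_add hp,
          Real.rpow_sub hp, Real.rpow_one]
      rw [abs_mul, Real.abs_exp]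
      calc _ ≤ (c ^ (3 / 2 : ℝ))⁻¹ * (|x| / |x| ^ (3 / 2 : ℝ)) *
            (Real.exp (4 * γ ^ 2 * K) * |x| ^ (-(4 * γ ^ 2))) := by gcongr
        _ = (c ^ (3 / 2 : ℝ))⁻¹ * Real.exp (4 * γ ^ 2 * K) *
            (|x| / |x| ^ (3 / 2 : ℝ) * |x| ^ (-(4 * γ ^ 2))) := by ring
        _ = _ := by rw [h3]
  · rw [zero_mul, abs_zero]; positivity

lemma abs_rescale_le {C : ℝ} (hl : 0 < l) (h : ∀ x, |κ x| ≤ C * |x| ^ (-a)) (t : ℝ) :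
    |rescale a l κ t| ≤ C * |t| ^ (-a) := by
  have hp := Real.rpow_pos_of_pos hl a
  rw [rescale, abs_mul, abs_of_pos hp]
  calc _ ≤ l ^ a * (C * |l * t| ^ (-a)) := by gcongr; exact h _
    _ = C * |t| ^ (-a) := by
      rw [abs_mul, abs_of_pos hl, Real.mul_rpow hl.le (abs_nonneg t), Real.rpow_neg hl.le]
      field_simp

lemma tendsto_rescale_corrKernel (hX : IsLogRegularization P Xhat) (hN : IsRegularizedNorm N)
    (γ : ℝ) (hl : 0 < l) {t : ℝ} (ht : t ≠ 0) :
    Tendsto (fun ε => rescale (1 / 2 + 4 * γ ^ 2) l (corrKernel P γ Xhat (kEps N ε) ε) t) (𝓝[>] 0)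
      (𝓝 (limKernel (1 / 2 + 4 * γ ^ 2) l t)) := by
  have hx : l * t ≠ 0 := mul_ne_zero hl.ne' ht
  simp only [rescale, corrKernel, kEps, limKernel]
  split_ifs with h
  · have hp := abs_pos.2 hx
    have hpl := Real.rpow_pos_of_pos hl (1 / 2 + 4 * γ ^ 2)
    have h1 : Tendsto (fun ε => N ε (l * t) ^ (3 / 2 : ℝ)) (𝓝[>] 0) (𝓝 (|l * t| ^ (3 / 2 : ℝ))) :=
      (hN.tendsto (l * t)).rpow_const (Or.inl hp.ne')
    have h2 : Tendsto (fun ε => Real.exp (4 * γ ^ 2 * fieldCov P Xhat ε (l * t))) (𝓝[>] 0)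
        (𝓝 (Real.exp (4 * γ ^ 2 * Real.posLog (1 / |l * t|)))) :=
      (Real.continuous_exp.tendsto _).comp ((hX.tendsto _ hx).const_mul _)
    have h3 : Tendsto (fun ε => l ^ (1 / 2 + 4 * γ ^ 2) * (l * t / N ε (l * t) ^ (3 / 2 : ℝ) *
        Real.exp (4 * γ ^ 2 * fieldCov P Xhat ε (l * t)))) (𝓝[>] 0)
        (𝓝 (l ^ (1 / 2 + 4 * γ ^ 2) * (l * t / |l * t| ^ (3 / 2 : ℝ) *
          Real.exp (4 * γ ^ 2 * Real.posLog (1 / |l * t|))))) :=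
      ((tendsto_const_nhds.div h1 (Real.rpow_pos_of_pos hp _).ne').mul h2).const_mul _
    have e : l * t / |l * t| ^ (3 / 2 : ℝ) * |l * t| ^ (-(4 * γ ^ 2)) =
        oddPow (1 / 2 + 4 * γ ^ 2) (l * t) := by
      rw [oddPow, show 1 / 2 + 4 * γ ^ 2 + 1 = 3 / 2 + 4 * γ ^ 2 by ring, Real.rpow_add hp,
        Real.rpow_neg hp.le]
      field_simp
    have e' : l ^ (1 / 2 + 4 * γ ^ 2) * (l * t / |l * t| ^ (3 / 2 : ℝ) *
        Real.exp (4 * γ ^ 2 * Real.posLog (1 / |l * t|))) = oddPow (1 / 2 + 4 * γ ^ 2) t := by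
      rw [posLog_one_div_abs hx h, exp_log_eq hx, e, oddPow_mul _ hl, Real.rpow_neg hl.le,
        mul_inv_cancel_left₀ hpl.ne']
    rwa [e'] at h3
  · simp

/-- The third moment of the increments of the limit field. -/
def limThird (γ H : ℝ) (φ : ℝ → ℝ) (l : ℝ) : ℝ :=
  6 * (l ^ xi γ H 3 * ∫ t, limKernel (1 / 2 + 4 * γ ^ 2) l t *
    selfConv (limKernel (1 / 2 + 4 * γ ^ 2) l) t * incrCorr (scaledPower φ (H - 1 / 2) l) t)

lemma third_moment_rescale (φ : ℝ → ℝ) {x x' : ℝ} (hx : x' < x) :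
    ∫ h, κ h * selfConv κ h * cubicCorr (phiIncr H φ x x') h =
      (x - x') ^ xi γ H 3 * ∫ t, rescale (1 / 2 + 4 * γ ^ 2) (x - x') κ t *
        selfConv (rescale (1 / 2 + 4 * γ ^ 2) (x - x') κ) t *
        incrCorr (scaledPower φ (H - 1 / 2) (x - x')) t := by
  simp only [cubicCorr_phiIncr φ hx]
  rw [integral_rescale (a := 1 / 2 + 4 * γ ^ 2) (sub_pos.2 hx)]
  congr 2
  rw [xi]; ring

variable [IsProbabilityMeasure P]

/-- The limit `ε → 0`, at a fixed distance. -/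
lemma tendsto_third_moment (hX : IsLogRegularization P Xhat) (hN : IsRegularizedNorm N)
    (hγ_ne : γ ≠ 0) (hγ : γ ^ 2 < 1 / 8) (hH : H ∈ Ioo (0 : ℝ) 1) (hH_ne : H ≠ 1 / 2)
    (φ : SchwartzMap ℝ ℝ) (hφ : ∀ x, φ (-x) = φ x) {x x' : ℝ} (hx : x' < x) :
    Tendsto (fun ε => 6 * ∫ h, corrKernel P γ Xhat (kEps N ε) ε h *
      selfConv (corrKernel P γ Xhat (kEps N ε) ε) h * cubicCorr (phiIncr H φ x x') h) (𝓝[>] 0)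
      (𝓝 (limThird γ H φ (x - x'))) := by
  have hγ0 : 0 < γ ^ 2 := by positivity
  have hl : 0 < x - x' := sub_pos.2 hx
  have hα : |H - 1 / 2| < 1 / 2 := abs_lt.2 ⟨by linarith [hH.1], by linarith [hH.2]⟩
  obtain ⟨Ψ, hΨ, hΨb⟩ := exists_corr_dominating hα
  obtain ⟨C, hC, hpow⟩ := exists_isPowerLike φ hφ (hα.le.trans (by norm_num)) (sub_ne_zero.2 hH_ne)
  obtain ⟨C', hC'⟩ := exists_abs_corrKernel_le hX hN γ
  have hev : ∀ᶠ ε in 𝓝[>] (0 : ℝ), ε ∈ Ioc (0 : ℝ) 1 := Ioc_mem_nhdsGT one_pos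
  simp only [third_moment_rescale (γ := γ) φ hx]
  refine Tendsto.const_mul _ (Tendsto.const_mul _ ?_)
  have hΨ' := (hΨ (3 * (1 / 2 + 4 * γ ^ 2) - 1) (by linarith) (by linarith)).const_mul (C ^ 3)
  refine tendsto_integral_selfConv (a := 1 / 2 + 4 * γ ^ 2) (C := C')
    (Ψ := fun h => C ^ 3 * Ψ h) (by linarith) (by linarith) ?_ ?_
    (fun t ht => tendsto_rescale_corrKernel hX hN γ hl ht)
    (Eventually.of_forall fun ε => (hpow _).measurable_incrCorr) ?_
    (Eventually.of_forall fun ε => hΨb C _ hC (hpow _))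
    (Eventually.of_forall fun h => tendsto_const_nhds)
  · filter_upwards [hev] with ε hε
    have := (isOddKernel_corrKernel hX hε γ (hN.isOddKernel hε)).measurable
    unfold rescale
    fun_prop
  · filter_upwards [hev] with ε hε
    exact abs_rescale_le hl (hC' ε hε)
  · refine hΨ'.congr (Eventually.of_forall fun h => ?_)
    simp only
    ring

end Scaling

section Constant

variable {γ H : ℝ}

/-- At scale `l = 0` the cut-off function is the constant `φ(0)`. -/
lemma incrCorr_scaledPower_zero (φ : ℝ → ℝ) (H h : ℝ) :
    incrCorr (scaledPower φ (H - 1 / 2) 0) h = φ 0 ^ 3 * fH H h := by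
  have e : ∀ x : ℝ, |x| ^ (H - 1 / 2) = 1 / |x| ^ (1 / 2 - H) := fun x => by
    rw [one_div (|x| ^ _), ← Real.rpow_neg (abs_nonneg x), neg_sub]
  rw [incrCorr, fH, ← integral_const_mul]
  refine integral_congr_ae (Eventually.of_forall fun x => ?_)
  simp only [incr, scaledPower, zero_mul, e]
  ring

/-- The limit `x - y → 0` of the rescaled third moment. -/
lemma tendsto_limThird (hγ_ne : γ ≠ 0) (hγ : γ ^ 2 < 1 / 8) (hH : H ∈ Ioo (0 : ℝ) 1)
    (hH_ne : H ≠ 1 / 2) (φ : SchwartzMap ℝ ℝ) (hφ : ∀ x, φ (-x) = φ x) :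
    Tendsto (fun l => 6 * ∫ t, limKernel (1 / 2 + 4 * γ ^ 2) l t *
      selfConv (limKernel (1 / 2 + 4 * γ ^ 2) l) t * incrCorr (scaledPower φ (H - 1 / 2) l) t)
      (𝓝[>] 0) (𝓝 (6 * ∫ t, oddPow (1 / 2 + 4 * γ ^ 2) t *
        selfConv (oddPow (1 / 2 + 4 * γ ^ 2)) t * incrCorr (scaledPower φ (H - 1 / 2) 0) t)) := by
  have hγ0 : 0 < γ ^ 2 := by positivity
  have hα : |H - 1 / 2| < 1 / 2 := abs_lt.2 ⟨by linarith [hH.1], by linarith [hH.2]⟩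
  obtain ⟨Ψ, hΨ, hΨb⟩ := exists_corr_dominating hα
  obtain ⟨C, hC, hpow⟩ := exists_isPowerLike φ hφ (hα.le.trans (by norm_num)) (sub_ne_zero.2 hH_ne)
  have hΨ' := (hΨ (3 * (1 / 2 + 4 * γ ^ 2) - 1) (by linarith) (by linarith)).const_mul (C ^ 3)
  refine Tendsto.const_mul _ (tendsto_integral_selfConv (a := 1 / 2 + 4 * γ ^ 2) (C := 1)
    (Ψ := fun h => C ^ 3 * Ψ h)
    (by linarith) (by linarith) (Eventually.of_forall fun l => measurable_limKernel _ l)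
    (Eventually.of_forall fun l => abs_limKernel_le (by positivity) l)
    (fun t _ => tendsto_limKernel _ t)
    (Eventually.of_forall fun l => (hpow _).measurable_incrCorr) ?_
    (Eventually.of_forall fun l => hΨb C _ hC (hpow _)) ?_)
  · refine hΨ'.congr (Eventually.of_forall fun h => ?_)
    simp only
    ring
  · filter_upwards [ae_integrable_incrBound hα] with h hh
    refine tendsto_incrCorr hC (Eventually.of_forall hpow) (fun u => ?_) hh
    have h1 : Continuous fun l : ℝ => φ (l * u) * |u| ^ (H - 1 / 2) :=
      (φ.continuous.comp (by fun_prop)).mul continuous_const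
    exact (h1.tendsto 0).mono_left nhdsWithin_le_nhds

/-- The integrand is even, as a product of two odd functions and an even one, and on the half-line
the self-convolution of the kernel is `-r_γ` times a power. -/
lemma integral_eq_skewConst (h1 : 1 / 2 < 1 / 2 + 4 * γ ^ 2) (h2 : 1 / 2 + 4 * γ ^ 2 < 1)
    (hH : H ∈ Ioo (0 : ℝ) 1) (hH_ne : H ≠ 1 / 2) (φ : SchwartzMap ℝ ℝ) (hφ : ∀ x, φ (-x) = φ x) :
    6 * ∫ t, oddPow (1 / 2 + 4 * γ ^ 2) t * selfConv (oddPow (1 / 2 + 4 * γ ^ 2)) t *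
      incrCorr (scaledPower φ (H - 1 / 2) 0) t = skewConst γ H φ := by
  set a := 1 / 2 + 4 * γ ^ 2 with ha
  have hα : |H - 1 / 2| < 1 / 2 := abs_lt.2 ⟨by linarith [hH.1], by linarith [hH.2]⟩
  obtain ⟨C, hC, hpow⟩ := exists_isPowerLike φ hφ (hα.le.trans (by norm_num)) (sub_ne_zero.2 hH_ne)
  set g : ℝ → ℝ := fun t => oddPow a t * selfConv (oddPow a) t *
    incrCorr (scaledPower φ (H - 1 / 2) 0) t with hg
  have hev : ∀ t, g (-t) = g t := fun t => by
    simp only [hg]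
    rw [oddPow_neg, selfConv_neg (oddPow_neg a), (hpow 0).incrCorr_neg]
    ring
  have h3 : ∫ t, g t = 2 * ∫ t in Ioi 0, g t := by
    rw [← integral_comp_abs]
    refine integral_congr_ae (Eventually.of_forall fun t => ?_)
    rcases abs_choice t with h | h <;> simp only [h]
    exact (hev t).symm
  have h4 : ∫ t in Ioi 0, g t = -(rGamma γ * φ 0 ^ 3) *
      ∫ h in Ioi (0 : ℝ), fH H h * (1 / h ^ (1 / 2 + 12 * γ ^ 2)) := by
    rw [← integral_const_mul]
    refine setIntegral_congr_fun measurableSet_Ioi fun t ht => ?_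
    have ht' : 0 < t := ht
    simp only [hg]
    rw [oddPow_of_pos ht', selfConv_oddPow a ht', selfConv_oddPow_one, ← rGamma_eq h1 h2,
      incrCorr_scaledPower_zero, one_div (t ^ _), ← Real.rpow_neg ht'.le,
      show -(1 / 2 + 12 * γ ^ 2) = -a + (1 - 2 * a) by rw [ha]; ring, Real.rpow_add ht']
    ring
  rw [h3, h4, skewConst]
  ring

lemma skewConst_ne_zero (hγ_ne : γ ≠ 0) (hγ : γ ^ 2 < 1 / 8) (hH : H ∈ Ioo (0 : ℝ) 1)
    (hH_ne : H ≠ 1 / 2) (φ : SchwartzMap ℝ ℝ) (hφ : ∀ x, φ (-x) = φ x) (hφ_zero : φ 0 ≠ 0)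
    (hsign : ∀ h : ℝ, 0 < h → h ≠ 1 → 0 < (1 / 2 - H) * fH H h) : skewConst γ H φ ≠ 0 := by
  have hγ0 : 0 < γ ^ 2 := by positivity
  have hα : |H - 1 / 2| < 1 / 2 := abs_lt.2 ⟨by linarith [hH.1], by linarith [hH.2]⟩
  obtain ⟨Ψ, hΨ, hΨb⟩ := exists_corr_dominating hα
  obtain ⟨C, hC, hpow⟩ := exists_isPowerLike φ hφ (hα.le.trans (by norm_num)) (sub_ne_zero.2 hH_ne)
  have hr : 0 < rGamma γ := by
    rw [rGamma_eq (by linarith) (by linarith)]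
    exact integral_oddPow_mul_pos (by linarith) (by linarith)
  set F : ℝ → ℝ := fun h => (1 / 2 - H) * (fH H h * (1 / h ^ (1 / 2 + 12 * γ ^ 2))) with hF
  have hfm : Measurable (fH H) := by
    have h1 := ((hpow 0).measurable_incrCorr).const_mul (φ 0 ^ 3)⁻¹
    have e : (fun h => (φ 0 ^ 3)⁻¹ * incrCorr (scaledPower φ (H - 1 / 2) 0) h) = fH H := by
      ext h
      rw [incrCorr_scaledPower_zero, inv_mul_cancel_left₀ (pow_ne_zero 3 hφ_zero)]
    rwa [e] at h1
  have hint : IntegrableOn F (Ioi 0) := by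
    have h1 := (hΨ (1 / 2 + 12 * γ ^ 2) (by linarith) (by linarith)).const_mul
      (|1 / 2 - H| * (|φ 0| ^ 3)⁻¹ * C ^ 3)
    refine h1.integrableOn.mono' (by fun_prop) ?_
    rw [ae_restrict_iff' measurableSet_Ioi]
    filter_upwards [hΨb C _ hC (hpow 0)] with h hh ht
    have ht' : 0 < h := ht
    have hp : 0 < |φ 0| ^ 3 := by positivity
    rw [incrCorr_scaledPower_zero, abs_mul, abs_pow] at hh
    have h5 : |fH H h| ≤ (|φ 0| ^ 3)⁻¹ * (C ^ 3 * Ψ h) := by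
      rw [le_inv_mul_iff₀ hp]; exact hh
    rw [hF, norm_mul, norm_mul, Real.norm_eq_abs, Real.norm_eq_abs, Real.norm_eq_abs,
      one_div (h ^ _), abs_inv, abs_of_pos (Real.rpow_pos_of_pos ht' _),
      ← Real.rpow_neg ht'.le, abs_of_pos ht']
    calc _ ≤ |1 / 2 - H| * ((|φ 0| ^ 3)⁻¹ * (C ^ 3 * Ψ h) * h ^ (-(1 / 2 + 12 * γ ^ 2))) := by
          have := Real.rpow_nonneg ht'.le (-(1 / 2 + 12 * γ ^ 2))
          gcongr
      _ = _ := by ring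
  have hpos : ∀ h : ℝ, 0 < h → h ≠ 1 → 0 < F h := fun h h0 h1 => by
    rw [hF]
    simp only
    rw [← mul_assoc]
    exact mul_pos (hsign h h0 h1) (by positivity)
  have hI : 0 < ∫ h in Ioi (0 : ℝ), F h := by
    rw [setIntegral_pos_iff_support_of_nonneg_ae ?_ hint]
    · have hsub : Ioo (0 : ℝ) 1 ⊆ Function.support F ∩ Ioi 0 := fun h hh =>
        ⟨(hpos h hh.1 hh.2.ne).ne', hh.1⟩
      exact lt_of_lt_of_le (by simp) (measure_mono hsub)
    · rw [EventuallyLE, ae_restrict_iff' measurableSet_Ioi]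
      filter_upwards [(by simp [ae_iff] : ∀ᵐ h : ℝ, h ≠ 1)] with h h1 h0
      exact (hpos h h0 h1).le
  rw [hF, integral_const_mul] at hI
  rw [skewConst]
  refine mul_ne_zero (mul_ne_zero (mul_ne_zero (by norm_num) hr.ne') (pow_ne_zero 3 hφ_zero)) ?_
  exact fun h => by rw [h, mul_zero] at hI; exact lt_irrefl _ hI

lemma isEquivalent_limThird (hγ_ne : γ ≠ 0) (hγ : γ ^ 2 < 1 / 8) (hH : H ∈ Ioo (0 : ℝ) 1)
    (hH_ne : H ≠ 1 / 2) (φ : SchwartzMap ℝ ℝ) (hφ : ∀ x, φ (-x) = φ x)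
    (hc : skewConst γ H φ ≠ 0) :
    Asymptotics.IsEquivalent (𝓝[>] 0) (limThird γ H φ)
      (fun l => skewConst γ H φ * l ^ xi γ H 3) := by
  have hγ0 : 0 < γ ^ 2 := by positivity
  have h := tendsto_limThird hγ_ne hγ hH hH_ne φ hφ
  rw [integral_eq_skewConst (by linarith) (by linarith) hH hH_ne φ hφ] at h
  have h1 := ((Asymptotics.isEquivalent_const_iff_tendsto hc).2 h).mul
    (Asymptotics.IsEquivalent.refl (u := fun l : ℝ => l ^ xi γ H 3) (l := 𝓝[>] 0))
  refine h1.congr_left (Eventually.of_forall fun l => ?_)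
  simp only [Pi.mul_apply, limThird]
  ring

end Constant

end SkewField

end

theorem proposition3 {Ω : Type*} [MeasurableSpace Ω] (P : Measure Ω) [IsProbabilityMeasure P]
    (γ H : ℝ) (hγ_ne : γ ≠ 0) (hγ : γ ^ 2 < 1 / 8) (hH : H ∈ Ioo (0 : ℝ) 1) (hH_ne : H ≠ 1 / 2)
    (φ : SchwartzMap ℝ ℝ) (hφ_even : ∀ x, φ (-x) = φ x) (hφ_zero : φ 0 ≠ 0)
    (N : ℝ → ℝ → ℝ) (hN : IsRegularizedNorm N)
    (W : FinSet → Ω → ℝ) (hW : IsWhiteNoise P W)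
    (Xhat : ℝ → ℝ → Ω → ℝ) (hX : IsLogRegularization P Xhat)
    (hXW : ∀ ε ∈ Ioc (0 : ℝ) 1, IndepFun (fun ω x => Xhat ε x ω) (fun ω A => W A ω) P)
    (hsign : ∀ h : ℝ, 0 < h → h ≠ 1 → 0 < (1 / 2 - H) * fH H h) :
    -- the fields `u_ε` are well defined
    (∀ ε ∈ Ioc (0 : ℝ) 1, ∀ x, IsDoubleIntegral (fieldSigma Xhat ε) P W
      (fieldKernel P γ H φ N Xhat ε x) (uEps P γ H φ N W Xhat ε x)) ∧
    -- the third moments of their increments exist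
    (∀ ε ∈ Ioc (0 : ℝ) 1, ∀ x y, Integrable
      (fun ω => (uEps P γ H φ N W Xhat ε x ω - uEps P γ H φ N W Xhat ε y ω) ^ 3) P) ∧
    -- as `ε → 0` they converge, to the third moment `S (x - y)` of the increments of the limit `u`
    ∃ S : ℝ → ℝ,
      (∀ x y, y < x → Tendsto
        (fun ε => ∫ ω, (uEps P γ H φ N W Xhat ε x ω - uEps P γ H φ N W Xhat ε y ω) ^ 3 ∂P)
        (𝓝[>] 0) (𝓝 (S (x - y)))) ∧
      -- its equivalent at small scales, with a non-vanishing constant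
      skewConst γ H φ ≠ 0 ∧
      Asymptotics.IsEquivalent (𝓝[>] 0) S (fun l => skewConst γ H φ * l ^ xi γ H 3) := by
  have hc := skewConst_ne_zero hγ_ne hγ hH hH_ne φ hφ_even hφ_zero hsign
  refine ⟨fun ε hε x => isDoubleIntegral_uEps hX hε hH φ hN hW (hXW ε hε) γ x,
    fun ε hε x y => (integral_uEps_sub_cube hX hε hH φ hN hW (hXW ε hε) γ x y).1,
    limThird γ H φ, fun x y hxy => ?_, hc,
    isEquivalent_limThird hγ_ne hγ hH hH_ne φ hφ_even hc⟩
  refine (tendsto_third_moment hX hN hγ_ne hγ hH hH_ne φ hφ_even hxy).congr' ?_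
  filter_upwards [Ioc_mem_nhdsGT one_pos] with ε hε
  exact (integral_uEps_sub_cube hX hε hH φ hN hW (hXW ε hε) γ x y).2.symm
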